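/- **Setting.** A *fibered space group* is a discrete cocompact group $G$ of isometries $g=(h,v):(x,y,z)\mapsto(h(x,y),v(z))$ of Euclidean 3-space preserving the fibration by vertical lines and containing a nontrivial vertical translation. Its horizontal parts $h$ form a plane crystallographic group $H$. Write $c+$ for $z\mapsto c+z$ and $c-$ for $z\mapsto c-z$; $h$ is *coupled* with $v$ if $(h,v)\in G$, and *plus-* or *minus-coupled* according to the sign of $v$. Let $k>0$ be least such that $1$ is coupled with $k+$; all constants below are measured in units of $k$. The fibration is *interval*, written $[\,]$, if $1$ is coupled with some $c-$; otherwise it is *circular*, written $(\,)$. For interval fibrations every element is plus-coupled and only plus couplings are used below. An *isotopy* of fibered space groups is a pointwise continuous family $(\phi_t)_{0\le t\le1}$ of injective homomorphisms of $G$ onto fibered space groups, with $\phi_0$ the identity, under which the elements with trivial horizontal part remain the same. **Generators.** Let $\sigma$ be one of the 17 Euclidean orbifold symbols $*632$, $632$, $*442$, $4{*}2$, $442$, $*333$, $3{*}3$, $333$, $*2222$, $2{*}22$, $22*$, $22\times$, $2222$, $**$, $*\times$, $\times\times$, $\circ$. *Standard generators* of $H$ for $\sigma$ are generators $X,Y$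 for each ring $\circ$, $\gamma$ for each gyration digit $G$, $\lambda,P,Q,\dots,R,S$ for each kaleidoscope $*AB\cdots C$, and $Z$ for each cross $\times$, giving a presentation of $H$ with relations $\gamma^G=1$; $1=P^2=(PQ)^A=Q^2=\dots=R^2=(RS)^C=S^2$ and $\lambda^{-1}P\lambda=S$; and the global relation $\alpha\cdots\gamma\cdots\lambda\cdots\omega\cdots=1$, the factors taken in the order of the symbol, where $\alpha=[X,Y]=X^{-1}Y^{-1}XY$ and $\omega=Z^2$. They are *admissible* if $X,Y$ of each ring couple to the same sign and, for interval fibrations, to the same translation. **Name.** The *fibrifold name* of $G$ with respect to admissible standard generators is $\sigma$ with the brackets $[\,]$ or $(\,)$ and the following embellishments. Simple ones: $\circ$, $*$, $\times$ is barred iff $X$ (and $Y$), $\lambda$, $Z$ respectively is minus-coupled. A digit $n$ belonging to $h=\gamma$ or $h=PQ$ gets the subscript $a$ $(0\le a<n)$ if $h$ is coupled to $\frac an+$, and none if $h$ is minus-coupled. A Latin generator is marked by one dot, two dots or a blank according as it is coupled to $0+$, $\frac12+$, or is minus-coupled. Subscripts $i\in\{0,1\}$, interval case: $\circ$, $*$,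 $\times$ gets $i$ if $X$ and $Y$, respectively $\lambda$, $Z$, are coupled to $\frac i2+$. Subscripts $i\in\{0,1\}$, circular case: - The barred rings get $i$, where $X\mapsto x-$, $Y\mapsto y-$, the sum of $x-y$ over the barred rings is $\frac{i-\kappa}2$ modulo $1$, and the remaining factors of the global relation couple to $\kappa+$, $0\le\kappa<1$. Unbarred rings get none. - A kaleidoscope all of whose Latin generators are minus-coupled, so that its digits are $A_aB_b\cdots C_c$, gets $i$, where with $\Sigma=\frac aA+\frac bB+\dots+\frac cC$ we have $l=\frac{\Sigma+i}2$ modulo $1$ if $\lambda\mapsto l+$, and $p-l=\frac{\Sigma+i}2$ modulo $1$ if $\lambda\mapsto l-$, $P\mapsto p-$. Other kaleidoscopes get none. - The unbarred crosses get $i$, where $Z\mapsto z+$, the sum of $z$ over them is $\frac{-\kappa+i}2$ modulo $1$, and the factors preceding the crosses in the global relation couple to $\kappa+$, $0\le\kappa<1$; this subscript is used only if $\kappa$ cannot be varied continuously, i.e. if all $X$, $\gamma$ and $\lambda$ are plus-coupled and all Latin generators are minus-coupled. Barred crosses get none. **Theorem.** Let $\sigma$ be one of these symbols. 1. If $G$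 is a fibered space group whose plane group $H$ has standard generators for $\sigma$, then $H$ has admissible ones, and with respect to any admissible standard generators $G$ has exactly one fibrifold name. 2. Let $G_0,G_1$ be fibered space groups whose plane groups $H_0,H_1$ have standard generators $s_0,s_1$ for $\sigma$, with respect to which $G_0$ and $G_1$ have the same name. (a) If $s_0=s_1$ (so $H_0=H_1$), there is an isotopy from $G_0$ to $G_1$ that keeps all horizontal parts fixed: the name determines the coupling maps over the given plane group up to continuous variation. (b) In general, $G_1$ is isotopic to $G_0$ or to the mirror image of $G_0$ in a vertical plane, by an isotopy that carries the generators $s_0$ (or their mirror images) to $s_1$. So no further embellishments are needed. -/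

import Mathlib

noncomputable section

namespace Fibrifold

/-! ### Fibered space groups -/

/-- The Euclidean plane. -/
abbrev Plane : Type := EuclideanSpace ℝ (Fin 2)

/-- The isometries of Euclidean 3-space that preserve the fibration by vertical lines: each one is
`(x, y, z) ↦ (h (x, y), v z)` for a unique isometry `h` of the plane (its horizontal part) and a
unique isometry `v` of the line (its vertical part). -/
abbrev FibIsom : Type := (Plane ≃ᵢ Plane) × (ℝ ≃ᵢ ℝ)

/-- The vertical operation `c+`, i.e. `z ↦ c + z`. -/
def plus (c : ℝ) : ℝ ≃ᵢ ℝ := IsometryEquiv.addLeft c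

/-- The vertical operation `c-`, i.e. `z ↦ c - z`. -/
def minus (c : ℝ) : ℝ ≃ᵢ ℝ := IsometryEquiv.subLeft c

theorem plus_apply (c z : ℝ) : plus c z = c + z := rfl

theorem minus_apply (c z : ℝ) : minus c z = c - z := rfl

/-- The action on 3-space, with points written as (horizontal part, height). -/
def act (g : FibIsom) (p : Plane × ℝ) : Plane × ℝ := (g.1 p.1, g.2 p.2)

/-- A fibered space group, the invariant direction being vertical: a discrete cocompact group of
isometries preserving the fibration by vertical lines, the fibers of the quotient being compact
(circles or intervals), i.e. the group contains a nontrivial vertical translation. -/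
structure IsFiberedSpaceGroup (G : Subgroup FibIsom) : Prop where
  discrete : ∀ B : Set (Plane × ℝ), IsCompact B →
    {g : FibIsom | g ∈ G ∧ (act g '' B ∩ B).Nonempty}.Finite
  cocompact : ∃ B : Set (Plane × ℝ), IsCompact B ∧ ∀ p, ∃ g ∈ G, p ∈ act g '' B
  compact_fibers : ∃ k : ℝ, 0 < k ∧ ((1, plus k) : FibIsom) ∈ G

/-- The plane group `H` of the horizontal parts of the elements of `G`. A horizontal operation `h`
is coupled with a vertical operation `v` if and only if `(h, v) ∈ G`. -/
def horizontal (G : Subgroup FibIsom) : Subgroup (Plane ≃ᵢ Plane) :=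
  G.map (MonoidHom.fst (Plane ≃ᵢ Plane) (ℝ ≃ᵢ ℝ))

/-- `k` is the smallest positive number such that the identity is coupled with `k+`. -/
def IsFiberLength (G : Subgroup FibIsom) (k : ℝ) : Prop :=
  IsLeast {c : ℝ | 0 < c ∧ ((1, plus c) : FibIsom) ∈ G} k

/-- Interval fibrations: the identity is coupled with some `c-`. Otherwise the fibration is
circular. -/
def IsInterval (G : Subgroup FibIsom) : Prop := ∃ c : ℝ, ((1, minus c) : FibIsom) ∈ G

/-- `h` is plus-coupled. For a circular fibration every element of the plane group is either
plus-coupled or minus-coupled and not both; for an interval fibration every element is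
plus-coupled (as well as minus-coupled), and only the plus form is used. -/
def IsPlus (G : Subgroup FibIsom) (h : Plane ≃ᵢ Plane) : Prop := ∃ c : ℝ, (h, plus c) ∈ G

/-! ### Isotopy -/

/-- An isotopy (continuous variation) of fibered space groups from `G₀` to `G₁`: a continuous
family of faithful representations `φ t` of `G₀`, for `t ∈ [0, 1]`, whose images are fibered space
groups (the operations with trivial horizontal part remaining the same ones), starting at the
inclusion of `G₀` and ending with image `G₁`. -/
structure Isotopy (G₀ G₁ : Subgroup FibIsom) where
  φ : Set.Icc (0 : ℝ) 1 → (G₀ →* FibIsom)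
  injective : ∀ t, Function.Injective (φ t)
  fibered : ∀ t, IsFiberedSpaceGroup (φ t).range
  kernel : ∀ t g, (φ t g).1 = 1 ↔ (g : FibIsom).1 = 1
  continuous : ∀ g p, Continuous fun t => act (φ t g) p
  start : ∀ g, φ 0 g = (g : FibIsom)
  finish : (φ 1).range = G₁

/-- The reflection of the plane in a coordinate axis. -/
def planeFlip : Plane ≃ᵢ Plane :=
  (LinearIsometryEquiv.piLpCongrRight 2 (fun i : Fin 2 =>
    if i = 0 then LinearIsometryEquiv.neg ℝ else LinearIsometryEquiv.refl ℝ ℝ)).toIsometryEquiv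

/-- The mirror image of `G` in a vertical plane. -/
def mirrorImage (G : Subgroup FibIsom) : Subgroup FibIsom :=
  G.map (MulAut.conj ((planeFlip, 1) : FibIsom)).toMonoidHom

/-! ### Orbifold symbols and their generators -/

/-- An orbifold symbol `○ ⋯ ○ G ⋯ G' ∗A B ⋯ C ⋯ ∗A' ⋯ C' × ⋯ ×`. -/
structure OrbifoldSymbol where
  rings : ℕ
  gyrations : List ℕ
  kaleidoscopes : List (List ℕ)
  crosses : ℕ

/-- The symbols of the 17 plane crystallographic groups:
`∗632, 632, ∗442, 4∗2, 442, ∗333, 3∗3, 333, ∗2222, 2∗22, 22∗, 22×, 2222, ∗∗, ∗×, ××, ○`. -/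
def euclideanSymbols : List OrbifoldSymbol :=
  [⟨0, [], [[6, 3, 2]], 0⟩, ⟨0, [6, 3, 2], [], 0⟩,
   ⟨0, [], [[4, 4, 2]], 0⟩, ⟨0, [4], [[2]], 0⟩, ⟨0, [4, 4, 2], [], 0⟩,
   ⟨0, [], [[3, 3, 3]], 0⟩, ⟨0, [3], [[3]], 0⟩, ⟨0, [3, 3, 3], [], 0⟩,
   ⟨0, [], [[2, 2, 2, 2]], 0⟩, ⟨0, [2], [[2, 2]], 0⟩, ⟨0, [2, 2], [[]], 0⟩,
   ⟨0, [2, 2], [], 1⟩, ⟨0, [2, 2, 2, 2], [], 0⟩,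
   ⟨0, [], [[], []], 0⟩, ⟨0, [], [[]], 1⟩, ⟨0, [], [], 2⟩, ⟨1, [], [], 0⟩]

variable (σ : OrbifoldSymbol)

/-- The number of digits of the `i`-th kaleidoscope symbol. -/
abbrev OrbifoldSymbol.len (i : Fin σ.kaleidoscopes.length) : ℕ := (σ.kaleidoscopes.get i).length

/-- The `j`-th digit of the `i`-th kaleidoscope symbol. -/
def OrbifoldSymbol.digit (i : Fin σ.kaleidoscopes.length) (j : Fin (σ.len i)) : ℕ :=
  (σ.kaleidoscopes.get i).get j

/-- The generators belonging to a symbol: `X, Y` for a ring, `γ` for a gyration, `lam` (that is,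
`λ`) and the Latin generators `P, Q, …, R, S` (one more than there are digits) for a kaleidoscope,
`Z` for a cross. -/
inductive Gen : Type
  | X (i : Fin σ.rings)
  | Y (i : Fin σ.rings)
  | γ (i : Fin σ.gyrations.length)
  | lam (i : Fin σ.kaleidoscopes.length)
  | P (i : Fin σ.kaleidoscopes.length) (j : Fin (σ.len i + 1))
  | Z (i : Fin σ.crosses)

section words

variable {σ} {Γ : Type} [Group Γ] (s : Gen σ → Γ)

/-- The product of the commutators `α = [X, Y] = X⁻¹ Y⁻¹ X Y` of the rings. -/
def ringProd : Γ :=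
  (List.ofFn fun i : Fin σ.rings =>
    (s (.X i))⁻¹ * (s (.Y i))⁻¹ * s (.X i) * s (.Y i)).prod

/-- The product of the `γ`s. -/
def gyrProd : Γ := (List.ofFn fun i : Fin σ.gyrations.length => s (.γ i)).prod

/-- The product of the `λ`s. -/
def lamProd : Γ := (List.ofFn fun i : Fin σ.kaleidoscopes.length => s (.lam i)).prod

/-- The product of the elements `ω = Z²` of the crosses. -/
def crossProd : Γ := (List.ofFn fun i : Fin σ.crosses => s (.Z i) ^ 2).prod

end words

/-- The left hand sides of the defining relations `w = 1`: `γ ^ G = 1`;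
`1 = P² = (PQ)^A = Q² = ⋯ = R² = (RS)^C = S²` and `λ⁻¹ P λ = S`;
and the global relation `α ⋯ γ ⋯ λ ⋯ ω = 1`. -/
inductive Relator : FreeGroup (Gen σ) → Prop
  | gyration (i : Fin σ.gyrations.length) :
      Relator (FreeGroup.of (.γ i) ^ σ.gyrations.get i)
  | mirror (i : Fin σ.kaleidoscopes.length) (j : Fin (σ.len i + 1)) :
      Relator (FreeGroup.of (.P i j) ^ 2)
  | corner (i : Fin σ.kaleidoscopes.length) (j : Fin (σ.len i)) :
      Relator ((FreeGroup.of (.P i j.castSucc) * FreeGroup.of (.P i j.succ)) ^ σ.digit i j)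
  | around (i : Fin σ.kaleidoscopes.length) :
      Relator ((FreeGroup.of (.lam i))⁻¹ * FreeGroup.of (.P i 0) * FreeGroup.of (.lam i) *
        (FreeGroup.of (.P i (Fin.last _)))⁻¹)
  | global :
      Relator (ringProd FreeGroup.of * gyrProd FreeGroup.of * lamProd FreeGroup.of *
        crossProd FreeGroup.of)

variable {σ}

/-- `s` is a system of standard generators of the plane group `H`, for the symbol `σ`: `H` is
presented by the generators `s` and the relations of `σ`. -/
def IsStandard (H : Subgroup (Plane ≃ᵢ Plane)) (s : Gen σ → (Plane ≃ᵢ Plane)) : Prop :=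
  ∃ e : PresentedGroup {w : FreeGroup (Gen σ) | Relator σ w} ≃* H,
    ∀ x, (e (PresentedGroup.of x) : Plane ≃ᵢ Plane) = s x

/-- The convention under which a ring symbol is embellished: `X` and `Y` couple to the same sign,
and, for interval fibrations, to the same translation. -/
def IsAdmissible (G : Subgroup FibIsom) (s : Gen σ → (Plane ≃ᵢ Plane)) : Prop :=
  ∀ i : Fin σ.rings, (IsPlus G (s (.X i)) ↔ IsPlus G (s (.Y i))) ∧
    (IsInterval G → ∃ c : ℝ, (s (.X i), plus c) ∈ G ∧ (s (.Y i), plus c) ∈ G)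

/-! ### Fibrifold names -/

/-- The marks for a Latin generator: one dot, two dots, or a blank. -/
inductive MirrorMark : Type
  | dot
  | colon
  | blank

variable (σ) in
/-- A fibrifold name: the orbifold symbol `σ` with its embellishments. `interval` tells `[ ]` from
`( )`, a `Bar` field tells whether the symbol is barred, a `Sub` field gives the subscript, if
there is one. The subscripts on rings, stars and crosses are `0` or `1`. -/
structure Name where
  interval : Bool
  ringBar : Fin σ.rings → Bool
  ringSub : Fin σ.rings → Option (Fin 2)
  gyrSub : Fin σ.gyrations.length → Option ℕ
  starBar : Fin σ.kaleidoscopes.length → Bool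
  starSub : Fin σ.kaleidoscopes.length → Option (Fin 2)
  mirrorMark : (i : Fin σ.kaleidoscopes.length) → Fin (σ.len i + 1) → MirrorMark
  digitSub : (i : Fin σ.kaleidoscopes.length) → Fin (σ.len i) → Option ℕ
  crossBar : Fin σ.crosses → Bool
  crossSub : Fin σ.crosses → Option (Fin 2)

/-- The embellishment of a digit `n` for an operation `h` with `h ^ n = 1`: subscript `a` if `h` is
coupled to `(a/n)+` (in units of the fiber length `k`), no subscript if `h` is minus-coupled. -/
def DigitRule (G : Subgroup FibIsom) (k : ℝ) (n : ℕ) (h : Plane ≃ᵢ Plane) : Option ℕ → Prop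
  | some a => a < n ∧ (h, plus (k * ((a : ℝ) / (n : ℝ)))) ∈ G
  | none => ¬ IsPlus G h

/-- The mark of a Latin generator: one dot for `0+`, two dots for `(1/2)+`, blank if it is
minus-coupled. -/
def MirrorRule (G : Subgroup FibIsom) (k : ℝ) (h : Plane ≃ᵢ Plane) : MirrorMark → Prop
  | .dot => (h, plus 0) ∈ G
  | .colon => (h, plus (k * (1 / 2))) ∈ G
  | .blank => ¬ IsPlus G h

/-- The simple embellishments, with `k` the fiber length. -/
structure SimpleRule (G : Subgroup FibIsom) (s : Gen σ → (Plane ≃ᵢ Plane)) (k : ℝ)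
    (N : Name σ) : Prop where
  interval : N.interval = true ↔ IsInterval G
  ring : ∀ i, N.ringBar i = true ↔ ¬ IsPlus G (s (.X i))
  gyration : ∀ i, DigitRule G k (σ.gyrations.get i) (s (.γ i)) (N.gyrSub i)
  star : ∀ i, N.starBar i = true ↔ ¬ IsPlus G (s (.lam i))
  mirror : ∀ i j, MirrorRule G k (s (.P i j)) (N.mirrorMark i j)
  corner : ∀ i j, DigitRule G k (σ.digit i j) (s (.P i j.castSucc) * s (.P i j.succ))
    (N.digitSub i j)
  cross : ∀ i, N.crossBar i = true ↔ ¬ IsPlus G (s (.Z i))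

/-- The subscripts for interval fibrations: `i` if the generators (both `X` and `Y` for a ring,
`λ` for a star, `Z` for a cross) couple to `(i/2)+`. -/
structure IntervalRule (G : Subgroup FibIsom) (s : Gen σ → (Plane ≃ᵢ Plane)) (k : ℝ)
    (N : Name σ) : Prop where
  ring : ∀ i, ∃ e : Fin 2, N.ringSub i = some e ∧
    (s (.X i), plus (k * ((e : ℕ) / 2))) ∈ G ∧ (s (.Y i), plus (k * ((e : ℕ) / 2))) ∈ G
  star : ∀ i, ∃ e : Fin 2, N.starSub i = some e ∧ (s (.lam i), plus (k * ((e : ℕ) / 2))) ∈ G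
  cross : ∀ i, ∃ e : Fin 2, N.crossSub i = some e ∧ (s (.Z i), plus (k * ((e : ℕ) / 2))) ∈ G

/-- All Latin generators of the `i`-th kaleidoscope are minus-coupled (circular fibrations). -/
def AllMinus (G : Subgroup FibIsom) (s : Gen σ → (Plane ≃ᵢ Plane))
    (i : Fin σ.kaleidoscopes.length) : Prop := ∀ j, ¬ IsPlus G (s (.P i j))

/-- The sum `Σ = a/A + b/B + ⋯ + c/C` for a kaleidoscope embellished to `A_a B_b ⋯ C_c`. -/
def Name.digitSum (N : Name σ) (i : Fin σ.kaleidoscopes.length) : ℝ :=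
  ∑ j, (((N.digitSub i j).getD 0 : ℕ) : ℝ) / (σ.digit i j : ℝ)

/-- `x - y + ⋯ + u - v = (e - κ)/2`, where `X, Y, …, U, V` are the generators of the barred rings,
`X` couples to `x-`, and so on, and where the product of the other factors of the global relation
couples to `κ+`, with `0 ≤ κ < 1` (all constants in units of `k`). -/
def RingEquation (G : Subgroup FibIsom) (s : Gen σ → (Plane ≃ᵢ Plane)) (k : ℝ) (N : Name σ)
    (e : Fin 2) : Prop :=
  ∃ (κ : ℝ) (x y : Fin σ.rings → ℝ), 0 ≤ κ ∧ κ < 1 ∧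
    (gyrProd s * lamProd s * crossProd s, plus (k * κ)) ∈ G ∧
    (∀ i, N.ringBar i = true →
      (s (.X i), minus (k * x i)) ∈ G ∧ (s (.Y i), minus (k * y i)) ∈ G) ∧
    (∑ i, if N.ringBar i = true then x i - y i else 0) = ((e : ℕ) - κ) / 2

/-- `l = (Σ + e)/2` if `λ` couples to `l+`, and `p - l = (Σ + e)/2` if `λ` couples to `l-` and the
first Latin generator `P` couples to `p-`. -/
def StarEquation (G : Subgroup FibIsom) (s : Gen σ → (Plane ≃ᵢ Plane)) (k : ℝ) (N : Name σ)
    (i : Fin σ.kaleidoscopes.length) (e : Fin 2) : Prop :=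
  (s (.lam i), plus (k * ((N.digitSum i + (e : ℕ)) / 2))) ∈ G ∨
  ∃ p l : ℝ, (s (.P i 0), minus (k * p)) ∈ G ∧ (s (.lam i), minus (k * l)) ∈ G ∧
    p - l = (N.digitSum i + (e : ℕ)) / 2

/-- `y + ⋯ + z = (-κ + e)/2`, where `Y, …, Z` are the generators of the crosses without bar, `Y`
couples to `y+`, and so on, and where the product of the preceding factors of the global relation
couples to `κ+`, with `0 ≤ κ < 1` (all constants in units of `k`). -/
def CrossEquation (G : Subgroup FibIsom) (s : Gen σ → (Plane ≃ᵢ Plane)) (k : ℝ) (N : Name σ)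
    (e : Fin 2) : Prop :=
  ∃ (κ : ℝ) (z : Fin σ.crosses → ℝ), 0 ≤ κ ∧ κ < 1 ∧
    (ringProd s * gyrProd s * lamProd s, plus (k * κ)) ∈ G ∧
    (∀ i, N.crossBar i = false → (s (.Z i), plus (k * z i)) ∈ G) ∧
    (∑ i, if N.crossBar i = false then z i else 0) = (-κ + (e : ℕ)) / 2

/-- The constant `κ` of the product of the factors of the global relation that precede the crosses
cannot be varied continuously: each of these factors couples to a translation `c+` with `c`
restricted to finitely many values modulo the fiber length. -/
def Rigid (G : Subgroup FibIsom) (s : Gen σ → (Plane ≃ᵢ Plane)) : Prop :=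
  (∀ i, IsPlus G (s (.X i))) ∧ (∀ i, IsPlus G (s (.γ i))) ∧
    ∀ i, IsPlus G (s (.lam i)) ∧ AllMinus G s i

/-- The subscripts for circular fibrations. A ring has one if it is barred, a star if all its Latin
generators are minus-coupled, a cross if it has no bar and the constant in its equation cannot be
varied continuously; the crosses without bar share one subscript, and so do the barred rings. -/
structure CircularRule (G : Subgroup FibIsom) (s : Gen σ → (Plane ≃ᵢ Plane)) (k : ℝ)
    (N : Name σ) : Prop where
  ring_same : ∀ i, IsPlus G (s (.X i)) ↔ IsPlus G (s (.Y i))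
  ring_none : ∀ i, N.ringBar i = false → N.ringSub i = none
  ring_some : ∀ i, N.ringBar i = true → ∃ e : Fin 2, N.ringSub i = some e ∧ RingEquation G s k N e
  star_none : ∀ i, ¬ AllMinus G s i → N.starSub i = none
  star_some : ∀ i, AllMinus G s i → ∃ e : Fin 2, N.starSub i = some e ∧ StarEquation G s k N i e
  cross_none : ∀ i, N.crossBar i = true ∨ ¬ Rigid G s → N.crossSub i = none
  cross_some : ∀ i, N.crossBar i = false → Rigid G s →
    ∃ e : Fin 2, N.crossSub i = some e ∧ CrossEquation G s k N e

/-- `N` is the fibrifold name of `G` with respect to the standard generators `s`. -/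
def HasName (G : Subgroup FibIsom) (s : Gen σ → (Plane ≃ᵢ Plane)) (N : Name σ) : Prop :=
  ∃ k : ℝ, IsFiberLength G k ∧ SimpleRule G s k N ∧
    (IsInterval G → IntervalRule G s k N) ∧ (¬ IsInterval G → CircularRule G s k N)

end Fibrifold

end

open Fibrifold

noncomputable section

namespace Fibrifold

section

/-! ### Vertical operations -/

/-! A coupling amounts to vertical operations attached to the standard generators of `H`, and each
relation of `H` becomes a condition on their constants modulo the fiber length. With constants in
units of `k`: `h ^ n = 1` with `h ↦ c+` makes `n c` an integer, the relation around a kaleidoscope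
of minus-coupled mirrors fixes twice the constant of `λ` (or of `p - l`), and the global relation
fixes twice a sum over the barred rings or the unbarred crosses. The subscripts record the choices
that remain. Hence names exist, and they are unique because constants are well defined modulo `k`.
Admissibility concerns only `○`, where replacing `X` by `XY` or `Y` by `YX` suffices.

For two circular groups with the same name, the differences of their vertical parts, each measured
in its own unit, form a coupling `difference` in which every embellishment is trivial
(`isTrivialCoupling_difference`). Such a coupling splits (`IsTrivialCoupling.exists_relations`): the
relations can be satisfied one symbol at a time, and the integer defect left in the global relation
is absorbed by a minus-coupled `γ` or by a `λ` that is free to move; if there is neither, the cross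
subscript makes the defect vanish. A splitting yields a real-valued cocycle `D`, and the multiples
`t D` with `0 ≤ t ≤ 1`, together with a linear rescaling of the fiber, join the two couplings
(`exists_isotopy`). For interval fibrations the name gives a plus coupling of every generator, and
`D` only has to shift the reflections by one constant.

When the plane groups differ, the isomorphism matching the generators is conjugation by an affine
map (`exists_affine_conj`, Bieberbach's theorem in the plane). In a complex coordinate this map is
`z ↦ a z + β conj z + c` with `‖a‖ ≠ ‖β‖`. If `‖β‖ < ‖a‖` it is joined to the identity by affine
maps that all conjugate `H` to isometries (`exists_affine_path`); if `‖a‖ < ‖β‖`, composing with a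
reflection exchanges the two coefficients, and the mirror image of the group is deformed instead. -/

theorem plus_zero : plus 0 = 1 := by ext z; simp [plus_apply]

theorem plus_mul_plus (a b : ℝ) : plus a * plus b = plus (a + b) := by
  ext z; simp only [IsometryEquiv.mul_apply, plus_apply]; ring

theorem plus_mul_minus (a b : ℝ) : plus a * minus b = minus (a + b) := by
  ext z; simp only [IsometryEquiv.mul_apply, plus_apply, minus_apply]; ring

theorem minus_mul_plus (a b : ℝ) : minus a * plus b = minus (a - b) := by
  ext z; simp only [IsometryEquiv.mul_apply, plus_apply, minus_apply]; ring

theorem minus_mul_minus (a b : ℝ) : minus a * minus b = plus (a - b) := by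
  ext z; simp only [IsometryEquiv.mul_apply, plus_apply, minus_apply]; ring

theorem plus_inv (a : ℝ) : (plus a)⁻¹ = plus (-a) :=
  inv_eq_of_mul_eq_one_right (by rw [plus_mul_plus, add_neg_cancel, plus_zero])

theorem minus_inv (a : ℝ) : (minus a)⁻¹ = minus a :=
  inv_eq_of_mul_eq_one_right (by rw [minus_mul_minus, sub_self, plus_zero])

theorem plus_pow (a : ℝ) (n : ℕ) : plus a ^ n = plus (n * a) := by
  induction n with
  | zero => simp [plus_zero]
  | succ n ih => rw [pow_succ, ih, plus_mul_plus]; congr 1; push_cast; ring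

theorem minus_sq (a : ℝ) : minus a ^ 2 = 1 := by
  rw [pow_two, minus_mul_minus, sub_self, plus_zero]

theorem plus_injective : Function.Injective plus := fun a b h => by
  simpa [plus_apply] using congrArg (fun v : ℝ ≃ᵢ ℝ => v 0) h

theorem plus_inj {a b : ℝ} : plus a = plus b ↔ a = b := plus_injective.eq_iff

/-- The slope of a vertical operation: `1` for `c+` and `-1` for `c-`. -/
def slope (v : ℝ ≃ᵢ ℝ) : ℝ := v 1 - v 0

@[simp] theorem slope_plus (c : ℝ) : slope (plus c) = 1 := by simp [slope, plus_apply]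

@[simp] theorem slope_minus (c : ℝ) : slope (minus c) = -1 := by simp [slope, minus_apply]

theorem plus_ne_minus (a b : ℝ) : plus a ≠ minus b := fun h => by
  have := congrArg slope h
  norm_num at this

theorem eq_plus_or_eq_minus (v : ℝ ≃ᵢ ℝ) : v = plus (v 0) ∨ v = minus (v 0) := by
  have h0 : ∀ z, |v z - v 0| = |z| := fun z => by
    have := v.isometry.dist_eq z 0
    simpa [Real.dist_eq] using this
  have h1 : ∀ z, |v z - v 1| = |z - 1| := fun z => by
    have := v.isometry.dist_eq z 1
    simpa [Real.dist_eq] using this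
  have h2 : ∀ z, (v z - v 0) ^ 2 = z ^ 2 := fun z => by rw [← sq_abs, h0, sq_abs]
  have h3 : ∀ z, (v z - v 1) ^ 2 = (z - 1) ^ 2 := fun z => by rw [← sq_abs, h1, sq_abs]
  -- The distances of `v z` from `v 0` and from `v 1` determine `v z`, so the image of the unit
  -- interval decides the sign.
  have h4 : (v 1 - v 0) = 1 ∨ (v 1 - v 0) = -1 := sq_eq_sq_iff_eq_or_eq_neg.1 (h2 1)
  rcases h4 with h | h
  · left; ext z; rw [plus_apply]
    have e : v 1 = v 0 + 1 := by linarith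
    have a := h2 z; have b := h3 z; rw [e] at b; nlinarith
  · right; ext z; rw [minus_apply]
    have e : v 1 = v 0 - 1 := by linarith
    have a := h2 z; have b := h3 z; rw [e] at b; nlinarith

theorem exists_eq_plus_or_minus (v : ℝ ≃ᵢ ℝ) : (∃ c, v = plus c) ∨ ∃ c, v = minus c :=
  (eq_plus_or_eq_minus v).imp (fun h => ⟨_, h⟩) fun h => ⟨_, h⟩

theorem slope_eq_one_iff (v : ℝ ≃ᵢ ℝ) : slope v = 1 ↔ ∃ c, v = plus c := by
  rcases exists_eq_plus_or_minus v with ⟨c, rfl⟩ | ⟨c, rfl⟩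
  · simp
  · simp only [slope_minus]
    constructor
    · intro h; norm_num at h
    · rintro ⟨d, h⟩; exact absurd h.symm (plus_ne_minus _ _)

theorem slope_eq_neg_one_iff (v : ℝ ≃ᵢ ℝ) : slope v = -1 ↔ ∃ c, v = minus c := by
  rcases exists_eq_plus_or_minus v with ⟨c, rfl⟩ | ⟨c, rfl⟩
  · simp only [slope_plus]
    constructor
    · intro h; norm_num at h
    · rintro ⟨d, h⟩; exact absurd h (plus_ne_minus _ _)
  · simp

theorem slope_mul (v w : ℝ ≃ᵢ ℝ) : slope (v * w) = slope v * slope w := by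
  rcases exists_eq_plus_or_minus v with ⟨c, rfl⟩ | ⟨c, rfl⟩ <;>
  rcases exists_eq_plus_or_minus w with ⟨d, rfl⟩ | ⟨d, rfl⟩ <;>
  simp [plus_mul_plus, plus_mul_minus, minus_mul_plus, minus_mul_minus]

theorem slope_one : slope 1 = 1 := by rw [← plus_zero, slope_plus]

theorem slope_eq_one_or (v : ℝ ≃ᵢ ℝ) : slope v = 1 ∨ slope v = -1 := by
  rcases exists_eq_plus_or_minus v with ⟨c, rfl⟩ | ⟨c, rfl⟩ <;> simp

theorem slope_inv (v : ℝ ≃ᵢ ℝ) : slope v⁻¹ = slope v := by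
  rcases exists_eq_plus_or_minus v with ⟨c, rfl⟩ | ⟨c, rfl⟩ <;> simp [plus_inv, minus_inv]

theorem vertical_apply (v : ℝ ≃ᵢ ℝ) (z : ℝ) : v z = v 0 + slope v * z := by
  rcases exists_eq_plus_or_minus v with ⟨c, rfl⟩ | ⟨c, rfl⟩ <;>
  simp [plus_apply, minus_apply, sub_eq_add_neg]

theorem vertical_mul_zero (v w : ℝ ≃ᵢ ℝ) : (v * w) 0 = v 0 + slope v * w 0 := by
  rw [IsometryEquiv.mul_apply, vertical_apply]

theorem vertical_ext {v w : ℝ ≃ᵢ ℝ} (h0 : v 0 = w 0) (h1 : slope v = slope w) : v = w := by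
  ext z; rw [vertical_apply v, vertical_apply w, h0, h1]

theorem vertical_inv_zero (v : ℝ ≃ᵢ ℝ) : v⁻¹ 0 = - (slope v * v 0) := by
  rcases exists_eq_plus_or_minus v with ⟨c, rfl⟩ | ⟨c, rfl⟩ <;>
  simp [plus_inv, minus_inv, plus_apply, minus_apply]

theorem minus_pow_eq_one_or (c : ℝ) (n : ℕ) : minus c ^ n = 1 ∨ minus c ^ n = minus c := by
  rcases Nat.even_or_odd' n with ⟨m, rfl | rfl⟩
  · left; rw [pow_mul, minus_sq, one_pow]
  · right; rw [pow_succ, pow_mul, minus_sq, one_pow, one_mul]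

/-! ### The fiber length -/

variable {G : Subgroup FibIsom} {k : ℝ}

/-- The translations coupled with the identity. -/
def fiberTranslations (G : Subgroup FibIsom) : AddSubgroup ℝ where
  carrier := {c | ((1, plus c) : FibIsom) ∈ G}
  zero_mem' := by
    have := G.one_mem
    rwa [Prod.one_eq_mk, ← plus_zero] at this
  add_mem' {a b} ha hb := by
    have := G.mul_mem ha hb
    rwa [Prod.mk_mul_mk, plus_mul_plus, one_mul] at this
  neg_mem' {a} ha := by
    have := G.inv_mem ha
    rwa [Prod.inv_mk, plus_inv, inv_one] at this

theorem IsFiberLength.one_plus_mem_iff (hk : IsFiberLength G k) {c : ℝ} :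
    ((1, plus c) : FibIsom) ∈ G ↔ ∃ n : ℤ, c = k * n := by
  have h : IsLeast {g | g ∈ fiberTranslations G ∧ 0 < g} k := by
    refine ⟨⟨hk.1.2, hk.1.1⟩, fun g hg => hk.2 ⟨hg.2, hg.1⟩⟩
  have := AddSubgroup.cyclic_of_min h
  change c ∈ fiberTranslations G ↔ _
  rw [this, AddSubgroup.mem_closure_singleton]
  constructor
  · rintro ⟨n, rfl⟩; exact ⟨n, by simp [mul_comm]⟩
  · rintro ⟨n, rfl⟩; exact ⟨n, by simp [mul_comm]⟩

theorem IsFiberLength.unique {k' : ℝ} (hk : IsFiberLength G k) (hk' : IsFiberLength G k') :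
    k = k' := IsLeast.unique hk hk'

theorem IsFiberLength.plus_mem_iff (hk : IsFiberLength G k) {h : Plane ≃ᵢ Plane} {a b : ℝ}
    (ha : (h, plus a) ∈ G) : (h, plus b) ∈ G ↔ ∃ n : ℤ, b = a + k * n := by
  have : (h, plus b) = (h, plus a) * (1, plus (b - a)) := by
    rw [Prod.mk_mul_mk, plus_mul_plus, mul_one]; congr; ring
  rw [this, G.mul_mem_cancel_left ha, hk.one_plus_mem_iff]
  simp only [sub_eq_iff_eq_add']

theorem IsFiberLength.minus_mem_iff (hk : IsFiberLength G k) {h : Plane ≃ᵢ Plane} {a b : ℝ}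
    (ha : (h, minus a) ∈ G) : (h, minus b) ∈ G ↔ ∃ n : ℤ, b = a + k * n := by
  have : (h, minus b) = (h, minus a) * (1, plus (a - b)) := by
    rw [Prod.mk_mul_mk, minus_mul_plus, mul_one]; congr; ring
  rw [this, G.mul_mem_cancel_left ha, hk.one_plus_mem_iff]
  constructor
  · rintro ⟨n, hn⟩; exact ⟨-n, by push_cast; linarith⟩
  · rintro ⟨n, hn⟩; exact ⟨-n, by push_cast; linarith⟩

theorem mem_horizontal {h : Plane ≃ᵢ Plane} : h ∈ horizontal G ↔ ∃ v, (h, v) ∈ G := by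
  simp [horizontal, Subgroup.mem_map]

theorem isPlus_or_exists_minus {h : Plane ≃ᵢ Plane} (hh : h ∈ horizontal G) :
    IsPlus G h ∨ ∃ c, (h, minus c) ∈ G := by
  obtain ⟨v, hv⟩ := mem_horizontal.1 hh
  rcases exists_eq_plus_or_minus v with ⟨c, rfl⟩ | ⟨c, rfl⟩
  · exact Or.inl ⟨c, hv⟩
  · exact Or.inr ⟨c, hv⟩

theorem not_isPlus_of_minus (hG : ¬ IsInterval G) {h : Plane ≃ᵢ Plane} {c : ℝ}
    (hh : (h, minus c) ∈ G) : ¬ IsPlus G h := by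
  rintro ⟨d, hd⟩
  refine hG ⟨-d + c, ?_⟩
  have := G.mul_mem (G.inv_mem hd) hh
  rwa [Prod.inv_mk, Prod.mk_mul_mk, plus_inv, plus_mul_minus, inv_mul_cancel] at this

theorem isPlus_of_isInterval (hG : IsInterval G) {h : Plane ≃ᵢ Plane} (hh : h ∈ horizontal G) :
    IsPlus G h := by
  rcases isPlus_or_exists_minus hh with h | ⟨c, hc⟩
  · exact h
  · obtain ⟨d, hd⟩ := hG
    refine ⟨c - d, ?_⟩
    have := G.mul_mem hc hd
    rwa [Prod.mk_mul_mk, minus_mul_minus, mul_one] at this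

/-- Translations by `c` in `(0, k]` move the origin within a compact vertical segment, so
discreteness leaves finitely many of them and a least one exists. -/
theorem IsFiberedSpaceGroup.exists_isFiberLength (hG : IsFiberedSpaceGroup G) :
    ∃ k, IsFiberLength G k := by
  obtain ⟨k, hk, hkG⟩ := hG.compact_fibers
  have hf := hG.discrete ({0} ×ˢ Set.Icc 0 k) (isCompact_singleton.prod isCompact_Icc)
  let S : Set ℝ := {c | (0 < c ∧ ((1, plus c) : FibIsom) ∈ G) ∧ c ≤ k}
  have hS : S.Finite := by
    refine Set.Finite.of_finite_image (f := fun c => ((1, plus c) : FibIsom)) ?_ ?_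
    · refine hf.subset ?_
      rintro _ ⟨c, ⟨⟨h0, hc⟩, hck⟩, rfl⟩
      refine ⟨hc, (0, c), ⟨(0, 0), ⟨rfl, le_refl _, hk.le⟩, ?_⟩, rfl, h0.le, hck⟩
      simp [act, plus_apply]
    · intro a _ b _ h
      exact plus_injective (Prod.ext_iff.1 h).2
  obtain ⟨m, hm, hmin⟩ := hS.exists_minimalFor id S ⟨k, ⟨hk, hkG⟩, le_refl _⟩
  refine ⟨m, hm.1, fun c hc => ?_⟩
  by_contra hlt
  push Not at hlt
  exact absurd (hmin (⟨hc, hlt.le.trans hm.2⟩ : c ∈ S) hlt.le) (not_le.2 hlt)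

end

section

/-! ### Products over the generators -/

section products

variable {σ : OrbifoldSymbol} {Γ Δ : Type} [Group Γ] [Group Δ]

theorem map_ringProd (f : Γ →* Δ) (s : Gen σ → Γ) : f (ringProd s) = ringProd fun x => f (s x) := by
  simp [ringProd, map_list_prod, List.map_ofFn, Function.comp_def]

theorem map_gyrProd (f : Γ →* Δ) (s : Gen σ → Γ) : f (gyrProd s) = gyrProd fun x => f (s x) := by
  simp [gyrProd, map_list_prod, List.map_ofFn, Function.comp_def]

theorem map_lamProd (f : Γ →* Δ) (s : Gen σ → Γ) : f (lamProd s) = lamProd fun x => f (s x) := by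
  simp [lamProd, map_list_prod, List.map_ofFn, Function.comp_def]

theorem map_crossProd (f : Γ →* Δ) (s : Gen σ → Γ) :
    f (crossProd s) = crossProd fun x => f (s x) := by
  simp [crossProd, map_list_prod, List.map_ofFn, Function.comp_def]

theorem ringProd_mem {W : Subgroup Γ} {s : Gen σ → Γ} (hX : ∀ i, s (.X i) ∈ W)
    (hY : ∀ i, s (.Y i) ∈ W) : ringProd s ∈ W := by
  refine W.list_prod_mem fun x hx => ?_
  obtain ⟨i, rfl⟩ := (List.mem_ofFn' _ _).1 hx
  exact W.mul_mem (W.mul_mem (W.mul_mem (W.inv_mem (hX _)) (W.inv_mem (hY _))) (hX _)) (hY _)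

theorem gyrProd_mem {W : Subgroup Γ} {s : Gen σ → Γ} (h : ∀ i, s (.γ i) ∈ W) : gyrProd s ∈ W := by
  refine W.list_prod_mem fun x hx => ?_
  obtain ⟨i, rfl⟩ := (List.mem_ofFn' _ _).1 hx
  exact h _

theorem lamProd_mem {W : Subgroup Γ} {s : Gen σ → Γ} (h : ∀ i, s (.lam i) ∈ W) : lamProd s ∈ W := by
  refine W.list_prod_mem fun x hx => ?_
  obtain ⟨i, rfl⟩ := (List.mem_ofFn' _ _).1 hx
  exact h _

theorem crossProd_mem {W : Subgroup Γ} {s : Gen σ → Γ} (h : ∀ i, s (.Z i) ∈ W) : crossProd s ∈ W := by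
  refine W.list_prod_mem fun x hx => ?_
  obtain ⟨i, rfl⟩ := (List.mem_ofFn' _ _).1 hx
  exact W.pow_mem (h _) 2

/-- The relations of the symbol `σ`. -/
structure Relations (s : Gen σ → Γ) : Prop where
  gyration : ∀ i, s (.γ i) ^ σ.gyrations.get i = 1
  mirror : ∀ i j, s (.P i j) ^ 2 = 1
  corner : ∀ i j, (s (.P i j.castSucc) * s (.P i j.succ)) ^ σ.digit i j = 1
  around : ∀ i, (s (.lam i))⁻¹ * s (.P i 0) * s (.lam i) = s (.P i (Fin.last _))
  global : ringProd s * gyrProd s * lamProd s * crossProd s = 1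

theorem relations_iff (s : Gen σ → Γ) :
    Relations s ↔ ∀ w, Relator σ w → FreeGroup.lift s w = 1 := by
  constructor
  · rintro h w hw
    cases hw with
    | gyration i => simpa using h.gyration i
    | mirror i j => simpa using h.mirror i j
    | corner i j => simpa using h.corner i j
    | around i => simpa [mul_inv_eq_one] using h.around i
    | global => simpa [map_ringProd, map_gyrProd, map_lamProd, map_crossProd] using h.global
  · intro h
    refine ⟨fun i => ?_, fun i j => ?_, fun i j => ?_, fun i => ?_, ?_⟩
    · simpa using h _ (.gyration i)
    · simpa using h _ (.mirror i j)
    · simpa using h _ (.corner i j)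
    · simpa [mul_inv_eq_one] using h _ (.around i)
    · simpa [map_ringProd, map_gyrProd, map_lamProd, map_crossProd] using h _ .global

end products

/-! ### Lifting the relations to the vertical operations -/

section chain

variable {W : Subgroup FibIsom}

theorem vertical_eq_minus_of_not_isPlus {h : Plane ≃ᵢ Plane} {v : ℝ ≃ᵢ ℝ} (hv : (h, v) ∈ W)
    (hp : ¬ IsPlus W h) : ∃ c, v = minus c := by
  rcases exists_eq_plus_or_minus v with ⟨c, rfl⟩ | h
  · exact absurd ⟨c, hv⟩ hp
  · exact h

theorem vertical_eq_plus_of_isPlus (hc : ¬ IsInterval W) {h : Plane ≃ᵢ Plane} {v : ℝ ≃ᵢ ℝ}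
    (hv : (h, v) ∈ W) (hp : IsPlus W h) : ∃ c, v = plus c := by
  rcases exists_eq_plus_or_minus v with h | ⟨c, rfl⟩
  · exact h
  · exact absurd hp (not_isPlus_of_minus hc hv)

/-- A power of a reflection is the identity or that same reflection; the second would couple the
identity with a minus operation. -/
theorem minus_pow_eq_one (hc : ¬ IsInterval W) {h : Plane ≃ᵢ Plane} {c : ℝ} {n : ℕ}
    (hv : (h, minus c) ∈ W) (hn : h ^ n = 1) : minus c ^ n = 1 := by
  refine (minus_pow_eq_one_or c n).resolve_right fun h' => hc ⟨c, ?_⟩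
  have := W.pow_mem hv n
  rwa [Prod.pow_mk, hn, h'] at this

/-- `v` is a vertical operation coupled with `h`, equal to the identity if `h` is plus-coupled. -/
def IsLift (W : Subgroup FibIsom) (h : Plane ≃ᵢ Plane) (v : ℝ ≃ᵢ ℝ) : Prop :=
  (h, v) ∈ W ∧ (IsPlus W h → v = 1)

theorem IsLift.sq_eq_one {h : Plane ≃ᵢ Plane} {v : ℝ ≃ᵢ ℝ} (hv : IsLift W h v) : v ^ 2 = 1 := by
  by_cases hp : IsPlus W h
  · rw [hv.2 hp, one_pow]
  · obtain ⟨c, rfl⟩ := vertical_eq_minus_of_not_isPlus hv.1 hp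
    exact minus_sq c

theorem exists_isLift {h : Plane ≃ᵢ Plane} (hh : h ∈ horizontal W)
    (h1 : IsPlus W h → (h, 1) ∈ W) : ∃ v, IsLift W h v := by
  by_cases hp : IsPlus W h
  · exact ⟨1, h1 hp, fun _ => rfl⟩
  · obtain ⟨v, hv⟩ := mem_horizontal.1 hh
    exact ⟨v, hv, fun h => absurd h hp⟩

variable (hc : ¬ IsInterval W) {P Q : Plane ≃ᵢ Plane} {A : ℕ}
  (hP : ∃ v, IsLift W P v) (hQ : ∃ v, IsLift W Q v)
  (hPQ : IsPlus W (P * Q) → (P * Q, (1 : ℝ ≃ᵢ ℝ)) ∈ W) (hA : (P * Q) ^ A = 1)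

-- If `P` and `Q` are both minus-coupled, then `PQ` is plus-coupled, hence coupled with the
-- identity, and `Q` can be given the same reflection as `P`. In all other cases the product of any
-- two lifts is the identity or a reflection whose power is killed by `minus_pow_eq_one`, so every
-- lift of `Q` works.
include hc hQ hPQ hA in
theorem exists_isLift_right {v : ℝ ≃ᵢ ℝ} (hv : IsLift W P v) :
    ∃ w, IsLift W Q w ∧ (v * w) ^ A = 1 := by
  by_cases hq : IsPlus W Q
  · obtain ⟨w, hw⟩ := hQ
    refine ⟨w, hw, ?_⟩
    rw [hw.2 hq, mul_one]
    by_cases hp : IsPlus W P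
    · rw [hv.2 hp, one_pow]
    · obtain ⟨c, rfl⟩ := vertical_eq_minus_of_not_isPlus hv.1 hp
      refine minus_pow_eq_one hc (h := P * Q) ?_ hA
      have := W.mul_mem hv.1 hw.1
      rwa [hw.2 hq, Prod.mk_mul_mk, mul_one] at this
  · by_cases hp : IsPlus W P
    · obtain ⟨w, hw⟩ := hQ
      refine ⟨w, hw, ?_⟩
      obtain ⟨c, rfl⟩ := vertical_eq_minus_of_not_isPlus hw.1 hq
      have := W.mul_mem hv.1 hw.1
      rw [hv.2 hp, Prod.mk_mul_mk, one_mul] at this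
      rw [hv.2 hp, one_mul]
      exact minus_pow_eq_one hc this hA
    · obtain ⟨c, rfl⟩ := vertical_eq_minus_of_not_isPlus hv.1 hp
      obtain ⟨w, hw⟩ := hQ
      obtain ⟨d, rfl⟩ := vertical_eq_minus_of_not_isPlus hw.1 hq
      have h1 := W.mul_mem hv.1 hw.1
      rw [Prod.mk_mul_mk, minus_mul_minus] at h1
      have h2 := W.mul_mem (W.inv_mem hv.1) (hPQ ⟨_, h1⟩)
      rw [Prod.inv_mk, Prod.mk_mul_mk, mul_one, inv_mul_cancel_left, minus_inv] at h2
      refine ⟨minus c, ⟨h2, fun h => absurd h hq⟩, ?_⟩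
      rw [minus_mul_minus, sub_self, plus_zero, one_pow]

include hc hP hPQ hA in
theorem exists_isLift_left {w : ℝ ≃ᵢ ℝ} (hw : IsLift W Q w) :
    ∃ v, IsLift W P v ∧ (v * w) ^ A = 1 := by
  by_cases hp : IsPlus W P
  · obtain ⟨v, hv⟩ := hP
    refine ⟨v, hv, ?_⟩
    rw [hv.2 hp, one_mul]
    by_cases hq : IsPlus W Q
    · rw [hw.2 hq, one_pow]
    · obtain ⟨c, rfl⟩ := vertical_eq_minus_of_not_isPlus hw.1 hq
      refine minus_pow_eq_one hc (h := P * Q) ?_ hA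
      have := W.mul_mem hv.1 hw.1
      rwa [hv.2 hp, Prod.mk_mul_mk, one_mul] at this
  · by_cases hq : IsPlus W Q
    · obtain ⟨v, hv⟩ := hP
      refine ⟨v, hv, ?_⟩
      obtain ⟨c, rfl⟩ := vertical_eq_minus_of_not_isPlus hv.1 hp
      have := W.mul_mem hv.1 hw.1
      rw [hw.2 hq, Prod.mk_mul_mk, mul_one] at this
      rw [hw.2 hq, mul_one]
      exact minus_pow_eq_one hc this hA
    · obtain ⟨c, rfl⟩ := vertical_eq_minus_of_not_isPlus hw.1 hq
      obtain ⟨v, hv⟩ := hP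
      obtain ⟨d, rfl⟩ := vertical_eq_minus_of_not_isPlus hv.1 hp
      have h1 := W.mul_mem hv.1 hw.1
      rw [Prod.mk_mul_mk, minus_mul_minus] at h1
      have h2 := W.mul_mem (hPQ ⟨_, h1⟩) (W.inv_mem hw.1)
      rw [Prod.inv_mk, Prod.mk_mul_mk, one_mul, mul_inv_cancel_right, minus_inv] at h2
      refine ⟨minus c, ⟨h2, fun h => absurd h hp⟩, ?_⟩
      rw [minus_mul_minus, sub_self, plus_zero, one_pow]

end chain

/-! ### Chains of mirrors around one kaleidoscope -/

section kaleidoscope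

variable {W : Subgroup FibIsom} (hc : ¬ IsInterval W) {n : ℕ} {P : Fin (n + 1) → Plane ≃ᵢ Plane}
  {A : Fin n → ℕ} (hP : ∀ j, ∃ v, IsLift W (P j) v)
  (hPQ : ∀ j : Fin n, IsPlus W (P j.castSucc * P j.succ) →
    (P j.castSucc * P j.succ, (1 : ℝ ≃ᵢ ℝ)) ∈ W)
  (hA : ∀ j : Fin n, (P j.castSucc * P j.succ) ^ A j = 1)

-- The product of consecutive mirrors is plus-coupled, hence coupled with the identity, so a
-- reflection coupled with one mirror is coupled with the next.
include hP hPQ in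
theorem minus_mem_of_all_minus (hm : ∀ j, ¬ IsPlus W (P j)) {c : ℝ} (h0 : (P 0, minus c) ∈ W)
    (j : Fin (n + 1)) : (P j, minus c) ∈ W := by
  induction j using Fin.induction with
  | zero => exact h0
  | succ j ih =>
    obtain ⟨v, hv⟩ := hP j.succ
    obtain ⟨d, rfl⟩ := vertical_eq_minus_of_not_isPlus hv.1 (hm _)
    have h1 := W.mul_mem ih hv.1
    rw [Prod.mk_mul_mk, minus_mul_minus] at h1
    have h2 := W.mul_mem (W.inv_mem ih) (hPQ j ⟨_, h1⟩)
    rwa [Prod.inv_mk, Prod.mk_mul_mk, mul_one, inv_mul_cancel_left, minus_inv] at h2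

/-- The values of `λ` that extend to a solution of the relations of a kaleidoscope. -/
def StarLift (W : Subgroup FibIsom) (P : Fin (n + 1) → Plane ≃ᵢ Plane) (A : Fin n → ℕ)
    (v : ℝ ≃ᵢ ℝ) : Prop :=
  ∃ V : Fin (n + 1) → ℝ ≃ᵢ ℝ, (∀ j, IsLift W (P j) (V j)) ∧
      (∀ j : Fin n, (V j.castSucc * V j.succ) ^ A j = 1) ∧ v⁻¹ * V 0 * v = V (Fin.last n)

-- When all mirrors are minus-coupled, one reflection serves for all of them. It is fixed under
-- conjugation by itself, which settles the relation around the kaleidoscope for `λ ↦ l-` here, and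
-- under conjugation by the identity in `starLift_one`.
include hP hPQ in
theorem starLift_of_minus (hm : ∀ j, ¬ IsPlus W (P j)) {l : ℝ} (h0 : (P 0, minus l) ∈ W) :
    StarLift W P A (minus l) := by
  refine ⟨fun _ => minus l, fun j => ⟨minus_mem_of_all_minus hP hPQ hm h0 j,
    fun h => absurd h (hm j)⟩, fun j => ?_, by simp⟩
  rw [minus_mul_minus, sub_self, plus_zero, one_pow]

include hP hPQ in
theorem starLift_one (hm : ∀ j, ¬ IsPlus W (P j)) : StarLift W P A 1 := by
  obtain ⟨p, hp⟩ := hP 0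
  obtain ⟨c, rfl⟩ := vertical_eq_minus_of_not_isPlus hp.1 (hm 0)
  refine ⟨fun _ => minus c, fun j => ⟨minus_mem_of_all_minus hP hPQ hm hp.1 j,
    fun h => absurd h (hm j)⟩, fun j => ?_, by simp⟩
  rw [minus_mul_minus, sub_self, plus_zero, one_pow]

include hc hP hPQ hA

theorem exists_chain_forward {v : ℝ ≃ᵢ ℝ} (hv : IsLift W (P 0) v) :
    ∃ V : Fin (n + 1) → ℝ ≃ᵢ ℝ, V 0 = v ∧ (∀ j, IsLift W (P j) (V j)) ∧
      ∀ j : Fin n, (V j.castSucc * V j.succ) ^ A j = 1 := by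
  have step : ∀ (j : Fin n) (v : {v // IsLift W (P j.castSucc) v}),
      ∃ w : {w // IsLift W (P j.succ) w}, (v.1 * w.1) ^ A j = 1 := fun j v => by
    obtain ⟨w, hw, h⟩ := exists_isLift_right hc (hP j.succ) (hPQ j) (hA j) v.2
    exact ⟨⟨w, hw⟩, h⟩
  choose f hf using step
  let V : ∀ j, {v // IsLift W (P j) v} :=
    fun j => Fin.induction (motive := fun j => {v // IsLift W (P j) v}) ⟨v, hv⟩ f j
  refine ⟨fun j => V j, rfl, fun j => (V j).2, fun j => ?_⟩
  exact hf j (V j.castSucc)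

theorem exists_chain_backward {v : ℝ ≃ᵢ ℝ} (hv : IsLift W (P (Fin.last n)) v) :
    ∃ V : Fin (n + 1) → ℝ ≃ᵢ ℝ, V (Fin.last n) = v ∧ (∀ j, IsLift W (P j) (V j)) ∧
      ∀ j : Fin n, (V j.castSucc * V j.succ) ^ A j = 1 := by
  have step : ∀ (j : Fin n) (v : {v // IsLift W (P j.succ) v}),
      ∃ w : {w // IsLift W (P j.castSucc) w}, (w.1 * v.1) ^ A j = 1 := fun j v => by
    obtain ⟨w, hw, h⟩ := exists_isLift_left hc (hP j.castSucc) (hPQ j) (hA j) v.2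
    exact ⟨⟨w, hw⟩, h⟩
  choose f hf using step
  let V : ∀ j, {v // IsLift W (P j) v} :=
    fun j => Fin.reverseInduction (motive := fun j => {v // IsLift W (P j) v}) ⟨v, hv⟩ f j
  refine ⟨fun j => V j, ?_, fun j => (V j).2, fun j => ?_⟩
  · simp [V]
  · have : V j.castSucc = f j (V j.succ) := by simp [V]
    change ((V j.castSucc).1 * (V j.succ).1) ^ A j = 1
    rw [this]
    exact hf j _

/-- A plus-coupled mirror can only be lifted to the identity. The chain built forward from the first
mirror and the one built backward from the last therefore agree at `m` and can be glued there, so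
the two ends are independent. -/
theorem exists_chain_of_isPlus {m : Fin (n + 1)} (hm : IsPlus W (P m)) {v w : ℝ ≃ᵢ ℝ}
    (hv : IsLift W (P 0) v) (hw : IsLift W (P (Fin.last n)) w) :
    ∃ V : Fin (n + 1) → ℝ ≃ᵢ ℝ, V 0 = v ∧ V (Fin.last n) = w ∧ (∀ j, IsLift W (P j) (V j)) ∧
      ∀ j : Fin n, (V j.castSucc * V j.succ) ^ A j = 1 := by
  obtain ⟨F, F0, Fl, Fr⟩ := exists_chain_forward hc hP hPQ hA hv
  obtain ⟨B, B0, Bl, Br⟩ := exists_chain_backward hc hP hPQ hA hw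
  have hmm : F m = B m := by rw [(Fl m).2 hm, (Bl m).2 hm]
  refine ⟨fun j => if j ≤ m then F j else B j, by simp [F0], ?_, fun j => ?_, fun j => ?_⟩
  · by_cases h : Fin.last n ≤ m
    · have : m = Fin.last n := le_antisymm (Fin.le_last m) h
      simp only [h, if_true]
      rw [← this, hmm, this, B0]
    · simp only [h, if_false, B0]
  · by_cases h : j ≤ m
    · simp only [h, if_true]; exact Fl j
    · simp only [h, if_false]; exact Bl j
  · by_cases h : j.succ ≤ m
    · have h' : j.castSucc ≤ m := (Fin.castSucc_lt_succ.le).trans h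
      simp only [h, h', if_true]; exact Fr j
    · by_cases h' : j.castSucc ≤ m
      · have : j.castSucc = m := by
          apply le_antisymm h'
          rw [Fin.le_def] at *
          simp at *; omega
        simp only [h, h', if_true, if_false]
        rw [this, hmm, ← this]; exact Br j
      · simp only [h, h', if_false]; exact Br j

/-- One plus-coupled mirror makes the value of `λ` completely free: the last mirror can be assigned
the conjugate of the first. Conjugation preserves slopes, so if the last mirror is plus-coupled so
is the first, and the conjugate is then the identity as a lift requires. -/
theorem starLift_of_isPlus {m : Fin (n + 1)} (hm : IsPlus W (P m)) {L : Plane ≃ᵢ Plane}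
    (hL : L⁻¹ * P 0 * L = P (Fin.last n)) {v : ℝ ≃ᵢ ℝ} (hv : (L, v) ∈ W) :
    StarLift W P A v := by
  obtain ⟨p, hp⟩ := hP 0
  have hw : IsLift W (P (Fin.last n)) (v⁻¹ * p * v) := by
    have := W.mul_mem (W.mul_mem (W.inv_mem hv) hp.1) hv
    rw [Prod.inv_mk, Prod.mk_mul_mk, Prod.mk_mul_mk, hL] at this
    refine ⟨this, fun h => ?_⟩
    have : IsPlus W (P 0) := by
      by_contra h0
      obtain ⟨c, rfl⟩ := vertical_eq_minus_of_not_isPlus hp.1 h0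
      obtain ⟨d, hd⟩ := vertical_eq_plus_of_isPlus hc this h
      have := congrArg slope hd
      rw [slope_mul, slope_mul, slope_inv, slope_minus, slope_plus] at this
      rcases slope_eq_one_or v with h | h <;> rw [h] at this <;> norm_num at this
    rw [hp.2 this]; simp
  obtain ⟨V, h0, hl, h1, h2⟩ := exists_chain_of_isPlus hc hP hPQ hA hm hp hw
  exact ⟨V, h1, h2, by rw [h0, hl]⟩

end kaleidoscope

end

section

/-! ### Splitting of a coupling with trivial embellishments -/

theorem prod_ofFn_update {M : Type} [Monoid M] {n : ℕ} (f : Fin n → M) (i : Fin n) :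
    ∃ A B : M, ∀ v, (List.ofFn (Function.update f i v)).prod = A * v * B := by
  refine ⟨((List.ofFn f).take i).prod, ((List.ofFn f).drop (i + 1)).prod, fun v => ?_⟩
  have : List.ofFn (Function.update f i v) = (List.ofFn f).set i v := by
    apply List.ext_getElem
    · simp
    · intro m h1 h2
      simp only [List.getElem_ofFn, List.getElem_set, Function.update_apply, Fin.ext_iff]
      simp only [eq_comm]
  rw [this, List.prod_set]
  simp

theorem conj_plus_int (B : ℝ ≃ᵢ ℝ) (m : ℤ) : ∃ n : ℤ, B * plus m * B⁻¹ = plus n := by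
  rcases exists_eq_plus_or_minus B with ⟨c, rfl⟩ | ⟨c, rfl⟩
  · exact ⟨m, by rw [plus_inv, plus_mul_plus, plus_mul_plus]; congr 1; ring⟩
  · exact ⟨-m, by rw [minus_inv, minus_mul_plus, minus_mul_minus]; congr 1; push_cast; ring⟩

/-- Integer translations are normalized by every vertical operation, so an integer defect of a
product can be moved to any chosen factor and cancelled there. -/
theorem exists_update_prod_eq_one {n : ℕ} (f : Fin n → ℝ ≃ᵢ ℝ) (i : Fin n) (L R : ℝ ≃ᵢ ℝ) {m : ℤ}
    (h : L * (List.ofFn f).prod * R = plus m) :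
    ∃ e : ℤ, L * (List.ofFn (Function.update f i (f i * plus e))).prod * R = 1 := by
  obtain ⟨A, B, hAB⟩ := prod_ofFn_update f i
  have h0 := hAB (f i)
  rw [Function.update_eq_self] at h0
  obtain ⟨e, he⟩ := conj_plus_int (B * R) (-m)
  refine ⟨e, ?_⟩
  rw [hAB, ← he]
  rw [h0] at h
  have h2 : plus (m : ℝ) * plus ((-m : ℤ) : ℝ) = 1 := by
    rw [plus_mul_plus, ← plus_zero]; congr 1; push_cast; ring
  calc _ = L * (A * f i * B) * R * plus ((-m : ℤ) : ℝ) := by group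
    _ = 1 := by rw [h, h2]

variable {σ : OrbifoldSymbol}

/-- The relations between a coupling `W` of fiber length `1` and the generators `s` expressing that
all embellishments of the name are trivial. -/
structure IsTrivialCoupling (W : Subgroup FibIsom) (s : Gen σ → (Plane ≃ᵢ Plane)) : Prop where
  length : IsFiberLength W 1
  circular : ¬ IsInterval W
  surj : ∀ x, s x ∈ horizontal W
  rel : Relations s
  gyration : ∀ i, IsPlus W (s (.γ i)) → (s (.γ i), 1) ∈ W
  mirror : ∀ i j, IsPlus W (s (.P i j)) → (s (.P i j), 1) ∈ W
  corner : ∀ i (j : Fin (σ.len i)), IsPlus W (s (.P i j.castSucc) * s (.P i j.succ)) →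
    (s (.P i j.castSucc) * s (.P i j.succ), 1) ∈ W
  star_plus : ∀ i, AllMinus W s i → IsPlus W (s (.lam i)) → (s (.lam i), 1) ∈ W
  star_minus : ∀ i, AllMinus W s i → ¬ IsPlus W (s (.lam i)) →
    ∃ c, (s (.P i 0), minus c) ∈ W ∧ (s (.lam i), minus c) ∈ W
  ring : ∀ i, (∃ a b, (s (.X i), plus a) ∈ W ∧ (s (.Y i), plus b) ∈ W) ∨
    ∃ c, (s (.X i), minus c) ∈ W ∧ (s (.Y i), minus c) ∈ W
  cross : (∀ i, IsPlus W (s (.γ i))) → (∀ i, IsPlus W (s (.lam i)) ∧ AllMinus W s i) →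
    ∃ v : Fin σ.crosses → ℝ ≃ᵢ ℝ, (∀ i, (s (.Z i), v i) ∈ W) ∧
      (List.ofFn fun i => v i ^ 2).prod = 1

namespace IsTrivialCoupling

variable {W : Subgroup FibIsom} {s : Gen σ → (Plane ≃ᵢ Plane)} (h : IsTrivialCoupling W s)

include h

theorem one_plus_mem (m : ℤ) : ((1, plus m) : FibIsom) ∈ W :=
  h.length.one_plus_mem_iff.2 ⟨m, by simp⟩

theorem mul_plus_mem {x : Plane ≃ᵢ Plane} {v : ℝ ≃ᵢ ℝ} (hv : (x, v) ∈ W) (m : ℤ) :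
    (x, v * plus m) ∈ W := by
  have := W.mul_mem hv (h.one_plus_mem m)
  rwa [Prod.mk_mul_mk, mul_one] at this

theorem exists_isLift_mirror (i) (j) : ∃ v, IsLift W (s (.P i j)) v :=
  exists_isLift (h.surj _) (h.mirror i j)

theorem gyration_pow_eq_one {i} {v : ℝ ≃ᵢ ℝ} (hv : (s (.γ i), v) ∈ W)
    (h1 : IsPlus W (s (.γ i)) → v = 1) : v ^ σ.gyrations.get i = 1 := by
  by_cases hp : IsPlus W (s (.γ i))
  · rw [h1 hp, one_pow]
  · obtain ⟨c, rfl⟩ := vertical_eq_minus_of_not_isPlus hv hp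
    exact minus_pow_eq_one h.circular hv (h.rel.gyration i)

/-- The possible values of `λ`. -/
theorem starLift_of_flexible {i} (hi : ¬ (IsPlus W (s (.lam i)) ∧ AllMinus W s i))
    {v : ℝ ≃ᵢ ℝ} (hv : (s (.lam i), v) ∈ W) :
    StarLift W (fun j => s (.P i j)) (σ.digit i) v := by
  by_cases ha : AllMinus W s i
  · have hl : ¬ IsPlus W (s (.lam i)) := fun hl => hi ⟨hl, ha⟩
    obtain ⟨l, rfl⟩ := vertical_eq_minus_of_not_isPlus hv hl
    obtain ⟨c, hP, hc⟩ := h.star_minus i ha hl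
    -- `P` and `λ` share the reflection `c-`, and `l` differs from `c` by a multiple of the fiber
    -- length, so `P` is coupled with `l-` too.
    refine starLift_of_minus (h.exists_isLift_mirror i) (h.corner i) ha ?_
    exact (h.length.minus_mem_iff hP).2 ((h.length.minus_mem_iff hc).1 hv)
  · simp only [AllMinus, not_forall, not_not] at ha
    obtain ⟨m, hm⟩ := ha
    exact starLift_of_isPlus h.circular (h.exists_isLift_mirror i) (h.corner i) (h.rel.corner i)
      hm (h.rel.around i) hv

theorem starLift_one_of_rigid {i} (hi : IsPlus W (s (.lam i)) ∧ AllMinus W s i) :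
    (s (.lam i), 1) ∈ W ∧ StarLift W (fun j => s (.P i j)) (σ.digit i) 1 :=
  ⟨h.star_plus i hi.2 hi.1, starLift_one (h.exists_isLift_mirror i) (h.corner i) hi.2⟩

theorem exists_starLift (i) :
    ∃ v, (s (.lam i), v) ∈ W ∧ StarLift W (fun j => s (.P i j)) (σ.digit i) v := by
  by_cases hi : IsPlus W (s (.lam i)) ∧ AllMinus W s i
  · exact ⟨1, h.starLift_one_of_rigid hi⟩
  · obtain ⟨v, hv⟩ := mem_horizontal.1 (h.surj (.lam i))
    exact ⟨v, hv, h.starLift_of_flexible hi hv⟩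

theorem exists_gyration (i) :
    ∃ v, (s (.γ i), v) ∈ W ∧ (IsPlus W (s (.γ i)) → v = 1) := by
  by_cases hi : IsPlus W (s (.γ i))
  · exact ⟨1, h.gyration i hi, fun _ => rfl⟩
  · obtain ⟨v, hv⟩ := mem_horizontal.1 (h.surj (.γ i))
    exact ⟨v, hv, fun h => absurd h hi⟩

theorem exists_ring (i) : ∃ v w, (s (.X i), v) ∈ W ∧ (s (.Y i), w) ∈ W ∧
    v⁻¹ * w⁻¹ * v * w = 1 := by
  rcases h.ring i with ⟨a, b, ha, hb⟩ | ⟨c, h1, h2⟩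
  · refine ⟨_, _, ha, hb, ?_⟩
    rw [plus_inv, plus_inv, plus_mul_plus, plus_mul_plus, plus_mul_plus, ← plus_zero]
    congr 1; ring
  · exact ⟨_, _, h1, h2, by simp⟩

/-- The global relation can be solved. -/
theorem exists_global : ∃ (γ : Fin σ.gyrations.length → ℝ ≃ᵢ ℝ)
    (l : Fin σ.kaleidoscopes.length → ℝ ≃ᵢ ℝ) (z : Fin σ.crosses → ℝ ≃ᵢ ℝ),
    (∀ i, (s (.γ i), γ i) ∈ W ∧ (IsPlus W (s (.γ i)) → γ i = 1)) ∧
    (∀ i, (s (.lam i), l i) ∈ W ∧ StarLift W (fun j => s (.P i j)) (σ.digit i) (l i)) ∧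
    (∀ i, (s (.Z i), z i) ∈ W) ∧
    (List.ofFn γ).prod * (List.ofFn l).prod * (List.ofFn fun i => z i ^ 2).prod = 1 := by
  by_cases hr : (∀ i, IsPlus W (s (.γ i))) ∧ ∀ i, IsPlus W (s (.lam i)) ∧ AllMinus W s i
  -- No `γ` or `λ` can absorb a defect here: all of them are lifted to the identity, and the squares
  -- of the crosses multiply to the identity by the hypothesis on crosses.
  · obtain ⟨z, hz, hz1⟩ := h.cross hr.1 hr.2
    refine ⟨fun _ => 1, fun _ => 1, z, fun i => ⟨h.gyration i (hr.1 i), fun _ => rfl⟩,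
      fun i => h.starLift_one_of_rigid (hr.2 i), hz, ?_⟩
    rw [hz1]
    simp
  choose γ hγ using h.exists_gyration
  choose l hl using h.exists_starLift
  choose z hz using fun i => mem_horizontal.1 (h.surj (.Z i))
  choose x y hx hy hxy using h.exists_ring
  -- The values `p` only complete `V` to all generators; the Latin generators do not occur in the
  -- global relation.
  choose p hp using fun i j => mem_horizontal.1 (h.surj (.P i j))
  let V : Gen σ → ℝ ≃ᵢ ℝ := fun
    | .X i => x i
    | .Y i => y i
    | .γ i => γ i
    | .lam i => l i
    | .P i j => p i j
    | .Z i => z i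
  have hV : ∀ g, ((s g, V g) : FibIsom) ∈ W := by
    rintro (i | i | i | i | ⟨i, j⟩ | i)
    exacts [hx i, hy i, (hγ i).1, (hl i).1, hp i j, hz i]
  have hprod : ringProd (fun g => ((s g, V g) : FibIsom)) * gyrProd (fun g => (s g, V g)) *
      lamProd (fun g => (s g, V g)) * crossProd (fun g => (s g, V g)) ∈ W :=
    W.mul_mem (W.mul_mem (W.mul_mem (ringProd_mem (fun _ => hV _) fun _ => hV _)
      (gyrProd_mem fun _ => hV _)) (lamProd_mem fun _ => hV _)) (crossProd_mem fun _ => hV _)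
  -- The ring commutators are already trivial, and the product lies over the identity by the global
  -- relation of `s`, so it is an integer translation; a reflection is excluded because the
  -- fibration is circular.
  obtain ⟨m, hm⟩ : ∃ m : ℤ, (List.ofFn γ).prod * (List.ofFn l).prod *
      (List.ofFn fun i => z i ^ 2).prod = plus m := by
    have e1 := map_ringProd (MonoidHom.fst (Plane ≃ᵢ Plane) (ℝ ≃ᵢ ℝ)) (fun g => (s g, V g))
    have e2 := map_gyrProd (MonoidHom.fst (Plane ≃ᵢ Plane) (ℝ ≃ᵢ ℝ)) (fun g => (s g, V g))
    have e3 := map_lamProd (MonoidHom.fst (Plane ≃ᵢ Plane) (ℝ ≃ᵢ ℝ)) (fun g => (s g, V g))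
    have e4 := map_crossProd (MonoidHom.fst (Plane ≃ᵢ Plane) (ℝ ≃ᵢ ℝ)) (fun g => (s g, V g))
    have f1 := map_ringProd (MonoidHom.snd (Plane ≃ᵢ Plane) (ℝ ≃ᵢ ℝ)) (fun g => (s g, V g))
    have f2 := map_gyrProd (MonoidHom.snd (Plane ≃ᵢ Plane) (ℝ ≃ᵢ ℝ)) (fun g => (s g, V g))
    have f3 := map_lamProd (MonoidHom.snd (Plane ≃ᵢ Plane) (ℝ ≃ᵢ ℝ)) (fun g => (s g, V g))
    have f4 := map_crossProd (MonoidHom.snd (Plane ≃ᵢ Plane) (ℝ ≃ᵢ ℝ)) (fun g => (s g, V g))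
    simp only [MonoidHom.coe_fst, MonoidHom.coe_snd] at e1 e2 e3 e4 f1 f2 f3 f4
    have e : (ringProd (fun g => ((s g, V g) : FibIsom)) * gyrProd (fun g => (s g, V g)) *
      lamProd (fun g => (s g, V g)) * crossProd (fun g => (s g, V g))) =
      (1, (List.ofFn γ).prod * (List.ofFn l).prod * (List.ofFn fun i => z i ^ 2).prod) := by
      refine Prod.ext ?_ ?_
      · simp only [Prod.fst_mul, e1, e2, e3, e4]
        exact h.rel.global
      · have : ringProd V = 1 := by simp [ringProd, V, hxy]
        simp only [Prod.snd_mul, f1, f2, f3, f4, this, one_mul]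
        rfl
    rw [e] at hprod
    rcases exists_eq_plus_or_minus ((List.ofFn γ).prod * (List.ofFn l).prod *
      (List.ofFn fun i => z i ^ 2).prod) with ⟨c, hc⟩ | ⟨c, hc⟩
    · rw [hc] at hprod
      obtain ⟨m, rfl⟩ := h.length.one_plus_mem_iff.1 hprod
      exact ⟨m, by rw [hc, one_mul]⟩
    · rw [hc] at hprod
      exact absurd ⟨c, hprod⟩ h.circular
  -- Some `γ` is minus-coupled or some `λ` is flexible. Changing its lift by an integer translation
  -- keeps its own relations valid, so it can absorb `m`.
  rw [not_and_or, not_forall, not_forall] at hr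
  rcases hr with ⟨i, hi⟩ | ⟨i, hi⟩
  · obtain ⟨e, he⟩ := exists_update_prod_eq_one γ i 1
      ((List.ofFn l).prod * (List.ofFn fun i => z i ^ 2).prod) (m := m)
      (by rw [one_mul, ← mul_assoc, hm])
    refine ⟨Function.update γ i (γ i * plus e), l, z, fun j => ?_, hl, hz, ?_⟩
    · by_cases hj : j = i
      · subst hj
        rw [Function.update_self]
        exact ⟨h.mul_plus_mem (hγ j).1 e, fun h => absurd h hi⟩
      · rw [Function.update_of_ne hj]; exact hγ j
    · rwa [one_mul, ← mul_assoc] at he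
  · obtain ⟨e, he⟩ := exists_update_prod_eq_one l i (List.ofFn γ).prod
      (List.ofFn fun i => z i ^ 2).prod (m := m) hm
    refine ⟨γ, Function.update l i (l i * plus e), z, hγ, fun j => ?_, hz, he⟩
    by_cases hj : j = i
    · subst hj
      rw [Function.update_self]
      have := h.mul_plus_mem (hl j).1 e
      exact ⟨this, h.starLift_of_flexible hi this⟩
    · rw [Function.update_of_ne hj]; exact hl j

/-- A coupling all of whose embellishments are trivial splits. -/
theorem exists_relations : ∃ V : Gen σ → ℝ ≃ᵢ ℝ, (∀ x, (s x, V x) ∈ W) ∧ Relations V := by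
  obtain ⟨γ, l, z, hγ, hl, hz, hglob⟩ := h.exists_global
  choose x y hx hy hxy using h.exists_ring
  choose p hp hpA hpl using fun i => (hl i).2
  refine ⟨fun
    | .X i => x i
    | .Y i => y i
    | .γ i => γ i
    | .lam i => l i
    | .P i j => p i j
    | .Z i => z i, ?_, ?_⟩
  · rintro (i | i | i | i | ⟨i, j⟩ | i)
    exacts [hx i, hy i, (hγ i).1, (hl i).1, (hp i j).1, hz i]
  · refine ⟨fun i => h.gyration_pow_eq_one (hγ i).1 (hγ i).2, fun i j => (hp i j).sq_eq_one,
      fun i j => hpA i j, fun i => hpl i, ?_⟩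
    simp only [ringProd, gyrProd, lamProd, crossProd, hxy]
    simpa using hglob

end IsTrivialCoupling

end

section

/-! ### The difference of two couplings with the same name -/

theorem prod_ofFn_plus {n : ℕ} (a : Fin n → ℝ) :
    (List.ofFn fun i => plus (a i)).prod = plus (∑ i, a i) := by
  induction n with
  | zero => simp [plus_zero]
  | succ n ih => rw [List.ofFn_succ, List.prod_cons, ih, plus_mul_plus, Fin.sum_univ_succ]

theorem ringProd_eq_one {σ : OrbifoldSymbol} (h : σ.rings = 0) {Γ : Type} [Group Γ]
    (s : Gen σ → Γ) : ringProd s = 1 := by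
  rw [ringProd, List.ofFn_eq_nil_iff.2 h, List.prod_nil]

/-- The vertical differences (in units of the fiber lengths `k₀` and `k₁`) of the operations coupled
in `G₁` with `θ h` and in `G₀` with `h`. -/
def difference (G₀ G₁ : Subgroup FibIsom) (k₀ k₁ : ℝ) (θ : horizontal G₀ →* Plane ≃ᵢ Plane) :
    Subgroup FibIsom where
  carrier := {p | ∃ x : horizontal G₀, p.1 = x ∧ ∃ v₀ v₁, ((x : Plane ≃ᵢ Plane), v₀) ∈ G₀ ∧
    (θ x, v₁) ∈ G₁ ∧ slope v₀ = slope p.2 ∧ slope v₁ = slope p.2 ∧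
    p.2 0 = v₁ 0 / k₁ - v₀ 0 / k₀}
  one_mem' := ⟨1, rfl, 1, 1, G₀.one_mem, by rw [map_one]; exact G₁.one_mem, rfl, rfl, by simp⟩
  -- The two couplings and their difference have the same slope, and the height of a product at `0`
  -- is `v 0 + slope v * w 0`, so differences compose by the same rule.
  mul_mem' := by
    rintro ⟨h, v⟩ ⟨h', v'⟩ ⟨x, hx, v₀, v₁, h0, h1, e0, e1, e⟩ ⟨y, hy, w₀, w₁, g0, g1, f0, f1, f⟩
    refine ⟨x * y, by simp_all, v₀ * w₀, v₁ * w₁, G₀.mul_mem h0 g0, ?_, ?_, ?_, ?_⟩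
    · rw [map_mul]; exact G₁.mul_mem h1 g1
    · simp only [Prod.mk_mul_mk, slope_mul, e0, f0]
    · simp only [Prod.mk_mul_mk, slope_mul, e1, f1]
    · simp only [Prod.mk_mul_mk, vertical_mul_zero]
      simp only at e f e0 e1
      rw [e, f, e0, e1]; ring
  inv_mem' := by
    rintro ⟨h, v⟩ ⟨x, hx, v₀, v₁, h0, h1, e0, e1, e⟩
    refine ⟨x⁻¹, by simp_all, v₀⁻¹, v₁⁻¹, G₀.inv_mem h0, ?_, ?_, ?_, ?_⟩
    · rw [map_inv]; exact G₁.inv_mem h1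
    · simp only [Prod.inv_mk, slope_inv, e0]
    · simp only [Prod.inv_mk, slope_inv, e1]
    · simp only [Prod.inv_mk, vertical_inv_zero]
      simp only at e e0 e1
      rw [e, e0, e1]; ring

section difference

variable {G₀ G₁ : Subgroup FibIsom} {k₀ k₁ : ℝ} {θ : horizontal G₀ →* Plane ≃ᵢ Plane}

theorem plus_mem_difference {x : horizontal G₀} {a b : ℝ}
    (ha : ((x : Plane ≃ᵢ Plane), plus a) ∈ G₀) (hb : (θ x, plus b) ∈ G₁) :
    ((x : Plane ≃ᵢ Plane), plus (b / k₁ - a / k₀)) ∈ difference G₀ G₁ k₀ k₁ θ :=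
  ⟨x, rfl, _, _, ha, hb, by simp, by simp, by simp [plus_apply]⟩

theorem minus_mem_difference {x : horizontal G₀} {a b : ℝ}
    (ha : ((x : Plane ≃ᵢ Plane), minus a) ∈ G₀) (hb : (θ x, minus b) ∈ G₁) :
    ((x : Plane ≃ᵢ Plane), minus (b / k₁ - a / k₀)) ∈ difference G₀ G₁ k₀ k₁ θ :=
  ⟨x, rfl, _, _, ha, hb, by simp, by simp, by simp [minus_apply]⟩

theorem exists_of_mem_difference {x : horizontal G₀} {v : ℝ ≃ᵢ ℝ}
    (h : ((x : Plane ≃ᵢ Plane), v) ∈ difference G₀ G₁ k₀ k₁ θ) :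
    ∃ v₀ v₁, ((x : Plane ≃ᵢ Plane), v₀) ∈ G₀ ∧ (θ x, v₁) ∈ G₁ ∧ slope v₀ = slope v ∧
      slope v₁ = slope v ∧ v 0 = v₁ 0 / k₁ - v₀ 0 / k₀ := by
  obtain ⟨y, hy, h⟩ := h
  obtain rfl : x = y := Subtype.ext hy
  exact h

theorem exists_of_plus_mem_difference {x : horizontal G₀} {c : ℝ}
    (h : ((x : Plane ≃ᵢ Plane), plus c) ∈ difference G₀ G₁ k₀ k₁ θ) :
    ∃ a b, ((x : Plane ≃ᵢ Plane), plus a) ∈ G₀ ∧ (θ x, plus b) ∈ G₁ ∧ c = b / k₁ - a / k₀ := by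
  obtain ⟨v₀, v₁, h0, h1, s0, s1, e⟩ := exists_of_mem_difference h
  obtain ⟨a, rfl⟩ := (slope_eq_one_iff v₀).1 (by simp [s0])
  obtain ⟨b, rfl⟩ := (slope_eq_one_iff v₁).1 (by simp [s1])
  exact ⟨a, b, h0, h1, by simpa [plus_apply] using e⟩

theorem isPlus_difference_iff {x : horizontal G₀} :
    IsPlus (difference G₀ G₁ k₀ k₁ θ) x ↔ IsPlus G₀ x ∧ IsPlus G₁ (θ x) := by
  constructor
  · rintro ⟨c, hc⟩
    obtain ⟨a, b, ha, hb, -⟩ := exists_of_plus_mem_difference hc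
    exact ⟨⟨a, ha⟩, ⟨b, hb⟩⟩
  · rintro ⟨⟨a, ha⟩, ⟨b, hb⟩⟩
    exact ⟨_, plus_mem_difference ha hb⟩

theorem difference_circular (h0 : ¬ IsInterval G₀) : ¬ IsInterval (difference G₀ G₁ k₀ k₁ θ) := by
  rintro ⟨c, hc⟩
  obtain ⟨v₀, v₁, m0, -, s0, -⟩ := exists_of_mem_difference (x := 1) hc
  obtain ⟨a, rfl⟩ := (slope_eq_neg_one_iff v₀).1 (by simp [s0])
  exact h0 ⟨a, m0⟩

theorem difference_isFiberLength (hk₀ : IsFiberLength G₀ k₀) (hk₁ : IsFiberLength G₁ k₁) :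
    IsFiberLength (difference G₀ G₁ k₀ k₁ θ) 1 := by
  have h0 := hk₀.1.1
  have h1 := hk₁.1.1
  constructor
  · refine ⟨one_pos, ?_⟩
    have := plus_mem_difference (θ := θ) (k₀ := k₀) (k₁ := k₁) (x := 1) (a := 0) (b := k₁)
      (by rw [plus_zero]; exact G₀.one_mem) (by rw [map_one]; exact hk₁.1.2)
    simpa [h1.ne'] using this
  · rintro c ⟨hc, hm⟩
    obtain ⟨a, b, ha, hb, e⟩ := exists_of_plus_mem_difference (x := 1) hm
    obtain ⟨n, rfl⟩ := hk₀.one_plus_mem_iff.1 ha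
    rw [map_one] at hb
    obtain ⟨m, rfl⟩ := hk₁.one_plus_mem_iff.1 hb
    rw [mul_div_cancel_left₀ _ h1.ne', mul_div_cancel_left₀ _ h0.ne'] at e
    subst e
    have : 0 < m - n := by exact_mod_cast hc
    exact_mod_cast this

end difference

theorem HasName.isInterval_iff {σ : OrbifoldSymbol} {G : Subgroup FibIsom}
    {s : Gen σ → (Plane ≃ᵢ Plane)} {N : Name σ} (h : HasName G s N) :
    N.interval = true ↔ IsInterval G := by
  obtain ⟨k, -, h, -⟩ := h
  exact h.interval

/-! ### Equal names make the difference trivial -/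

section same_name

variable {σ : OrbifoldSymbol} {G₀ G₁ : Subgroup FibIsom} {k₀ k₁ : ℝ}
  {s₀ s₁ : Gen σ → (Plane ≃ᵢ Plane)} {N : Name σ}

theorem DigitRule.isPlus_iff {G : Subgroup FibIsom} {k : ℝ} {n : ℕ} {h : Plane ≃ᵢ Plane}
    {o : Option ℕ} (hr : DigitRule G k n h o) : IsPlus G h ↔ o.isSome = true := by
  cases o with
  | none => simpa [DigitRule] using hr
  | some a => exact iff_of_true ⟨_, hr.2⟩ rfl

theorem MirrorRule.isPlus_iff {G : Subgroup FibIsom} {k : ℝ} {h : Plane ≃ᵢ Plane}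
    {o : MirrorMark} (hr : MirrorRule G k h o) : IsPlus G h ↔ o ≠ .blank := by
  cases o with
  | blank => simpa [MirrorRule] using hr
  | dot => exact iff_of_true ⟨_, hr⟩ (by simp)
  | colon => exact iff_of_true ⟨_, hr⟩ (by simp)

theorem isPlus_iff_of_same_name (h0 : SimpleRule G₀ s₀ k₀ N) (h1 : SimpleRule G₁ s₁ k₁ N)
    (c0 : CircularRule G₀ s₀ k₀ N) (c1 : CircularRule G₁ s₁ k₁ N) (x : Gen σ) :
    IsPlus G₀ (s₀ x) ↔ IsPlus G₁ (s₁ x) := by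
  rcases x with i | i | i | i | ⟨i, j⟩ | i
  · exact not_iff_not.1 ((h0.ring i).symm.trans (h1.ring i))
  · rw [← c0.ring_same, ← c1.ring_same]
    exact not_iff_not.1 ((h0.ring i).symm.trans (h1.ring i))
  · rw [(h0.gyration i).isPlus_iff, (h1.gyration i).isPlus_iff]
  · exact not_iff_not.1 ((h0.star i).symm.trans (h1.star i))
  · rw [(h0.mirror i j).isPlus_iff, (h1.mirror i j).isPlus_iff]
  · exact not_iff_not.1 ((h0.cross i).symm.trans (h1.cross i))

variable {θ : horizontal G₀ →* Plane ≃ᵢ Plane} {t : Gen σ → horizontal G₀}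

theorem DigitRule.one_mem_difference (hk₀ : IsFiberLength G₀ k₀) (hk₁ : IsFiberLength G₁ k₁)
    {x : horizontal G₀} {n : ℕ} {o : Option ℕ} (h0 : DigitRule G₀ k₀ n x o)
    (h1 : DigitRule G₁ k₁ n (θ x) o)
    (hx : IsPlus (difference G₀ G₁ k₀ k₁ θ) x) :
    ((x : Plane ≃ᵢ Plane), 1) ∈ difference G₀ G₁ k₀ k₁ θ := by
  rw [isPlus_difference_iff] at hx
  cases o with
  | none => exact absurd hx.1 h0
  | some a =>
    have := plus_mem_difference (k₀ := k₀) (k₁ := k₁) h0.2 h1.2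
    rwa [mul_div_cancel_left₀ _ hk₀.1.1.ne', mul_div_cancel_left₀ _ hk₁.1.1.ne', sub_self,
      plus_zero] at this

theorem MirrorRule.one_mem_difference (hk₀ : IsFiberLength G₀ k₀) (hk₁ : IsFiberLength G₁ k₁)
    {x : horizontal G₀} {o : MirrorMark} (h0 : MirrorRule G₀ k₀ x o)
    (h1 : MirrorRule G₁ k₁ (θ x) o)
    (hx : IsPlus (difference G₀ G₁ k₀ k₁ θ) x) :
    ((x : Plane ≃ᵢ Plane), 1) ∈ difference G₀ G₁ k₀ k₁ θ := by
  rw [isPlus_difference_iff] at hx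
  cases o with
  | blank => exact absurd hx.1 h0
  | dot =>
    have := plus_mem_difference (k₀ := k₀) (k₁ := k₁) h0 h1
    rwa [zero_div, zero_div, sub_self, plus_zero] at this
  | colon =>
    have := plus_mem_difference (k₀ := k₀) (k₁ := k₁) h0 h1
    rwa [mul_div_cancel_left₀ _ hk₀.1.1.ne', mul_div_cancel_left₀ _ hk₁.1.1.ne', sub_self,
      plus_zero] at this

/-- The symbol has no rings, or a single ring and nothing else. -/
def OrbifoldSymbol.NoRingOrTorus (σ : OrbifoldSymbol) : Prop :=
  σ.rings = 0 ∨ σ.rings = 1 ∧ σ.gyrations = [] ∧ σ.kaleidoscopes = [] ∧ σ.crosses = 0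

theorem eq_of_fract_eq {a b : ℝ} {m n : ℤ} (ha : 0 ≤ a) (ha1 : a < 1) (hb : 0 ≤ b) (hb1 : b < 1)
    (h : a + m = b + n) : a = b := by
  have h1 : ((m - n : ℤ) : ℝ) = b - a := by push_cast; linarith
  have h2 : ((m - n : ℤ) : ℝ) < 1 := by rw [h1]; linarith
  have h3 : (-1 : ℝ) < ((m - n : ℤ) : ℝ) := by rw [h1]; linarith
  have h4 : m - n < 1 := by exact_mod_cast h2
  have h5 : -1 < m - n := by exact_mod_cast h3
  have h6 : m - n = 0 := by omega
  rw [h6] at h1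
  push_cast at h1
  linarith

/-- For the torus the remaining factors of the global relation form the empty product, so `κ` is an
integer in `[0, 1)`, that is `0`, and the sum has a single term. -/
theorem RingEquation.exists_sub_eq {G : Subgroup FibIsom} {s : Gen σ → (Plane ≃ᵢ Plane)} {k : ℝ}
    {e : Fin 2} (hk : IsFiberLength G k)
    (hσ : σ.rings = 1 ∧ σ.gyrations = [] ∧ σ.kaleidoscopes = [] ∧ σ.crosses = 0)
    (h : RingEquation G s k N e) (i : Fin σ.rings) (hi : N.ringBar i = true) :
    ∃ x y, (s (.X i), minus (k * x)) ∈ G ∧ (s (.Y i), minus (k * y)) ∈ G ∧ x - y = (e : ℕ) / 2 := by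
  obtain ⟨κ, x, y, h0, h1, hm, hxy, hs⟩ := h
  have : gyrProd s * lamProd s * crossProd s = 1 := by
    rw [gyrProd, lamProd, crossProd, List.ofFn_eq_nil_iff.2 (by simp [hσ.2.1]),
      List.ofFn_eq_nil_iff.2 (by simp [hσ.2.2.1]), List.ofFn_eq_nil_iff.2 hσ.2.2.2]
    simp
  rw [this, hk.one_plus_mem_iff] at hm
  obtain ⟨n, hn⟩ := hm
  have hκ : κ = 0 := by
    have : κ = n := mul_left_cancel₀ hk.1.1.ne' hn
    exact eq_of_fract_eq (m := 0) (n := n) h0 h1 le_rfl one_pos (by simpa using this)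
  have : Subsingleton (Fin σ.rings) := by rw [hσ.1]; infer_instance
  rw [Fintype.sum_subsingleton _ i, if_pos hi, hκ, sub_zero] at hs
  exact ⟨x i, y i, (hxy i hi).1, (hxy i hi).2, hs⟩

/-- Each embellishment pins down a constant in units of the fiber length, or a combination of such
constants. Equal names make it cancel when the couplings are subtracted. -/
theorem isTrivialCoupling_difference (hσ : σ.NoRingOrTorus) (hk₀ : IsFiberLength G₀ k₀)
    (hk₁ : IsFiberLength G₁ k₁)
    (hθ : ∀ x, θ (t x) = s₁ x) (ht : ∀ x, (t x : Plane ≃ᵢ Plane) = s₀ x)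
    (hH₁ : ∀ x, s₁ x ∈ horizontal G₁) (hrel : Relations s₀) (hc : ¬ IsInterval G₀) (hcc : ¬ IsInterval G₁)
    (h0 : SimpleRule G₀ s₀ k₀ N) (h1 : SimpleRule G₁ s₁ k₁ N)
    (c0 : CircularRule G₀ s₀ k₀ N) (c1 : CircularRule G₁ s₁ k₁ N) :
    IsTrivialCoupling (difference G₀ G₁ k₀ k₁ θ) s₀ := by
  have p0 := hk₀.1.1
  have p1 := hk₁.1.1
  have hs : ∀ x, IsPlus G₀ (s₀ x) ↔ IsPlus G₁ (s₁ x) := isPlus_iff_of_same_name h0 h1 c0 c1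
  have hW : ∀ x, IsPlus (difference G₀ G₁ k₀ k₁ θ) (s₀ x) ↔ IsPlus G₀ (s₀ x) := fun x => by
    rw [← ht, isPlus_difference_iff, hθ, ht, ← hs, and_self]
  have hA0 : ∀ i, AllMinus (difference G₀ G₁ k₀ k₁ θ) s₀ i ↔ AllMinus G₀ s₀ i := fun i => by
    simp only [AllMinus, hW]
  have hA1 : ∀ i, AllMinus (difference G₀ G₁ k₀ k₁ θ) s₀ i ↔ AllMinus G₁ s₁ i := fun i => by
    simp only [AllMinus, hW, hs]
  have memp : ∀ {x a b c}, (s₀ x, plus a) ∈ G₀ → (s₁ x, plus b) ∈ G₁ → b / k₁ - a / k₀ = c →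
      (s₀ x, plus c) ∈ difference G₀ G₁ k₀ k₁ θ := by
    rintro x a b c ha hb rfl
    rw [← ht] at ha ⊢; rw [← hθ] at hb; exact plus_mem_difference ha hb
  have memm : ∀ {x a b c}, (s₀ x, minus a) ∈ G₀ → (s₁ x, minus b) ∈ G₁ → b / k₁ - a / k₀ = c →
      (s₀ x, minus c) ∈ difference G₀ G₁ k₀ k₁ θ := by
    rintro x a b c ha hb rfl
    rw [← ht] at ha ⊢; rw [← hθ] at hb; exact minus_mem_difference ha hb
  have hminus : ∀ {x}, ¬ IsPlus G₀ (s₀ x) →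
      ∃ a b, (s₀ x, minus a) ∈ G₀ ∧ (s₁ x, minus b) ∈ G₁ := fun {x} hx => by
    obtain ⟨a, ha⟩ := (isPlus_or_exists_minus (ht x ▸ (t x).2)).resolve_left hx
    obtain ⟨b, hb⟩ := (isPlus_or_exists_minus (hH₁ x)).resolve_left fun h => hx ((hs x).2 h)
    exact ⟨a, b, ha, hb⟩
  have hsurj : ∀ x, s₀ x ∈ horizontal (difference G₀ G₁ k₀ k₁ θ) := fun x => by
    by_cases hx : IsPlus G₀ (s₀ x)
    · obtain ⟨c, hc⟩ := (hW x).2 hx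
      exact mem_horizontal.2 ⟨_, hc⟩
    · obtain ⟨a, b, ha, hb⟩ := hminus hx
      exact mem_horizontal.2 ⟨_, memm ha hb rfl⟩
  have hgyr : ∀ i, IsPlus (difference G₀ G₁ k₀ k₁ θ) (s₀ (.γ i)) →
      (s₀ (.γ i), 1) ∈ difference G₀ G₁ k₀ k₁ θ := fun i => by
    have e0 := h0.gyration i
    have e1 := h1.gyration i
    rw [← ht] at e0 ⊢; rw [← hθ] at e1
    exact e0.one_mem_difference hk₀ hk₁ e1
  have hstar : ∀ i, AllMinus (difference G₀ G₁ k₀ k₁ θ) s₀ i →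
      IsPlus (difference G₀ G₁ k₀ k₁ θ) (s₀ (.lam i)) →
      (s₀ (.lam i), 1) ∈ difference G₀ G₁ k₀ k₁ θ := fun i ha hl => by
    obtain ⟨e, he, hS0⟩ := c0.star_some i ((hA0 i).1 ha)
    obtain ⟨e', he', hS1⟩ := c1.star_some i ((hA1 i).1 ha)
    obtain rfl : e = e' := Option.some.inj (he.symm.trans he')
    rw [hW] at hl
    rcases hS0 with hS0 | ⟨p, l, -, hl', -⟩
    swap
    · exact absurd hl (not_isPlus_of_minus hc hl')
    rcases hS1 with hS1 | ⟨p, l, -, hl', -⟩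
    swap
    · exact absurd ((hs _).1 hl) (not_isPlus_of_minus hcc hl')
    rw [← plus_zero]
    refine memp hS0 hS1 ?_
    rw [mul_div_cancel_left₀ _ p0.ne', mul_div_cancel_left₀ _ p1.ne', sub_self]
  refine ⟨difference_isFiberLength hk₀ hk₁, difference_circular hc, hsurj, hrel,
    hgyr, fun i j => ?_, fun i j => ?_, hstar, fun i ha hl => ?_, fun i => ?_,
    fun hγ hl => ?_⟩
  · have e0 := h0.mirror i j
    have e1 := h1.mirror i j
    rw [← ht] at e0 ⊢; rw [← hθ] at e1
    exact e0.one_mem_difference hk₀ hk₁ e1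
  · have e0 := h0.corner i j
    have e1 := h1.corner i j
    rw [← ht, ← ht, ← Subgroup.coe_mul] at e0 ⊢; rw [← hθ, ← hθ, ← map_mul] at e1
    exact e0.one_mem_difference hk₀ hk₁ e1
  · obtain ⟨e, he, hS0⟩ := c0.star_some i ((hA0 i).1 ha)
    obtain ⟨e', he', hS1⟩ := c1.star_some i ((hA1 i).1 ha)
    obtain rfl : e = e' := Option.some.inj (he.symm.trans he')
    rw [hW] at hl
    rcases hS0 with hS0 | ⟨p, l, hp, hl', e0⟩
    · exact absurd ⟨_, hS0⟩ hl
    rcases hS1 with hS1 | ⟨q, m, hq, hm', e1⟩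
    · exact absurd ((hs _).2 ⟨_, hS1⟩) hl
    -- Equal subscripts give `p - l = q - m`, hence `q - p = m - l`: the mirror and `λ` have the
    -- same reflection in the difference.
    refine ⟨q - p, memm hp hq ?_, memm hl' hm' ?_⟩ <;>
      rw [mul_div_cancel_left₀ _ p0.ne', mul_div_cancel_left₀ _ p1.ne']
    linarith
  · by_cases hx : IsPlus G₀ (s₀ (.X i))
    · left
      obtain ⟨a, ha⟩ := (hW _).2 hx
      obtain ⟨b, hb⟩ := (hW _).2 ((c0.ring_same i).1 hx)
      exact ⟨a, b, ha, hb⟩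
    · right
      have hi : N.ringBar i = true := (h0.ring i).2 hx
      have hσ1 := hσ.resolve_left fun h => by
        have := i.2
        omega
      obtain ⟨e, he, hS0⟩ := c0.ring_some i hi
      obtain ⟨e', he', hS1⟩ := c1.ring_some i hi
      obtain rfl : e = e' := Option.some.inj (he.symm.trans he')
      obtain ⟨x, y, hx, hy, hxy⟩ := hS0.exists_sub_eq hk₀ hσ1 i hi
      obtain ⟨u, v, hu, hv, huv⟩ := hS1.exists_sub_eq hk₁ hσ1 i hi
      refine ⟨u - x, memm hx hu ?_, memm hy hv ?_⟩ <;>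
        rw [mul_div_cancel_left₀ _ p0.ne', mul_div_cancel_left₀ _ p1.ne']
      linarith
  · by_cases hz : ∃ i, N.crossBar i = false
    -- If all crosses are barred, they are coupled with reflections and their squares are trivial.
    swap
    · have hz' : ∀ i, ∃ c, (s₀ (.Z i), minus c) ∈ difference G₀ G₁ k₀ k₁ θ := fun i => by
        have : N.crossBar i = true := by
          by_contra h
          exact hz ⟨i, by simpa using h⟩
        obtain ⟨a, b, ha, hb⟩ := hminus ((h0.cross i).1 this)
        exact ⟨_, memm ha hb rfl⟩
      choose c hc using hz'
      exact ⟨fun i => minus (c i), hc, by simp [minus_sq]⟩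
    obtain ⟨i₁, hi₁⟩ := hz
    have hσ0 : σ.rings = 0 := hσ.resolve_right fun h => by
      have := i₁.2
      omega
    have hE : ∀ i : Fin σ.rings, False := fun i => by
      have := i.2
      omega
    have hR0 : Rigid G₀ s₀ := ⟨fun i => (hE i).elim, fun i => (hW _).1 (hγ i),
      fun i => ⟨(hW _).1 (hl i).1, (hA0 i).1 (hl i).2⟩⟩
    have hR1 : Rigid G₁ s₁ := ⟨fun i => (hE i).elim, fun i => (hs _).1 (hR0.2.1 i),
      fun i => ⟨(hs _).1 (hR0.2.2 i).1, (hA1 i).1 (hl i).2⟩⟩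
    obtain ⟨e, he, κ, z, hκ0, hκ1, hκ, hz, hsum⟩ := c0.cross_some i₁ hi₁ hR0
    obtain ⟨e', he', κ', z', hκ0', hκ1', hκ', hz', hsum'⟩ := c1.cross_some i₁ hi₁ hR1
    obtain rfl : e = e' := Option.some.inj (he.symm.trans he')
    have hs₀ : s₀ = fun x => (horizontal G₀).subtype (t x) := funext fun x => (ht x).symm
    have hs₁ : s₁ = fun x => θ (t x) := funext fun x => (hθ x).symm
    -- In the rigid case all `γ` and `λ` are coupled with the identity in the difference, so `κ` and
    -- `κ'` differ by an integer; both lie in `[0, 1)`.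
    have hκκ : κ = κ' := by
      have h1 : gyrProd s₀ * lamProd s₀ ∈ (difference G₀ G₁ k₀ k₁ θ).comap (MonoidHom.inl _ _) :=
        Subgroup.mul_mem _ (gyrProd_mem fun i => hgyr i (hγ i))
          (lamProd_mem fun i => hstar i (hl i).2 (hl i).1)
      rw [ringProd_eq_one hσ0, one_mul] at hκ hκ'
      rw [hs₀, ← map_gyrProd, ← map_lamProd, ← map_mul, Subgroup.coe_subtype] at hκ h1
      rw [hs₁, ← map_gyrProd, ← map_lamProd, ← map_mul] at hκ'
      rw [Subgroup.mem_comap, MonoidHom.inl_apply, ← plus_zero] at h1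
      obtain ⟨a, b, ha, hb, hab⟩ := exists_of_plus_mem_difference h1
      obtain ⟨n, rfl⟩ := (hk₀.plus_mem_iff hκ).1 ha
      obtain ⟨m, rfl⟩ := (hk₁.plus_mem_iff hκ').1 hb
      rw [← mul_add, ← mul_add, mul_div_cancel_left₀ _ p0.ne', mul_div_cancel_left₀ _ p1.ne'] at hab
      exact eq_of_fract_eq (m := n) (n := m) hκ0 hκ1 hκ0' hκ1' (by linarith)
    subst hκκ
    -- An unbarred cross contributes `2 (z' - z)` and a barred one nothing. With `κ = κ'` the two
    -- cross equations have the same right side, so the contributions add up to `0`.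
    have hv : ∀ i, ∃ v, (s₀ (.Z i), v) ∈ difference G₀ G₁ k₀ k₁ θ ∧
        v ^ 2 = plus (2 * (if N.crossBar i = false then z' i - z i else 0)) := fun i => by
      by_cases hi : N.crossBar i = false
      · refine ⟨plus (z' i - z i), memp (hz i hi) (hz' i hi) ?_, ?_⟩
        · rw [mul_div_cancel_left₀ _ p0.ne', mul_div_cancel_left₀ _ p1.ne']
        · rw [if_pos hi, plus_pow]; norm_num
      · obtain ⟨a, b, ha, hb⟩ := hminus ((h0.cross i).1 (by simpa using hi))
        exact ⟨_, memm ha hb rfl, by rw [if_neg hi, minus_sq, mul_zero, plus_zero]⟩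
    choose v hv hv2 using hv
    refine ⟨v, hv, ?_⟩
    simp only [hv2]
    rw [prod_ofFn_plus, ← Finset.mul_sum, ← plus_zero]
    congr 1
    have : ∀ i, (if N.crossBar i = false then z' i - z i else 0) =
        (if N.crossBar i = false then z' i else 0) - (if N.crossBar i = false then z i else 0) :=
      fun i => by split_ifs <;> simp
    simp only [this]
    rw [Finset.sum_sub_distrib, hsum, hsum', sub_self, mul_zero]

end same_name

end

section

/-! ### Standard generators -/

section standard

variable {σ : OrbifoldSymbol} {H H' : Subgroup (Plane ≃ᵢ Plane)} {s s' : Gen σ → (Plane ≃ᵢ Plane)}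

theorem IsStandard.mem (h : IsStandard H s) (x : Gen σ) : s x ∈ H := by
  obtain ⟨e, he⟩ := h
  rw [← he]
  exact (e _).2

theorem IsStandard.relations (h : IsStandard H s) : Relations s := by
  obtain ⟨e, he⟩ := h
  rw [relations_iff]
  intro w hw
  have h1 : FreeGroup.lift s =
      (H.subtype.comp e.toMonoidHom).comp (PresentedGroup.mk {w | Relator σ w}) := by
    ext x : 1
    rw [FreeGroup.lift_apply_of]
    exact (he x).symm
  have h2 : PresentedGroup.mk {w | Relator σ w} w = 1 := PresentedGroup.one_of_mem hw
  rw [h1, MonoidHom.comp_apply, h2, map_one]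

theorem IsStandard.exists_hom (h : IsStandard H s) {Δ : Type} [Group Δ] {V : Gen σ → Δ}
    (hV : Relations V) : ∃ R : H →* Δ, ∀ x, R ⟨s x, h.mem x⟩ = V x := by
  have h' := h
  obtain ⟨e, he⟩ := h'
  refine ⟨(PresentedGroup.toGroup (rels := {w | Relator σ w})
    ((relations_iff V).1 hV)).comp e.symm.toMonoidHom, fun x => ?_⟩
  have : (⟨s x, h.mem x⟩ : H) = e (PresentedGroup.of x) := Subtype.ext (he x).symm
  rw [this]
  simp

theorem IsStandard.eq_top (h : IsStandard H s) {K : Subgroup H}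
    (hK : ∀ x, (⟨s x, h.mem x⟩ : H) ∈ K) : K = ⊤ := by
  have h' := h
  obtain ⟨e, he⟩ := h'
  rw [eq_top_iff]
  rintro y -
  obtain ⟨z, rfl⟩ := e.surjective y
  have hle : Subgroup.closure (Set.range PresentedGroup.of) ≤ K.comap e.toMonoidHom := by
    rw [Subgroup.closure_le]
    rintro _ ⟨x, rfl⟩
    have : (⟨s x, h.mem x⟩ : H) = e (PresentedGroup.of x) := Subtype.ext (he x).symm
    have hx := hK x
    rw [this] at hx
    exact hx
  rw [PresentedGroup.closure_range_of] at hle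
  exact hle (Subgroup.mem_top z)

theorem IsStandard.exists_mulEquiv (h : IsStandard H s) (h' : IsStandard H' s') :
    ∃ θ : H ≃* H', ∀ x, (θ ⟨s x, h.mem x⟩ : Plane ≃ᵢ Plane) = s' x := by
  have g := h
  obtain ⟨e, he⟩ := g
  obtain ⟨e', he'⟩ := h'
  refine ⟨e.symm.trans e', fun x => ?_⟩
  have : (⟨s x, h.mem x⟩ : H) = e (PresentedGroup.of x) := Subtype.ext (he x).symm
  rw [this, ← he']
  simp

end standard

/-! ### Twists -/

/-- The projection of `G` to its plane group. -/
def toHorizontal (G : Subgroup FibIsom) : G →* horizontal G :=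
  (MonoidHom.fst (Plane ≃ᵢ Plane) (ℝ ≃ᵢ ℝ)).subgroupMap G

@[simp] theorem coe_toHorizontal {G : Subgroup FibIsom} (g : G) :
    (toHorizontal G g : Plane ≃ᵢ Plane) = (g : FibIsom).1 := rfl

/-- The vertical operation `v` followed by the translation by `d` and rescaled by the factor `r`. -/
def twistVertical (r d : ℝ) (v : ℝ ≃ᵢ ℝ) : ℝ ≃ᵢ ℝ :=
  if slope v = 1 then plus (r * (d + v 0)) else minus (r * (d + v 0))

theorem slope_twistVertical (r d : ℝ) (v : ℝ ≃ᵢ ℝ) : slope (twistVertical r d v) = slope v := by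
  unfold twistVertical
  rcases slope_eq_one_or v with h | h
  · simp [h]
  · rw [h, if_neg (by norm_num), slope_minus]

theorem twistVertical_zero (r d : ℝ) (v : ℝ ≃ᵢ ℝ) : twistVertical r d v 0 = r * (d + v 0) := by
  unfold twistVertical
  split_ifs <;> simp [plus_apply, minus_apply]

/-- The offset of the product is the cocycle rule of `IsTwist.map_mul`, which is what makes
`twistHom` multiplicative. -/
theorem twistVertical_mul (r d d' : ℝ) (v v' : ℝ ≃ᵢ ℝ) :
    twistVertical r (d + slope v * d') (v * v') = twistVertical r d v * twistVertical r d' v' := by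
  refine vertical_ext ?_ ?_
  · rw [vertical_mul_zero, twistVertical_zero, twistVertical_zero, twistVertical_zero,
      slope_twistVertical, vertical_mul_zero]
    ring
  · rw [slope_mul, slope_twistVertical, slope_twistVertical, slope_twistVertical, slope_mul]

theorem twistVertical_plus (r d c : ℝ) : twistVertical r d (plus c) = plus (r * (d + c)) := by
  simp [twistVertical, plus_apply]

theorem twistVertical_minus (r d c : ℝ) : twistVertical r d (minus c) = minus (r * (d + c)) := by
  rw [twistVertical, if_neg (by rw [slope_minus]; norm_num), minus_apply, sub_zero]

/-- `D` is a cocycle that, together with the homomorphism `θ` of plane groups and the change of the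
fiber length from `k₀` to `k₁`, carries `G₀` into `G₁`. -/
structure IsTwist (G₀ G₁ : Subgroup FibIsom) (k₀ k₁ : ℝ) (θ : horizontal G₀ →* Plane ≃ᵢ Plane)
    (D : G₀ → ℝ) : Prop where
  map_mul : ∀ g g' : G₀, D (g * g') = D g + slope (g : FibIsom).2 * D g'
  vertical : ∀ g : G₀, (g : FibIsom).1 = 1 → slope (g : FibIsom).2 = 1 → D g = 0
  mem : ∀ g : G₀, (θ (toHorizontal G₀ g), twistVertical (k₁ / k₀) (D g) (g : FibIsom).2) ∈ G₁

variable {σ : OrbifoldSymbol} {G₀ G₁ : Subgroup FibIsom} {k₀ k₁ : ℝ}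
  {s₀ s₁ : Gen σ → (Plane ≃ᵢ Plane)} {N : Name σ} {θ : horizontal G₀ →* Plane ≃ᵢ Plane}

/-- The cocycle is `k₀` times the height of `R` at `0`: it obeys the cocycle rule because `R` is a
homomorphism with the slopes of `G₀`, and it turns heights of `G₀` into heights of `G₁` up to
multiples of `k₁`. -/
theorem exists_isTwist_of_hom (hk₀ : IsFiberLength G₀ k₀) (hk₁ : IsFiberLength G₁ k₁)
    (hc : ¬ IsInterval G₀) {R : horizontal G₀ →* ℝ ≃ᵢ ℝ}
    (hR : ∀ x : horizontal G₀, ((x : Plane ≃ᵢ Plane), R x) ∈ difference G₀ G₁ k₀ k₁ θ) :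
    ∃ D, IsTwist G₀ G₁ k₀ k₁ θ D := by
  have p0 := hk₀.1.1
  have p1 := hk₁.1.1
  -- Membership in the difference supplies some coupling `v₀` of the horizontal part; `g` itself
  -- differs from it by a multiple of `k₀`, whence the integer `n`.
  have key : ∀ g : G₀, slope (R (toHorizontal G₀ g)) = slope (g : FibIsom).2 ∧
      ∃ (v₁ : ℝ ≃ᵢ ℝ) (n : ℤ), (θ (toHorizontal G₀ g), v₁) ∈ G₁ ∧ slope v₁ = slope (g : FibIsom).2 ∧
        R (toHorizontal G₀ g) 0 = v₁ 0 / k₁ - (g : FibIsom).2 0 / k₀ + n := by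
    rintro ⟨⟨h, v⟩, hg⟩
    obtain ⟨v₀, v₁, h0, h1, e0, e1, e⟩ := exists_of_mem_difference (hR (toHorizontal G₀ ⟨(h, v), hg⟩))
    simp only [coe_toHorizontal] at h0 ⊢
    rcases exists_eq_plus_or_minus v with ⟨c, rfl⟩ | ⟨c, rfl⟩
    · obtain ⟨a, rfl⟩ := vertical_eq_plus_of_isPlus hc h0 ⟨c, hg⟩
      obtain ⟨n, rfl⟩ := (hk₀.plus_mem_iff h0).1 hg
      refine ⟨by rw [← e0]; simp, v₁, n, h1, by rw [e1, ← e0]; simp, ?_⟩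
      rw [e, plus_apply, plus_apply]; field_simp; ring
    · obtain ⟨a, rfl⟩ := vertical_eq_minus_of_not_isPlus h0 (not_isPlus_of_minus hc hg)
      obtain ⟨n, rfl⟩ := (hk₀.minus_mem_iff h0).1 hg
      refine ⟨by rw [← e0]; simp, v₁, n, h1, by rw [e1, ← e0]; simp, ?_⟩
      rw [e, minus_apply, minus_apply]; field_simp; ring
  refine ⟨fun g => k₀ * R (toHorizontal G₀ g) 0, fun g g' => ?_, fun g h1 _ => ?_, fun g => ?_⟩
  · rw [map_mul, map_mul, vertical_mul_zero, (key g).1]; ring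
  · have : toHorizontal G₀ g = 1 := Subtype.ext h1
    rw [this, map_one, IsometryEquiv.coe_one, id, mul_zero]
  · obtain ⟨hs, v₁, n, h1, e1, e⟩ := key g
    have e2 : k₁ / k₀ * (k₀ * R (toHorizontal G₀ g) 0 + (g : FibIsom).2 0) = v₁ 0 + k₁ * n := by
      rw [e]; field_simp; ring
    simp only [twistVertical, e2]
    split_ifs with h
    · obtain ⟨b, rfl⟩ := (slope_eq_one_iff v₁).1 (e1.trans h)
      exact (hk₁.plus_mem_iff h1).2 ⟨n, by simp [plus_apply]⟩
    · obtain ⟨b, rfl⟩ := (slope_eq_neg_one_iff v₁).1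
        (e1.trans ((slope_eq_one_or _).resolve_left h))
      exact (hk₁.minus_mem_iff h1).2 ⟨n, by simp [minus_apply]⟩

/-- The plus couplings agree already. Only the reflections need a shift, by the one constant that
takes `c₀` to `c₁` after rescaling; a function that is `0` on slope `1` and constant on slope `-1`
is a cocycle. -/
theorem exists_isTwist_interval (hk₀ : IsFiberLength G₀ k₀) (hk₁ : IsFiberLength G₁ k₁)
    (hc₀ : IsInterval G₀) (hc₁ : IsInterval G₁)
    (hR : ∀ x : horizontal G₀, ∃ c : ℝ, ((x : Plane ≃ᵢ Plane), plus (k₀ * c)) ∈ G₀ ∧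
      (θ x, plus (k₁ * c)) ∈ G₁) :
    ∃ D, IsTwist G₀ G₁ k₀ k₁ θ D := by
  have p0 := hk₀.1.1
  have p1 := hk₁.1.1
  obtain ⟨c₀, hc₀⟩ := hc₀
  obtain ⟨c₁, hc₁⟩ := hc₁
  refine ⟨fun g => if slope (g : FibIsom).2 = 1 then 0 else k₀ * (c₁ / k₁ - c₀ / k₀),
    fun g g' => ?_, fun g _ h => if_pos h, ?_⟩
  · rw [Subgroup.coe_mul, Prod.snd_mul, slope_mul]
    rcases slope_eq_one_or (g : FibIsom).2 with h | h <;>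
    rcases slope_eq_one_or (g' : FibIsom).2 with h' | h' <;> rw [h, h'] <;> norm_num
  · rintro ⟨⟨h, v⟩, hg⟩
    obtain ⟨c, m0, m1⟩ := hR (toHorizontal G₀ ⟨(h, v), hg⟩)
    simp only [coe_toHorizontal] at m0
    rcases exists_eq_plus_or_minus v with ⟨d, rfl⟩ | ⟨d, rfl⟩
    · obtain ⟨n, rfl⟩ := (hk₀.plus_mem_iff m0).1 hg
      simp only [slope_plus, if_true, twistVertical_plus]
      refine (hk₁.plus_mem_iff m1).2 ⟨n, ?_⟩
      field_simp; ring
    · have m2 := G₀.mul_mem m0 hc₀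
      have m3 := G₁.mul_mem m1 hc₁
      rw [Prod.mk_mul_mk, mul_one, plus_mul_minus] at m2 m3
      obtain ⟨n, rfl⟩ := (hk₀.minus_mem_iff m2).1 hg
      have : ¬ ((-1 : ℝ) = 1) := by norm_num
      simp only [slope_minus, this, if_false, twistVertical_minus]
      refine (hk₁.minus_mem_iff m3).2 ⟨n, ?_⟩
      field_simp; ring

/-- Plus couplings add along products, so the elements with a common constant form a subgroup; it
contains the generators. -/
theorem exists_coupling_of_generators (hst : IsStandard (horizontal G₀) s₀)
    (hθ : ∀ x, θ ⟨s₀ x, hst.mem x⟩ = s₁ x)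
    (h : ∀ x, ∃ c : ℝ, (s₀ x, plus (k₀ * c)) ∈ G₀ ∧ (s₁ x, plus (k₁ * c)) ∈ G₁)
    (x : horizontal G₀) :
    ∃ c : ℝ, ((x : Plane ≃ᵢ Plane), plus (k₀ * c)) ∈ G₀ ∧ (θ x, plus (k₁ * c)) ∈ G₁ := by
  let K : Subgroup (horizontal G₀) :=
    { carrier := {x | ∃ c : ℝ, ((x : Plane ≃ᵢ Plane), plus (k₀ * c)) ∈ G₀ ∧
        (θ x, plus (k₁ * c)) ∈ G₁}
      one_mem' := ⟨0, by rw [mul_zero, plus_zero]; exact G₀.one_mem,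
        by rw [map_one, mul_zero, plus_zero]; exact G₁.one_mem⟩
      mul_mem' := by
        rintro x y ⟨c, h0, h1⟩ ⟨d, g0, g1⟩
        refine ⟨c + d, ?_, ?_⟩
        · have := G₀.mul_mem h0 g0
          rwa [Prod.mk_mul_mk, plus_mul_plus, ← mul_add] at this
        · have := G₁.mul_mem h1 g1
          rwa [Prod.mk_mul_mk, plus_mul_plus, ← mul_add, ← map_mul] at this
      inv_mem' := by
        rintro x ⟨c, h0, h1⟩
        refine ⟨-c, ?_, ?_⟩
        · have := G₀.inv_mem h0
          rwa [Prod.inv_mk, plus_inv, ← mul_neg] at this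
        · have := G₁.inv_mem h1
          rwa [Prod.inv_mk, plus_inv, ← mul_neg, ← map_inv] at this }
  have : K = ⊤ := hst.eq_top fun y => by
    obtain ⟨c, h0, h1⟩ := h y
    exact ⟨c, h0, by rwa [hθ]⟩
  exact (this ▸ Subgroup.mem_top x : x ∈ K)

/-- Fibered space groups with the same name differ by a twist. -/
theorem HasName.exists_isTwist (hσ : σ.NoRingOrTorus) (hst₀ : IsStandard (horizontal G₀) s₀)
    (hst₁ : IsStandard (horizontal G₁) s₁) (hN₀ : HasName G₀ s₀ N) (hN₁ : HasName G₁ s₁ N)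
    (hθ : ∀ x, θ ⟨s₀ x, hst₀.mem x⟩ = s₁ x) :
    ∃ k₀ k₁ D, IsFiberLength G₀ k₀ ∧ IsFiberLength G₁ k₁ ∧ IsTwist G₀ G₁ k₀ k₁ θ D := by
  have hint := hN₀.isInterval_iff.symm.trans hN₁.isInterval_iff
  obtain ⟨k₀, hk₀, hS₀, hI₀, hC₀⟩ := hN₀
  obtain ⟨k₁, hk₁, hS₁, hI₁, hC₁⟩ := hN₁
  suffices h : ∃ D, IsTwist G₀ G₁ k₀ k₁ θ D by
    obtain ⟨D, hD⟩ := h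
    exact ⟨k₀, k₁, D, hk₀, hk₁, hD⟩
  by_cases hc : IsInterval G₀
  · have hc₁ := hint.1 hc
    refine exists_isTwist_interval hk₀ hk₁ hc hc₁
      (exists_coupling_of_generators hst₀ hθ fun x => ?_)
    have hp : IsPlus G₀ (s₀ x) := isPlus_of_isInterval hc (hst₀.mem x)
    rcases x with i | i | i | i | ⟨i, j⟩ | i
    · obtain ⟨e, he, h0, -⟩ := (hI₀ hc).ring i
      obtain ⟨e', he', h1, -⟩ := (hI₁ hc₁).ring i
      obtain rfl : e = e' := Option.some.inj (he.symm.trans he')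
      exact ⟨_, h0, h1⟩
    · obtain ⟨e, he, -, h0⟩ := (hI₀ hc).ring i
      obtain ⟨e', he', -, h1⟩ := (hI₁ hc₁).ring i
      obtain rfl : e = e' := Option.some.inj (he.symm.trans he')
      exact ⟨_, h0, h1⟩
    · have h0 := hS₀.gyration i
      have h1 := hS₁.gyration i
      cases ho : N.gyrSub i with
      | none => rw [ho] at h0; exact absurd hp h0
      | some a => rw [ho] at h0 h1; exact ⟨_, h0.2, h1.2⟩
    · obtain ⟨e, he, h0⟩ := (hI₀ hc).star i
      obtain ⟨e', he', h1⟩ := (hI₁ hc₁).star i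
      obtain rfl : e = e' := Option.some.inj (he.symm.trans he')
      exact ⟨_, h0, h1⟩
    · have h0 := hS₀.mirror i j
      have h1 := hS₁.mirror i j
      cases ho : N.mirrorMark i j with
      | blank => rw [ho] at h0; exact absurd hp h0
      | dot =>
        rw [ho] at h0 h1
        exact ⟨0, by rw [mul_zero]; exact h0, by rw [mul_zero]; exact h1⟩
      | colon => rw [ho] at h0 h1; exact ⟨_, h0, h1⟩
    · obtain ⟨e, he, h0⟩ := (hI₀ hc).cross i
      obtain ⟨e', he', h1⟩ := (hI₁ hc₁).cross i
      obtain rfl : e = e' := Option.some.inj (he.symm.trans he')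
      exact ⟨_, h0, h1⟩
  · have hc₁ : ¬ IsInterval G₁ := fun h => hc (hint.2 h)
    -- The lifted generators satisfy the relations, so the presentation turns them into a
    -- homomorphism `R`. Its graph lies in the difference because it does so on generators.
    obtain ⟨V, hV, hrel⟩ := (isTrivialCoupling_difference (t := fun x => ⟨s₀ x, hst₀.mem x⟩)
      hσ hk₀ hk₁ hθ (fun _ => rfl) hst₁.mem hst₀.relations hc hc₁ hS₀ hS₁ (hC₀ hc)
      (hC₁ hc₁)).exists_relations
    obtain ⟨R, hR⟩ := hst₀.exists_hom hrel
    have htop := hst₀.eq_top (K := (difference G₀ G₁ k₀ k₁ θ).comap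
      ((horizontal G₀).subtype.prod R)) fun x => by
        change (s₀ x, R ⟨s₀ x, hst₀.mem x⟩) ∈ difference G₀ G₁ k₀ k₁ θ
        rw [hR]; exact hV x
    refine exists_isTwist_of_hom hk₀ hk₁ hc (R := R) fun x => ?_
    have : x ∈ (difference G₀ G₁ k₀ k₁ θ).comap ((horizontal G₀).subtype.prod R) :=
      htop ▸ Subgroup.mem_top x
    exact this

end

section

/-! ### Uniqueness of the name -/

variable {σ : OrbifoldSymbol} {G : Subgroup FibIsom} {k : ℝ} {s : Gen σ → (Plane ≃ᵢ Plane)}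
  {N N' : Name σ}

theorem fin_two_eq_of_half {e e' : Fin 2} {a : ℝ} {n : ℤ}
    (h : (a + (e : ℕ)) / 2 = (a + (e' : ℕ)) / 2 + n) : e = e' := by
  have h1 : ((e : ℕ) : ℤ) - ((e' : ℕ) : ℤ) = 2 * n := by
    have : ((e : ℕ) : ℝ) - ((e' : ℕ) : ℝ) = 2 * n := by linarith
    exact_mod_cast this
  have := e.2
  have := e'.2
  ext
  omega

theorem IsFiberLength.plus_mem_iff' (hk : IsFiberLength G k) {h : Plane ≃ᵢ Plane} {a b : ℝ}
    (ha : (h, plus (k * a)) ∈ G) : (h, plus (k * b)) ∈ G ↔ ∃ n : ℤ, b = a + n := by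
  rw [hk.plus_mem_iff ha]
  simp only [← mul_add, mul_right_inj' hk.1.1.ne']

theorem IsFiberLength.minus_mem_iff' (hk : IsFiberLength G k) {h : Plane ≃ᵢ Plane} {a b : ℝ}
    (ha : (h, minus (k * a)) ∈ G) : (h, minus (k * b)) ∈ G ↔ ∃ n : ℤ, b = a + n := by
  rw [hk.minus_mem_iff ha]
  simp only [← mul_add, mul_right_inj' hk.1.1.ne']

theorem DigitRule.unique (hk : IsFiberLength G k) {n : ℕ} {h : Plane ≃ᵢ Plane} {o o' : Option ℕ}
    (h1 : DigitRule G k n h o) (h2 : DigitRule G k n h o') : o = o' := by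
  have hs := h1.isPlus_iff.symm.trans h2.isPlus_iff
  cases o with
  | none =>
    cases o' with
    | none => rfl
    | some b => simp at hs
  | some a =>
    cases o' with
    | none => simp at hs
    | some b =>
      obtain ⟨ha, h1⟩ := h1
      obtain ⟨hb, h2⟩ := h2
      obtain ⟨m, hm⟩ := (hk.plus_mem_iff' h1).1 h2
      have hn : (0 : ℝ) < n := by exact_mod_cast (Nat.zero_le _).trans_lt ha
      have := eq_of_fract_eq (a := a / n) (b := b / n) (m := m) (n := 0) (by positivity)
        ((div_lt_one hn).2 (by exact_mod_cast ha)) (by positivity)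
        ((div_lt_one hn).2 (by exact_mod_cast hb)) (by rw [hm]; simp)
      rw [div_left_inj' hn.ne'] at this
      exact congrArg some (by exact_mod_cast this)

theorem MirrorRule.unique (hk : IsFiberLength G k) {h : Plane ≃ᵢ Plane} {o o' : MirrorMark}
    (h1 : MirrorRule G k h o) (h2 : MirrorRule G k h o') : o = o' := by
  have hs := h1.isPlus_iff.symm.trans h2.isPlus_iff
  have key : ¬ ((h, plus 0) ∈ G ∧ (h, plus (k * (1 / 2))) ∈ G) := fun ⟨h1, h2⟩ => by
    rw [← mul_zero k] at h1
    obtain ⟨m, hm⟩ := (hk.plus_mem_iff' h1).1 h2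
    have : (1 : ℤ) = 2 * m := by
      have : (1 : ℝ) = 2 * m := by linarith
      exact_mod_cast this
    omega
  cases o <;> cases o' <;> simp at hs <;> try rfl
  · exact absurd ⟨h1, h2⟩ key
  · exact absurd ⟨h2, h1⟩ key

theorem exists_sum_eq_add_int {n : ℕ} {a b : Fin n → ℝ} (h : ∀ i, ∃ m : ℤ, a i = b i + m) :
    ∃ m : ℤ, ∑ i, a i = ∑ i, b i + m := by
  choose m hm using h
  exact ⟨∑ i, m i, by simp only [hm, Finset.sum_add_distrib]; push_cast; rfl⟩

/-- `κ` is unique in `[0, 1)`, while each `x` and `y` is unique modulo `1`. So `(e - κ) / 2` is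
determined modulo `1`, which fixes the parity `e`. The crosses and stars follow the same pattern. -/
theorem RingEquation.unique (hk : IsFiberLength G k) (hN : N.ringBar = N'.ringBar) {e e' : Fin 2}
    (h : RingEquation G s k N e) (h' : RingEquation G s k N' e') : e = e' := by
  obtain ⟨κ, x, y, h0, h1, hκ, hxy, hs⟩ := h
  obtain ⟨κ', x', y', h0', h1', hκ', hxy', hs'⟩ := h'
  rw [← hN] at hxy' hs'
  obtain ⟨m, hm⟩ := (hk.plus_mem_iff' hκ).1 hκ'
  obtain rfl : κ = κ' := eq_of_fract_eq (m := m) (n := 0) h0 h1 h0' h1' (by rw [hm]; simp)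
  obtain ⟨n, hn⟩ := exists_sum_eq_add_int
    (a := fun i => if N.ringBar i = true then x i - y i else 0)
    (b := fun i => if N.ringBar i = true then x' i - y' i else 0) fun i => by
      by_cases hi : N.ringBar i = true
      · obtain ⟨p, hp⟩ := (hk.minus_mem_iff' (hxy' i hi).1).1 (hxy i hi).1
        obtain ⟨q, hq⟩ := (hk.minus_mem_iff' (hxy' i hi).2).1 (hxy i hi).2
        refine ⟨p - q, ?_⟩
        simp only [hi, if_true]
        rw [hp, hq]; push_cast; ring
      · exact ⟨0, by simp [hi]⟩
  rw [hs, hs'] at hn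
  refine fin_two_eq_of_half (a := -κ) (n := n) ?_
  linarith

theorem CrossEquation.unique (hk : IsFiberLength G k) (hN : N.crossBar = N'.crossBar)
    {e e' : Fin 2} (h : CrossEquation G s k N e) (h' : CrossEquation G s k N' e') : e = e' := by
  obtain ⟨κ, z, h0, h1, hκ, hz, hs⟩ := h
  obtain ⟨κ', z', h0', h1', hκ', hz', hs'⟩ := h'
  rw [← hN] at hz' hs'
  obtain ⟨m, hm⟩ := (hk.plus_mem_iff' hκ).1 hκ'
  obtain rfl : κ = κ' := eq_of_fract_eq (m := m) (n := 0) h0 h1 h0' h1' (by rw [hm]; simp)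
  obtain ⟨n, hn⟩ := exists_sum_eq_add_int
    (a := fun i => if N.crossBar i = false then z i else 0)
    (b := fun i => if N.crossBar i = false then z' i else 0) fun i => by
      by_cases hi : N.crossBar i = false
      · obtain ⟨p, hp⟩ := (hk.plus_mem_iff' (hz' i hi)).1 (hz i hi)
        exact ⟨p, by simp only [hi, if_true]; exact hp⟩
      · exact ⟨0, by simp [hi]⟩
  rw [hs, hs'] at hn
  exact fin_two_eq_of_half hn

theorem StarEquation.unique (hk : IsFiberLength G k) (hc : ¬ IsInterval G)
    (hN : N.digitSub = N'.digitSub) {i : Fin σ.kaleidoscopes.length} {e e' : Fin 2}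
    (h : StarEquation G s k N i e) (h' : StarEquation G s k N' i e') : e = e' := by
  have hsum : N'.digitSum i = N.digitSum i := by simp only [Name.digitSum, hN]
  unfold StarEquation at h h'
  rw [hsum] at h'
  rcases h with h | ⟨p, l, hp, hl, h⟩ <;> rcases h' with h' | ⟨p', l', hp', hl', h'⟩
  · obtain ⟨n, hn⟩ := (hk.plus_mem_iff' h').1 h
    exact fin_two_eq_of_half hn
  · exact absurd ⟨_, h⟩ (not_isPlus_of_minus hc hl')
  · exact absurd ⟨_, h'⟩ (not_isPlus_of_minus hc hl)
  · obtain ⟨m, hm⟩ := (hk.minus_mem_iff' hp').1 hp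
    obtain ⟨n, hn⟩ := (hk.minus_mem_iff' hl').1 hl
    refine fin_two_eq_of_half (a := N.digitSum i) (n := m - n) ?_
    push_cast
    linarith

theorem half_unique (hk : IsFiberLength G k) {h : Plane ≃ᵢ Plane} {e e' : Fin 2}
    (h1 : (h, plus (k * ((e : ℕ) / 2))) ∈ G) (h2 : (h, plus (k * ((e' : ℕ) / 2))) ∈ G) :
    e = e' := by
  obtain ⟨n, hn⟩ := (hk.plus_mem_iff' h2).1 h1
  exact fin_two_eq_of_half (a := 0) (n := n) (by simpa using hn)

theorem HasName.unique (h : HasName G s N) (h' : HasName G s N') : N = N' := by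
  obtain ⟨k, hk, hS, hI, hC⟩ := h
  obtain ⟨k', hk', hS', hI', hC'⟩ := h'
  obtain rfl := hk.unique hk'
  have e1 : N.interval = N'.interval := Bool.eq_iff_iff.2 (hS.interval.trans hS'.interval.symm)
  have e2 : N.ringBar = N'.ringBar :=
    funext fun i => Bool.eq_iff_iff.2 ((hS.ring i).trans (hS'.ring i).symm)
  have e3 : N.gyrSub = N'.gyrSub := funext fun i => (hS.gyration i).unique hk (hS'.gyration i)
  have e4 : N.starBar = N'.starBar :=
    funext fun i => Bool.eq_iff_iff.2 ((hS.star i).trans (hS'.star i).symm)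
  have e5 : N.mirrorMark = N'.mirrorMark :=
    funext fun i => funext fun j => (hS.mirror i j).unique hk (hS'.mirror i j)
  have e6 : N.digitSub = N'.digitSub :=
    funext fun i => funext fun j => (hS.corner i j).unique hk (hS'.corner i j)
  have e7 : N.crossBar = N'.crossBar :=
    funext fun i => Bool.eq_iff_iff.2 ((hS.cross i).trans (hS'.cross i).symm)
  have e8 : N.ringSub = N'.ringSub ∧ N.starSub = N'.starSub ∧ N.crossSub = N'.crossSub := by
    by_cases hc : IsInterval G
    · refine ⟨funext fun i => ?_, funext fun i => ?_, funext fun i => ?_⟩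
      · obtain ⟨e, he, h, -⟩ := (hI hc).ring i
        obtain ⟨e', he', h', -⟩ := (hI' hc).ring i
        rw [he, he', half_unique hk h h']
      · obtain ⟨e, he, h⟩ := (hI hc).star i
        obtain ⟨e', he', h'⟩ := (hI' hc).star i
        rw [he, he', half_unique hk h h']
      · obtain ⟨e, he, h⟩ := (hI hc).cross i
        obtain ⟨e', he', h'⟩ := (hI' hc).cross i
        rw [he, he', half_unique hk h h']
    · have c := hC hc
      have c' := hC' hc
      refine ⟨funext fun i => ?_, funext fun i => ?_, funext fun i => ?_⟩
      · cases hi : N.ringBar i with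
        | false => rw [c.ring_none i hi, c'.ring_none i (e2 ▸ hi)]
        | true =>
          obtain ⟨e, he, h⟩ := c.ring_some i hi
          obtain ⟨e', he', h'⟩ := c'.ring_some i (e2 ▸ hi)
          rw [he, he', h.unique hk e2 h']
      · by_cases hi : AllMinus G s i
        · obtain ⟨e, he, h⟩ := c.star_some i hi
          obtain ⟨e', he', h'⟩ := c'.star_some i hi
          rw [he, he', h.unique hk hc e6 h']
        · rw [c.star_none i hi, c'.star_none i hi]
      · by_cases hi : N.crossBar i = true ∨ ¬ Rigid G s
        · rw [c.cross_none i hi, c'.cross_none i (e7 ▸ hi)]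
        · simp only [not_or, not_not, Bool.not_eq_true] at hi
          obtain ⟨e, he, h⟩ := c.cross_some i hi.1 hi.2
          obtain ⟨e', he', h'⟩ := c'.cross_some i (e7 ▸ hi.1) hi.2
          rw [he, he', h.unique hk e7 h']
  cases N
  cases N'
  simp only at e1 e2 e3 e4 e5 e6 e7 e8
  obtain ⟨e8, e9, e10⟩ := e8
  subst_vars
  rfl

end

section

/-! ### Existence of the name -/

variable {σ : OrbifoldSymbol} {G : Subgroup FibIsom} {k : ℝ} {s : Gen σ → (Plane ≃ᵢ Plane)}

theorem exists_half {t A : ℝ} {m : ℤ} (h : 2 * t = A + m) :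
    ∃ (e : Fin 2) (n : ℤ), t = (A + (e : ℕ)) / 2 + n := by
  -- `e` is the parity of `m`, and `n` takes up the rest.
  refine ⟨⟨(m % 2).toNat, by omega⟩, m / 2, ?_⟩
  have h1 : (((m % 2).toNat : ℕ) : ℤ) = m % 2 := Int.toNat_of_nonneg (by omega)
  have h2 : (((m % 2).toNat : ℕ) : ℝ) = m - 2 * ((m / 2 : ℤ) : ℝ) := by
    have : (((m % 2).toNat : ℕ) : ℤ) = m - 2 * (m / 2) := by omega
    exact_mod_cast this
  simp only [h2]
  linarith

theorem exists_plus_mul (hk : IsFiberLength G k) {h : Plane ≃ᵢ Plane} (hp : IsPlus G h) :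
    ∃ c, (h, plus (k * c)) ∈ G := by
  obtain ⟨c, hc⟩ := hp
  exact ⟨c / k, by rwa [mul_div_cancel₀ _ hk.1.1.ne']⟩

theorem exists_minus_mul (hk : IsFiberLength G k) {h : Plane ≃ᵢ Plane} (hh : h ∈ horizontal G)
    (hp : ¬ IsPlus G h) : ∃ c, (h, minus (k * c)) ∈ G := by
  obtain ⟨c, hc⟩ := (isPlus_or_exists_minus hh).resolve_left hp
  exact ⟨c / k, by rwa [mul_div_cancel₀ _ hk.1.1.ne']⟩

theorem IsFiberLength.one_plus_mem_iff' (hk : IsFiberLength G k) {c : ℝ} :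
    ((1, plus (k * c)) : FibIsom) ∈ G ↔ ∃ n : ℤ, c = n := by
  rw [hk.one_plus_mem_iff]
  simp only [mul_right_inj' hk.1.1.ne']

/-- `h ^ n = 1` forces `n c` to be an integer `m`, so modulo `1` the constant `c` is `a / n`, with
`a` the residue of `m` modulo `n`. -/
theorem exists_digitRule (hk : IsFiberLength G k) {n : ℕ} (hn : 0 < n) {h : Plane ≃ᵢ Plane}
    (h1 : h ^ n = 1) : ∃ o, DigitRule G k n h o := by
  by_cases hp : IsPlus G h
  · obtain ⟨c, hc⟩ := exists_plus_mul hk hp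
    have := G.pow_mem hc n
    rw [Prod.pow_mk, h1, plus_pow, mul_left_comm, hk.one_plus_mem_iff'] at this
    obtain ⟨m, hm⟩ := this
    have hn' : (0 : ℤ) < n := by exact_mod_cast hn
    have hn0 : (n : ℝ) ≠ 0 := by exact_mod_cast hn.ne'
    have e1 : (((m % n).toNat : ℕ) : ℤ) = m % n := Int.toNat_of_nonneg (Int.emod_nonneg _ hn'.ne')
    refine ⟨some (m % n).toNat, ?_, (hk.plus_mem_iff' hc).2 ⟨-(m / n), ?_⟩⟩
    · have := Int.emod_lt_of_pos m hn'
      omega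
    · have e2 : (((m % n).toNat : ℕ) : ℤ) = m - n * (m / n) := by
        rw [e1, Int.emod_def]
      have e3 : (((m % n).toNat : ℕ) : ℝ) = m - n * ((m / n : ℤ) : ℝ) := by exact_mod_cast e2
      rw [e3, ← hm]
      push_cast
      field_simp
      ring
  · exact ⟨none, hp⟩

theorem exists_mirrorRule (hk : IsFiberLength G k) {h : Plane ≃ᵢ Plane} (h1 : h ^ 2 = 1) :
    ∃ o, MirrorRule G k h o := by
  obtain ⟨o, ho⟩ := exists_digitRule hk (two_pos) h1
  match o, ho with
  | none, ho => exact ⟨.blank, ho⟩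
  | some 0, ho => exact ⟨.dot, by simpa [DigitRule, MirrorRule] using ho.2⟩
  | some 1, ho => exact ⟨.colon, by simpa [DigitRule, MirrorRule] using ho.2⟩
  | some (a + 2), ho => exact absurd ho.1 (by omega)

/-- Conjugating `(1, d-)` by an element with vertical part `c+` gives `(1, (d + 2c)-)`, so `2c` is a
multiple of the fiber length. -/
theorem exists_half_of_isInterval (hk : IsFiberLength G k) (hc : IsInterval G)
    {h : Plane ≃ᵢ Plane} {c : ℝ} (hh : (h, plus (k * c)) ∈ G) :
    ∃ (e : Fin 2) (n : ℤ), c = (e : ℕ) / 2 + n := by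
  obtain ⟨d, hd⟩ := hc
  have h1 := G.mul_mem (G.mul_mem hh hd) (G.inv_mem hh)
  rw [Prod.inv_mk, Prod.mk_mul_mk, Prod.mk_mul_mk, mul_one, mul_inv_cancel, plus_inv,
    plus_mul_minus, minus_mul_plus] at h1
  obtain ⟨m, hm⟩ := (hk.minus_mem_iff hd).1 h1
  have : 2 * c = 0 + m := mul_left_cancel₀ hk.1.1.ne' (by linarith)
  obtain ⟨e, n, h⟩ := exists_half this
  exact ⟨e, n, by rw [h, zero_add]⟩

theorem exists_coupled_half (hk : IsFiberLength G k) (hc : IsInterval G) {h : Plane ≃ᵢ Plane}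
    (hh : h ∈ horizontal G) : ∃ e : Fin 2, (h, plus (k * ((e : ℕ) / 2))) ∈ G := by
  obtain ⟨c, hc'⟩ := exists_plus_mul hk (isPlus_of_isInterval hc hh)
  obtain ⟨e, n, he⟩ := exists_half_of_isInterval hk hc hc'
  exact ⟨e, (hk.plus_mem_iff' hc').2 ⟨-n, by rw [he]; push_cast; ring⟩⟩

theorem exists_fract (t : ℝ) : ∃ (κ : ℝ) (m : ℤ), 0 ≤ κ ∧ κ < 1 ∧ t = κ + m :=
  ⟨Int.fract t, ⌊t⌋, Int.fract_nonneg t, Int.fract_lt_one t, (Int.fract_add_floor t).symm⟩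

theorem sum_castSucc_sub_succ {n : ℕ} (f : Fin (n + 1) → ℝ) :
    ∑ j : Fin n, (f j.castSucc - f j.succ) = f 0 - f (Fin.last n) := by
  have h1 := Fin.sum_univ_castSucc f
  have h2 := Fin.sum_univ_succ f
  rw [Finset.sum_sub_distrib]
  linarith

/-- The corner constants telescope: modulo `1`, the first mirror constant minus the last is `Σ`. The
relation `λ⁻¹ P λ = S` makes this difference `2l` when `λ ↦ l+`, and `2(p - l)` when `λ ↦ l-`.
Halving leaves the choice of `e`. -/
theorem exists_starEquation (hk : IsFiberLength G k) (hs : ∀ x, s x ∈ horizontal G)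
    (hrel : Relations s) {N : Name σ} (i : Fin σ.kaleidoscopes.length)
    (hN : ∀ j, DigitRule G k (σ.digit i j) (s (.P i j.castSucc) * s (.P i j.succ)) (N.digitSub i j))
    (hm : AllMinus G s i) : ∃ e, StarEquation G s k N i e := by
  choose p hp using fun j => exists_minus_mul hk (hs (.P i j)) (hm j)
  have hd : ∀ j : Fin (σ.len i), ∃ n : ℤ, p j.castSucc - p j.succ =
      (((N.digitSub i j).getD 0 : ℕ) : ℝ) / (σ.digit i j : ℝ) + n := fun j => by
    have h1 := G.mul_mem (hp j.castSucc) (hp j.succ)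
    rw [Prod.mk_mul_mk, minus_mul_minus, ← mul_sub] at h1
    have h2 := hN j
    cases ho : N.digitSub i j with
    | none => rw [ho] at h2; exact absurd ⟨_, h1⟩ h2
    | some a => rw [ho] at h2; exact (hk.plus_mem_iff' h2.2).1 h1
  obtain ⟨n, hn⟩ := exists_sum_eq_add_int hd
  rw [sum_castSucc_sub_succ] at hn
  change p 0 - p (Fin.last _) = N.digitSum i + n at hn
  by_cases hl : IsPlus G (s (.lam i))
  · obtain ⟨l, hl⟩ := exists_plus_mul hk hl
    have h1 := G.mul_mem (G.mul_mem (G.inv_mem hl) (hp 0)) hl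
    rw [Prod.inv_mk, Prod.mk_mul_mk, Prod.mk_mul_mk, hrel.around, plus_inv, plus_mul_minus,
      minus_mul_plus, ← mul_neg, ← mul_add, ← mul_sub] at h1
    obtain ⟨m, hm⟩ := (hk.minus_mem_iff' h1).1 (hp (Fin.last _))
    obtain ⟨e, q, he⟩ := exists_half (t := l) (A := N.digitSum i) (m := n + m)
      (by push_cast; linarith)
    exact ⟨e, Or.inl ((hk.plus_mem_iff' hl).2 ⟨-q, by rw [he]; push_cast; ring⟩)⟩
  · obtain ⟨l, hl⟩ := exists_minus_mul hk (hs (.lam i)) hl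
    have h1 := G.mul_mem (G.mul_mem (G.inv_mem hl) (hp 0)) hl
    rw [Prod.inv_mk, Prod.mk_mul_mk, Prod.mk_mul_mk, hrel.around, minus_inv, minus_mul_minus,
      plus_mul_minus, ← mul_sub, ← mul_add] at h1
    obtain ⟨m, hm⟩ := (hk.minus_mem_iff' h1).1 (hp (Fin.last _))
    obtain ⟨e, q, he⟩ := exists_half (t := p 0 - l) (A := N.digitSum i) (m := n + m)
      (by push_cast; linarith)
    exact ⟨e, Or.inr ⟨p 0, l + q, hp 0, (hk.minus_mem_iff' hl).2 ⟨q, rfl⟩, by linarith⟩⟩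

/-- Coupling of a product of generators computed from couplings of the generators. -/
theorem ringProd_coupled {v : Gen σ → ℝ ≃ᵢ ℝ} (hX : ∀ i, (s (.X i), v (.X i)) ∈ G)
    (hY : ∀ i, (s (.Y i), v (.Y i)) ∈ G) : (ringProd s, ringProd v) ∈ G := by
  have h := ringProd_mem (s := fun x => (s x, v x)) hX hY
  have e1 := map_ringProd (MonoidHom.fst (Plane ≃ᵢ Plane) (ℝ ≃ᵢ ℝ)) (fun g => (s g, v g))
  have e2 := map_ringProd (MonoidHom.snd (Plane ≃ᵢ Plane) (ℝ ≃ᵢ ℝ)) (fun g => (s g, v g))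
  rw [Prod.ext (x := ringProd fun g => (s g, v g)) (y := (ringProd s, ringProd v)) e1 e2] at h
  exact h

theorem crossProd_coupled {v : Gen σ → ℝ ≃ᵢ ℝ} (hZ : ∀ i, (s (.Z i), v (.Z i)) ∈ G) :
    (crossProd s, crossProd v) ∈ G := by
  have h := crossProd_mem (s := fun x => (s x, v x)) hZ
  have e1 := map_crossProd (MonoidHom.fst (Plane ≃ᵢ Plane) (ℝ ≃ᵢ ℝ)) (fun g => (s g, v g))
  have e2 := map_crossProd (MonoidHom.snd (Plane ≃ᵢ Plane) (ℝ ≃ᵢ ℝ)) (fun g => (s g, v g))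
  rw [Prod.ext (x := crossProd fun g => (s g, v g)) (y := (crossProd s, crossProd v)) e1 e2] at h
  exact h

/-- The commutator of `x-` and `y-` is `2(x - y)+`, while translations commute. The global relation
therefore makes twice the sum congruent to `-κ` modulo `1`. -/
theorem exists_ringEquation (hk : IsFiberLength G k) (hs : ∀ x, s x ∈ horizontal G)
    (hrel : Relations s) {N : Name σ} (hN : ∀ i, N.ringBar i = true ↔ ¬ IsPlus G (s (.X i)))
    (hsame : ∀ i, IsPlus G (s (.X i)) ↔ IsPlus G (s (.Y i))) {i₀ : Fin σ.rings}
    (hi₀ : N.ringBar i₀ = true) : ∃ e, RingEquation G s k N e := by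
  have hv : ∀ i, ∃ (v w : ℝ ≃ᵢ ℝ) (x y : ℝ), (s (.X i), v) ∈ G ∧ (s (.Y i), w) ∈ G ∧
      (N.ringBar i = true → v = minus (k * x) ∧ w = minus (k * y)) ∧
      v⁻¹ * w⁻¹ * v * w = plus (k * (2 * (if N.ringBar i = true then x - y else 0))) := fun i => by
    by_cases hi : N.ringBar i = true
    · obtain ⟨x, hx⟩ := exists_minus_mul hk (hs (.X i)) ((hN i).1 hi)
      obtain ⟨y, hy⟩ := exists_minus_mul hk (hs (.Y i)) fun h => (hN i).1 hi ((hsame i).2 h)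
      refine ⟨_, _, x, y, hx, hy, fun _ => ⟨rfl, rfl⟩, ?_⟩
      rw [if_pos hi, minus_inv, minus_inv, minus_mul_minus, plus_mul_minus, minus_mul_minus]
      congr 1; ring
    · have hp : IsPlus G (s (.X i)) := by
        by_contra h
        exact hi ((hN i).2 h)
      obtain ⟨x, hx⟩ := exists_plus_mul hk hp
      obtain ⟨y, hy⟩ := exists_plus_mul hk ((hsame i).1 hp)
      refine ⟨_, _, x, y, hx, hy, fun h => absurd h hi, ?_⟩
      rw [if_neg hi, plus_inv, plus_inv, plus_mul_plus, plus_mul_plus, plus_mul_plus]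
      congr 1; ring
  choose v w x y hX hY hb hc using hv
  obtain ⟨κ, m, h0, h1, hκ⟩ :=
    exists_fract (-(2 * ∑ i, if N.ringBar i = true then x i - y i else 0))
  have hR := ringProd_coupled (s := s) (G := G) (v := fun
    | .X i => v i
    | .Y i => w i
    | _ => 1) hX hY
  have e : ringProd (fun
    | .X i => v i
    | .Y i => w i
    | _ => 1 : Gen σ → ℝ ≃ᵢ ℝ) =
      plus (k * (2 * ∑ i, if N.ringBar i = true then x i - y i else 0)) := by
    simp only [ringProd, hc]
    rw [prod_ofFn_plus, ← Finset.mul_sum, ← Finset.mul_sum]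
  rw [e] at hR
  have hR' := G.inv_mem hR
  have e1 : (ringProd s)⁻¹ = gyrProd s * lamProd s * crossProd s :=
    inv_eq_of_mul_eq_one_right (by rw [← hrel.global]; group)
  rw [Prod.inv_mk, e1, plus_inv, ← mul_neg] at hR'
  obtain ⟨e, q, he⟩ := exists_half (t := ∑ i, if N.ringBar i = true then x i - y i else 0)
    (A := -κ) (m := -m) (by push_cast; linarith)
  -- Halving gives the equation only modulo `1`; the integer `q` is removed by changing `x` on the
  -- single ring `i₀`.
  refine ⟨e, κ, fun i => x i - if i = i₀ then (q : ℝ) else 0, y, h0, h1,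
    (hk.plus_mem_iff' hR').2 ⟨-m, by rw [hκ]; push_cast; ring⟩, fun i hi => ⟨?_, ?_⟩, ?_⟩
  · have := hX i
    rw [(hb i hi).1] at this
    refine (hk.minus_mem_iff' this).2 ?_
    by_cases h : i = i₀
    · exact ⟨-q, by simp only [h, if_true]; push_cast; ring⟩
    · exact ⟨0, by simp [h]⟩
  · have := hY i
    rwa [(hb i hi).2] at this
  · have : ∀ i, (if N.ringBar i = true then x i - (if i = i₀ then (q : ℝ) else 0) - y i else 0) =
        (if N.ringBar i = true then x i - y i else 0) - if i = i₀ then (q : ℝ) else 0 := fun i => by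
      by_cases h : i = i₀
      · subst h; simp only [hi₀, if_true]; ring
      · simp [h]
    simp only [this]
    rw [Finset.sum_sub_distrib, Finset.sum_ite_eq' Finset.univ i₀, if_pos (Finset.mem_univ _), he]
    ring

/-- `Z ^ 2` is coupled with `2z+` when `Z ↦ z+`, and with the identity when `Z` is minus-coupled, so
the global relation gives twice the sum as `-κ` modulo `1`. -/
theorem exists_crossEquation (hk : IsFiberLength G k) (hs : ∀ x, s x ∈ horizontal G)
    (hrel : Relations s) {N : Name σ} (hN : ∀ i, N.crossBar i = true ↔ ¬ IsPlus G (s (.Z i)))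
    {i₀ : Fin σ.crosses} (hi₀ : N.crossBar i₀ = false) : ∃ e, CrossEquation G s k N e := by
  have hv : ∀ i, ∃ (v : ℝ ≃ᵢ ℝ) (z : ℝ), (s (.Z i), v) ∈ G ∧
      (N.crossBar i = false → v = plus (k * z)) ∧
      v ^ 2 = plus (k * (2 * (if N.crossBar i = false then z else 0))) := fun i => by
    by_cases hi : N.crossBar i = false
    · have hp : IsPlus G (s (.Z i)) := by
        by_contra h
        rw [(hN i).2 h] at hi
        exact absurd hi (by simp)
      obtain ⟨z, hz⟩ := exists_plus_mul hk hp
      refine ⟨_, z, hz, fun _ => rfl, ?_⟩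
      rw [if_pos hi, plus_pow]
      congr 1; push_cast; ring
    · obtain ⟨z, hz⟩ := exists_minus_mul hk (hs (.Z i)) ((hN i).1 (by simpa using hi))
      refine ⟨_, z, hz, fun h => absurd h hi, ?_⟩
      rw [if_neg hi, minus_sq, mul_zero, mul_zero, plus_zero]
  choose v z hZ hb hc using hv
  obtain ⟨κ, m, h0, h1, hκ⟩ :=
    exists_fract (-(2 * ∑ i, if N.crossBar i = false then z i else 0))
  have hR := crossProd_coupled (s := s) (G := G) (v := fun
    | .Z i => v i
    | _ => 1) hZ
  have e : crossProd (fun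
    | .Z i => v i
    | _ => 1 : Gen σ → ℝ ≃ᵢ ℝ) =
      plus (k * (2 * ∑ i, if N.crossBar i = false then z i else 0)) := by
    simp only [crossProd, hc]
    rw [prod_ofFn_plus, ← Finset.mul_sum, ← Finset.mul_sum]
  rw [e] at hR
  have hR' := G.inv_mem hR
  have e1 : (crossProd s)⁻¹ = ringProd s * gyrProd s * lamProd s :=
    inv_eq_of_mul_eq_one_left hrel.global
  rw [Prod.inv_mk, e1, plus_inv, ← mul_neg] at hR'
  obtain ⟨e, q, he⟩ := exists_half (t := ∑ i, if N.crossBar i = false then z i else 0)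
    (A := -κ) (m := -m) (by push_cast; linarith)
  refine ⟨e, κ, fun i => z i - if i = i₀ then (q : ℝ) else 0, h0, h1,
    (hk.plus_mem_iff' hR').2 ⟨-m, by rw [hκ]; push_cast; ring⟩, fun i hi => ?_, ?_⟩
  · have := hZ i
    rw [hb i hi] at this
    refine (hk.plus_mem_iff' this).2 ?_
    by_cases h : i = i₀
    · exact ⟨-q, by simp only [h, if_true]; push_cast; ring⟩
    · exact ⟨0, by simp [h]⟩
  · have : ∀ i, (if N.crossBar i = false then z i - (if i = i₀ then (q : ℝ) else 0) else 0) =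
        (if N.crossBar i = false then z i else 0) - if i = i₀ then (q : ℝ) else 0 := fun i => by
      by_cases h : i = i₀
      · subst h; simp only [hi₀, if_true]
      · simp [h]
    simp only [this]
    rw [Finset.sum_sub_distrib, Finset.sum_ite_eq' Finset.univ i₀, if_pos (Finset.mem_univ _), he]
    ring

/-- All digits of the symbol are positive. -/
def OrbifoldSymbol.PosDigits (σ : OrbifoldSymbol) : Prop :=
  (∀ i, 0 < σ.gyrations.get i) ∧ ∀ i j, 0 < σ.digit i j

open Classical in
theorem exists_hasName (hσ : σ.PosDigits) (hG : IsFiberedSpaceGroup G)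
    (hst : IsStandard (horizontal G) s) (ha : IsAdmissible G s) : ∃ N, HasName G s N := by
  obtain ⟨k, hk⟩ := hG.exists_isFiberLength
  have hs := hst.mem
  have hrel := hst.relations
  choose g hg using fun i => exists_digitRule hk (hσ.1 i) (hrel.gyration i)
  choose d hd using fun i j => exists_digitRule hk (hσ.2 i j) (hrel.corner i j)
  choose m hm using fun i j => exists_mirrorRule hk (hrel.mirror i j)
  let M (r : Fin σ.rings → Option (Fin 2)) (t : Fin σ.kaleidoscopes.length → Option (Fin 2))
      (c : Fin σ.crosses → Option (Fin 2)) : Name σ :=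
    { interval := decide (IsInterval G)
      ringBar := fun i => decide (¬ IsPlus G (s (.X i)))
      ringSub := r
      gyrSub := g
      starBar := fun i => decide (¬ IsPlus G (s (.lam i)))
      starSub := t
      mirrorMark := m
      digitSub := d
      crossBar := fun i => decide (¬ IsPlus G (s (.Z i)))
      crossSub := c }
  have hM : ∀ r t c, SimpleRule G s k (M r t c) := fun r t c =>
    ⟨decide_eq_true_iff, fun _ => decide_eq_true_iff, hg, fun _ => decide_eq_true_iff, hm, hd,
      fun _ => decide_eq_true_iff⟩
  by_cases hc : IsInterval G
  · have hr : ∀ i, ∃ e : Fin 2, (s (.X i), plus (k * ((e : ℕ) / 2))) ∈ G ∧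
        (s (.Y i), plus (k * ((e : ℕ) / 2))) ∈ G := fun i => by
      obtain ⟨c, hX, hY⟩ := (ha i).2 hc
      obtain ⟨c, rfl⟩ : ∃ c', c = k * c' := ⟨c / k, by rw [mul_div_cancel₀ _ hk.1.1.ne']⟩
      obtain ⟨e, n, he⟩ := exists_half_of_isInterval hk hc hX
      exact ⟨e, (hk.plus_mem_iff' hX).2 ⟨-n, by rw [he]; push_cast; ring⟩,
        (hk.plus_mem_iff' hY).2 ⟨-n, by rw [he]; push_cast; ring⟩⟩
    choose r hr using hr
    choose t ht using fun i => exists_coupled_half hk hc (hs (.lam i))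
    choose c hcr using fun i => exists_coupled_half hk hc (hs (.Z i))
    exact ⟨M (fun i => some (r i)) (fun i => some (t i)) (fun i => some (c i)), k, hk, hM _ _ _,
      fun _ => ⟨fun i => ⟨_, rfl, hr i⟩, fun i => ⟨_, rfl, ht i⟩, fun i => ⟨_, rfl, hcr i⟩⟩,
      fun h => absurd hc h⟩
  -- The three equations read only the bars and the digit subscripts of a name, so they can be
  -- solved before the subscripts on rings, stars and crosses are filled in. One `e₁` serves all
  -- barred rings, and one `e₂` all unbarred crosses.
  · let M₀ := M (fun _ => none) (fun _ => none) (fun _ => none)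
    have hM₀ := hM (fun _ => none) (fun _ => none) (fun _ => none)
    have hsame := fun i => (ha i).1
    obtain ⟨e₁, he₁⟩ : ∃ e, ∀ i, M₀.ringBar i = true → RingEquation G s k M₀ e := by
      by_cases h : ∃ i, M₀.ringBar i = true
      · obtain ⟨i, hi⟩ := h
        obtain ⟨e, he⟩ := exists_ringEquation hk hs hrel hM₀.ring hsame hi
        exact ⟨e, fun _ _ => he⟩
      · exact ⟨0, fun i hi => absurd ⟨i, hi⟩ h⟩
    obtain ⟨e₂, he₂⟩ : ∃ e, ∀ i, M₀.crossBar i = false → CrossEquation G s k M₀ e := by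
      by_cases h : ∃ i, M₀.crossBar i = false
      · obtain ⟨i, hi⟩ := h
        obtain ⟨e, he⟩ := exists_crossEquation hk hs hrel hM₀.cross hi
        exact ⟨e, fun _ _ => he⟩
      · exact ⟨0, fun i hi => absurd ⟨i, hi⟩ h⟩
    have hstar : ∀ i, ∃ e, AllMinus G s i → StarEquation G s k M₀ i e := fun i => by
      by_cases h : AllMinus G s i
      · obtain ⟨e, he⟩ := exists_starEquation hk hs hrel i (hM₀.corner i) h
        exact ⟨e, fun _ => he⟩
      · exact ⟨0, fun h' => absurd h' h⟩
    choose e₃ he₃ using hstar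
    refine ⟨M (fun i => if M₀.ringBar i = true then some e₁ else none)
      (fun i => if AllMinus G s i then some (e₃ i) else none)
      (fun i => if M₀.crossBar i = true ∨ ¬ Rigid G s then none else some e₂), k, hk, hM _ _ _,
      fun h => absurd h hc, fun _ => ⟨hsame, fun i hi => ?_, fun i hi => ⟨e₁, ?_, he₁ i hi⟩,
      fun i hi => if_neg hi, fun i hi => ⟨e₃ i, if_pos hi, he₃ i hi⟩, fun i hi => if_pos hi,
      fun i hi hr => ⟨e₂, ?_, he₂ i hi⟩⟩⟩
    · exact if_neg (by rw [show M₀.ringBar i = false from hi]; simp)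
    · exact if_pos hi
    · refine if_neg ?_
      rw [show M₀.crossBar i = false from hi]
      simpa using hr

end

section

/-! ### Existence of admissible generators -/

/-- A change of generators that is natural in the group and preserves the relations, with an inverse
of the same kind, can be applied to the universal generators. There it defines an automorphism of
the presented group. -/
theorem IsStandard.of_move {σ : OrbifoldSymbol} {H : Subgroup (Plane ≃ᵢ Plane)}
    {s : Gen σ → (Plane ≃ᵢ Plane)} (hs : IsStandard H s)
    (T T' : ∀ (Δ : Type) [Group Δ], (Gen σ → Δ) → Gen σ → Δ)
    (hT : ∀ (Δ Δ' : Type) [Group Δ] [Group Δ'] (f : Δ →* Δ') (V : Gen σ → Δ) (x : Gen σ),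
      f (T Δ V x) = T Δ' (fun y => f (V y)) x)
    (hT' : ∀ (Δ Δ' : Type) [Group Δ] [Group Δ'] (f : Δ →* Δ') (V : Gen σ → Δ) (x : Gen σ),
      f (T' Δ V x) = T' Δ' (fun y => f (V y)) x)
    (rT : ∀ (Δ : Type) [Group Δ] (V : Gen σ → Δ), Relations V → Relations (T Δ V))
    (rT' : ∀ (Δ : Type) [Group Δ] (V : Gen σ → Δ), Relations V → Relations (T' Δ V))
    (h1 : ∀ (Δ : Type) [Group Δ] (V : Gen σ → Δ), T Δ (T' Δ V) = V)
    (h2 : ∀ (Δ : Type) [Group Δ] (V : Gen σ → Δ), T' Δ (T Δ V) = V) :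
    IsStandard H (T _ s) := by
  obtain ⟨e, he⟩ := hs
  let Γ := PresentedGroup {w : FreeGroup (Gen σ) | Relator σ w}
  have hu : Relations (PresentedGroup.of : Gen σ → Γ) := by
    rw [relations_iff]
    intro w hw
    have : FreeGroup.lift (PresentedGroup.of : Gen σ → Γ) = PresentedGroup.mk _ := by
      ext x : 1
      rw [FreeGroup.lift_apply_of]
      rfl
    rw [this]
    exact PresentedGroup.one_of_mem hw
  let a : Γ →* Γ := PresentedGroup.toGroup (rels := {w | Relator σ w})
    ((relations_iff _).1 (rT Γ _ hu))
  let b : Γ →* Γ := PresentedGroup.toGroup (rels := {w | Relator σ w})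
    ((relations_iff _).1 (rT' Γ _ hu))
  have ha : ∀ x, a (PresentedGroup.of x) = T Γ PresentedGroup.of x := fun x =>
    PresentedGroup.toGroup.of _
  have hb : ∀ x, b (PresentedGroup.of x) = T' Γ PresentedGroup.of x := fun x =>
    PresentedGroup.toGroup.of _
  have hab : a.comp b = MonoidHom.id Γ := PresentedGroup.ext fun x => by
    rw [MonoidHom.comp_apply, hb, hT', funext ha, h2]; rfl
  have hba : b.comp a = MonoidHom.id Γ := PresentedGroup.ext fun x => by
    rw [MonoidHom.comp_apply, ha, hT, funext hb, h1]; rfl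
  refine ⟨(MonoidHom.toMulEquiv a b hba hab).trans e, fun x => ?_⟩
  have h3 := hT _ _ (H.subtype.comp e.toMonoidHom) PresentedGroup.of x
  have h4 : (fun y => (H.subtype.comp e.toMonoidHom) (PresentedGroup.of y)) = s :=
    funext he
  rw [h4] at h3
  rw [← h3, ← ha]
  rfl

/-! ### Moves on the generators of the torus group -/

/-- The symbol of the torus. -/
def torusSymbol : OrbifoldSymbol := ⟨1, [], [], 0⟩

theorem relations_torus_iff {Γ : Type} [Group Γ] (s : Gen torusSymbol → Γ) :
    Relations s ↔ Commute (s (.X (0 : Fin 1))) (s (.Y (0 : Fin 1))) := by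
  have key : (ringProd s * gyrProd s * lamProd s * crossProd s = 1) ↔
      Commute (s (.X (0 : Fin 1))) (s (.Y (0 : Fin 1))) := by
    simp only [ringProd, gyrProd, lamProd, crossProd]
    have e0 : (List.ofFn fun i : Fin torusSymbol.rings =>
      (s (.X i))⁻¹ * (s (.Y i))⁻¹ * s (.X i) * s (.Y i)) =
        [(s (.X (0 : Fin 1)))⁻¹ * (s (.Y (0 : Fin 1)))⁻¹ * s (.X (0 : Fin 1)) *
          s (.Y (0 : Fin 1))] := rfl
    have e1 : (List.ofFn fun i : Fin torusSymbol.gyrations.length => s (.γ i)) = [] := rfl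
    have e2 : (List.ofFn fun i : Fin torusSymbol.kaleidoscopes.length => s (.lam i)) = [] := rfl
    have e3 : (List.ofFn fun i : Fin torusSymbol.crosses => s (.Z i) ^ 2) = [] := rfl
    rw [e0, e1, e2, e3]
    simp only [List.prod_cons, List.prod_nil, mul_one]
    rw [Commute, SemiconjBy, mul_assoc, ← mul_inv_rev, inv_mul_eq_one, eq_comm]
  rw [← key]
  exact ⟨fun h => h.global, fun h => ⟨fun i => i.elim0, fun i => i.elim0, fun i => i.elim0,
    fun i => i.elim0, h⟩⟩

/-- The move `X ↦ X Y`. -/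
def moveX (Δ : Type) [Group Δ] (V : Gen torusSymbol → Δ) : Gen torusSymbol → Δ
  | .X i => V (.X i) * V (.Y i)
  | x => V x

/-- The move `X ↦ X Y⁻¹`. -/
def moveX' (Δ : Type) [Group Δ] (V : Gen torusSymbol → Δ) : Gen torusSymbol → Δ
  | .X i => V (.X i) * (V (.Y i))⁻¹
  | x => V x

/-- The move `Y ↦ Y X`. -/
def moveY (Δ : Type) [Group Δ] (V : Gen torusSymbol → Δ) : Gen torusSymbol → Δ
  | .Y i => V (.Y i) * V (.X i)
  | x => V x

/-- The move `Y ↦ Y X⁻¹`. -/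
def moveY' (Δ : Type) [Group Δ] (V : Gen torusSymbol → Δ) : Gen torusSymbol → Δ
  | .Y i => V (.Y i) * (V (.X i))⁻¹
  | x => V x

variable {H : Subgroup (Plane ≃ᵢ Plane)} {s : Gen torusSymbol → (Plane ≃ᵢ Plane)}

theorem IsStandard.moveX (hs : IsStandard H s) : IsStandard H (moveX _ s) := by
  refine hs.of_move Fibrifold.moveX moveX' ?_ ?_ ?_ ?_ ?_ ?_
  · intro Δ Δ' _ _ f V x; cases x <;> simp [Fibrifold.moveX]
  · intro Δ Δ' _ _ f V x; cases x <;> simp [Fibrifold.moveX']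
  · intro Δ _ V h
    rw [relations_torus_iff] at h ⊢
    exact h.mul_left (Commute.refl _)
  · intro Δ _ V h
    rw [relations_torus_iff] at h ⊢
    exact h.mul_left (Commute.refl _).inv_left
  · intro Δ _ V; funext x; cases x <;> simp [Fibrifold.moveX, moveX']
  · intro Δ _ V; funext x; cases x <;> simp [Fibrifold.moveX, moveX']

theorem IsStandard.moveY (hs : IsStandard H s) : IsStandard H (moveY _ s) := by
  refine hs.of_move Fibrifold.moveY moveY' ?_ ?_ ?_ ?_ ?_ ?_
  · intro Δ Δ' _ _ f V x; cases x <;> simp [Fibrifold.moveY]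
  · intro Δ Δ' _ _ f V x; cases x <;> simp [Fibrifold.moveY']
  · intro Δ _ V h
    rw [relations_torus_iff] at h ⊢
    exact h.mul_right (Commute.refl _)
  · intro Δ _ V h
    rw [relations_torus_iff] at h ⊢
    exact h.mul_right (Commute.refl _).inv_right
  · intro Δ _ V; funext x; cases x <;> simp [Fibrifold.moveY, moveY']
  · intro Δ _ V; funext x; cases x <;> simp [Fibrifold.moveY, moveY']

/-- The sign, or for interval fibrations the translation in `{0, 1/2}`, takes values in a group of
order two. If `X` and `Y` disagree, one of them has the trivial value, and multiplying it by the
other makes them agree. -/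
theorem exists_isAdmissible_torus {G : Subgroup FibIsom} (hG : IsFiberedSpaceGroup G)
    (hs : IsStandard (horizontal G) s) :
    ∃ s' : Gen torusSymbol → (Plane ≃ᵢ Plane), IsStandard (horizontal G) s' ∧
      IsAdmissible G s' := by
  obtain ⟨k, hk⟩ := hG.exists_isFiberLength
  have hall : ∀ {p : Fin torusSymbol.rings → Prop}, p (0 : Fin 1) → ∀ i, p i := fun {p} h i => by
    have : i = (0 : Fin 1) := Subsingleton.elim (α := Fin 1) _ _
    rwa [this]
  have hmemX := hs.mem (.X (0 : Fin 1))
  have hmemY := hs.mem (.Y (0 : Fin 1))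
  by_cases hc : IsInterval G
  · have hp : ∀ {h}, h ∈ horizontal G → IsPlus G h := fun hh => isPlus_of_isInterval hc hh
    obtain ⟨e, he⟩ := exists_coupled_half hk hc hmemX
    obtain ⟨e', he'⟩ := exists_coupled_half hk hc hmemY
    have h1 := G.mul_mem he he'
    have h2 := G.mul_mem he' he
    rw [Prod.mk_mul_mk, plus_mul_plus] at h1 h2
    by_cases hee : e = e'
    · subst hee
      exact ⟨s, hs, hall ⟨iff_of_true (hp (hs.mem _)) (hp (hs.mem _)), fun _ => ⟨_, he, he'⟩⟩⟩
    · by_cases h0 : e = 0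
      · subst h0
        simp only [Fin.val_zero, Nat.cast_zero, zero_div, mul_zero, zero_add] at h1
        exact ⟨_, hs.moveX, hall ⟨iff_of_true (hp (hs.moveX.mem _)) (hp (hs.moveX.mem _)),
          fun _ => ⟨_, h1, he'⟩⟩⟩
      · have h0' : e' = 0 := by omega
        subst h0'
        simp only [Fin.val_zero, Nat.cast_zero, zero_div, mul_zero, zero_add] at h2
        exact ⟨_, hs.moveY, hall ⟨iff_of_true (hp (hs.moveY.mem _)) (hp (hs.moveY.mem _)),
          fun _ => ⟨_, he, h2⟩⟩⟩
  · by_cases hX : IsPlus G (s (.X (0 : Fin 1))) <;> by_cases hY : IsPlus G (s (.Y (0 : Fin 1)))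
    · exact ⟨s, hs, hall ⟨iff_of_true hX hY, fun h => absurd h hc⟩⟩
    · obtain ⟨a, ha⟩ := hX
      obtain ⟨b, hb⟩ := (isPlus_or_exists_minus hmemY).resolve_left hY
      have h1 := G.mul_mem ha hb
      rw [Prod.mk_mul_mk, plus_mul_minus] at h1
      exact ⟨_, hs.moveX, hall ⟨iff_of_false (not_isPlus_of_minus hc h1) hY,
        fun h => absurd h hc⟩⟩
    · obtain ⟨a, ha⟩ := (isPlus_or_exists_minus hmemX).resolve_left hX
      obtain ⟨b, hb⟩ := hY
      have h1 := G.mul_mem hb ha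
      rw [Prod.mk_mul_mk, plus_mul_minus] at h1
      exact ⟨_, hs.moveY, hall ⟨iff_of_false hX (not_isPlus_of_minus hc h1),
        fun h => absurd h hc⟩⟩
    · exact ⟨s, hs, hall ⟨iff_of_false hX hY, fun h => absurd h hc⟩⟩

theorem exists_isAdmissible {σ : OrbifoldSymbol} (hσ : σ.NoRingOrTorus) {G : Subgroup FibIsom}
    (hG : IsFiberedSpaceGroup G) {s : Gen σ → (Plane ≃ᵢ Plane)}
    (hs : IsStandard (horizontal G) s) :
    ∃ s' : Gen σ → (Plane ≃ᵢ Plane), IsStandard (horizontal G) s' ∧ IsAdmissible G s' := by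
  rcases hσ with h | ⟨h1, h2, h3, h4⟩
  · refine ⟨s, hs, fun i => ?_⟩
    have := i.2
    omega
  · obtain ⟨r, g, l, c⟩ := σ
    simp only at h1 h2 h3 h4
    subst h1 h2 h3 h4
    exact exists_isAdmissible_torus hG hs

theorem noRingOrTorus_of_mem {σ : OrbifoldSymbol} (h : σ ∈ euclideanSymbols) :
    σ.NoRingOrTorus := by
  simp only [euclideanSymbols, List.mem_cons, List.not_mem_nil, or_false] at h
  rcases h with rfl | rfl | rfl | rfl | rfl | rfl | rfl | rfl | rfl | rfl | rfl | rfl | rfl | rfl |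
    rfl | rfl | rfl <;> simp [OrbifoldSymbol.NoRingOrTorus]

theorem posDigits_of_mem {σ : OrbifoldSymbol} (h : σ ∈ euclideanSymbols) : σ.PosDigits := by
  have key : ∀ τ ∈ euclideanSymbols, (∀ n ∈ τ.gyrations, 0 < n) ∧
      ∀ l ∈ τ.kaleidoscopes, ∀ n ∈ l, 0 < n := by decide
  exact ⟨fun i => (key σ h).1 _ (List.get_mem _ _),
    fun i j => (key σ h).2 _ (List.get_mem _ i) _ (List.get_mem _ j)⟩

end

section

/-! ### The plane group of a fibered space group -/

/-- A plane crystallographic group. -/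
structure IsCrystallographic (H : Subgroup (Plane ≃ᵢ Plane)) : Prop where
  finite : ∀ B : Set Plane, IsCompact B → {h | h ∈ H ∧ ((h : Plane → Plane) '' B ∩ B).Nonempty}.Finite
  cocompact : ∃ B : Set Plane, IsCompact B ∧ ∀ p, ∃ h ∈ H, p ∈ (h : Plane → Plane) '' B

variable {G : Subgroup FibIsom} {k : ℝ}

theorem exists_int_mem_Icc (hk : 0 < k) (c : ℝ) : ∃ n : ℤ, c + k * n ∈ Set.Icc 0 k := by
  refine ⟨-⌊c / k⌋, ?_⟩
  have h1 := Int.floor_le (c / k)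
  have h2 := (Int.lt_floor_add_one (c / k)).le
  rw [le_div_iff₀ hk] at h1
  rw [div_le_iff₀ hk] at h2
  push_cast
  constructor <;> nlinarith

theorem IsFiberLength.exists_mem_Icc (hk : IsFiberLength G k) {h : Plane ≃ᵢ Plane}
    (hh : h ∈ horizontal G) : ∃ v, (h, v) ∈ G ∧ v 0 ∈ Set.Icc 0 k := by
  obtain ⟨v, hv⟩ := mem_horizontal.1 hh
  rcases exists_eq_plus_or_minus v with ⟨c, rfl⟩ | ⟨c, rfl⟩
  · obtain ⟨n, hn⟩ := exists_int_mem_Icc hk.1.1 c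
    exact ⟨plus (c + k * n), (hk.plus_mem_iff hv).2 ⟨n, rfl⟩, by simpa [plus_apply] using hn⟩
  · obtain ⟨n, hn⟩ := exists_int_mem_Icc hk.1.1 c
    exact ⟨minus (c + k * n), (hk.minus_mem_iff hv).2 ⟨n, rfl⟩, by simpa [minus_apply] using hn⟩

/-- Fiber translations bring the height of any lift of `h` into `[0, k]`, so discreteness over `B ×ˢ
Set.Icc 0 k` descends to the plane. -/
theorem IsFiberedSpaceGroup.isCrystallographic (hG : IsFiberedSpaceGroup G) :
    IsCrystallographic (horizontal G) := by
  obtain ⟨k, hk⟩ := hG.exists_isFiberLength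
  constructor
  · intro B hB
    refine ((hG.discrete (B ×ˢ Set.Icc 0 k) (hB.prod isCompact_Icc)).image Prod.fst).subset ?_
    rintro h ⟨hh, _, ⟨b, hb, rfl⟩, hb'⟩
    obtain ⟨v, hv, hv0⟩ := hk.exists_mem_Icc hh
    exact ⟨(h, v), ⟨hv, (h b, v 0), ⟨(b, 0), ⟨hb, le_rfl, hk.1.1.le⟩, rfl⟩, hb', hv0⟩, rfl⟩
  · obtain ⟨B, hB, h⟩ := hG.cocompact
    refine ⟨Prod.fst '' B, hB.image continuous_fst, fun p => ?_⟩
    obtain ⟨g, hg, b, hb, e⟩ := h (p, 0)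
    exact ⟨g.1, mem_horizontal.2 ⟨g.2, hg⟩, b.1, ⟨b, hb, rfl⟩, congrArg Prod.fst e⟩

theorem finite_setOf_add_mul_int (hk : 0 < k) (a R : ℝ) :
    {c : ℝ | (∃ n : ℤ, c = a + k * n) ∧ |c| ≤ R}.Finite := by
  refine ((Set.finite_Icc (⌊(-R - a) / k⌋) (⌈(R - a) / k⌉)).image
    (fun n : ℤ => a + k * n)).subset ?_
  rintro c ⟨⟨n, rfl⟩, hc⟩
  rw [abs_le] at hc
  refine ⟨n, ⟨?_, ?_⟩, rfl⟩
  · have : ((⌊(-R - a) / k⌋ : ℤ) : ℝ) ≤ n :=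
      (Int.floor_le _).trans ((div_le_iff₀ hk).2 (by linarith))
    exact_mod_cast this
  · have : (n : ℝ) ≤ ((⌈(R - a) / k⌉ : ℤ) : ℝ) :=
      ((le_div_iff₀ hk).2 (by linarith)).trans (Int.le_ceil _)
    exact_mod_cast this

theorem IsFiberLength.finite_coupled (hk : IsFiberLength G k) (h : Plane ≃ᵢ Plane) (R : ℝ) :
    {v : ℝ ≃ᵢ ℝ | (h, v) ∈ G ∧ |v 0| ≤ R}.Finite := by
  have h1 : {c : ℝ | (h, plus c) ∈ G ∧ |c| ≤ R}.Finite := by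
    by_cases hp : ∃ a, (h, plus a) ∈ G
    · obtain ⟨a, ha⟩ := hp
      refine (finite_setOf_add_mul_int hk.1.1 a R).subset ?_
      rintro c ⟨hc, hR⟩
      exact ⟨(hk.plus_mem_iff ha).1 hc, hR⟩
    · exact Set.Finite.subset Set.finite_empty fun c hc => hp ⟨c, hc.1⟩
  have h2 : {c : ℝ | (h, minus c) ∈ G ∧ |c| ≤ R}.Finite := by
    by_cases hp : ∃ a, (h, minus a) ∈ G
    · obtain ⟨a, ha⟩ := hp
      refine (finite_setOf_add_mul_int hk.1.1 a R).subset ?_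
      rintro c ⟨hc, hR⟩
      exact ⟨(hk.minus_mem_iff ha).1 hc, hR⟩
    · exact Set.Finite.subset Set.finite_empty fun c hc => hp ⟨c, hc.1⟩
  refine ((h1.image plus).union (h2.image minus)).subset ?_
  rintro v ⟨hv, hR⟩
  rcases exists_eq_plus_or_minus v with ⟨c, rfl⟩ | ⟨c, rfl⟩
  · exact Or.inl ⟨c, ⟨hv, by simpa [plus_apply] using hR⟩, rfl⟩
  · exact Or.inr ⟨c, ⟨hv, by simpa [minus_apply] using hR⟩, rfl⟩

/-- Only finitely many horizontal parts meet a compact set. If its heights are bounded by `R`, the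
vertical part moves `0` by at most `2R`, which leaves finitely many couplings for each horizontal
part. -/
theorem IsCrystallographic.isFiberedSpaceGroup (hH : IsCrystallographic (horizontal G))
    (hk : IsFiberLength G k) : IsFiberedSpaceGroup G := by
  refine ⟨fun B hB => ?_, ?_, k, hk.1⟩
  · obtain ⟨R, hR⟩ := (hB.image continuous_snd).isBounded.exists_norm_le
    have hf := hH.finite _ (hB.image continuous_fst)
    refine (hf.biUnion fun h _ => (hk.finite_coupled h (R + R)).image (Prod.mk h)).subset ?_
    rintro ⟨h, v⟩ ⟨hg, _, ⟨b, hb, rfl⟩, hb'⟩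
    refine Set.mem_biUnion (x := h) ⟨mem_horizontal.2 ⟨v, hg⟩, h b.1, ⟨b.1, ⟨b, hb, rfl⟩, rfl⟩,
      _, hb', rfl⟩ ⟨v, ⟨hg, ?_⟩, rfl⟩
    have e1 := hR _ ⟨b, hb, rfl⟩
    have e2 := hR _ ⟨_, hb', rfl⟩
    simp only [act, Real.norm_eq_abs] at e1 e2
    rw [vertical_apply] at e2
    rcases slope_eq_one_or v with h | h <;> rw [h] at e2 <;> rw [abs_le] at * <;>
      constructor <;> linarith
  · obtain ⟨B, hB, h⟩ := hH.cocompact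
    refine ⟨B ×ˢ Set.Icc 0 k, hB.prod isCompact_Icc, fun p => ?_⟩
    obtain ⟨h, hh, b, hb, e⟩ := h p.1
    obtain ⟨v, hv⟩ := mem_horizontal.1 hh
    obtain ⟨n, hn⟩ := exists_int_mem_Icc hk.1.1 (v⁻¹ p.2)
    refine ⟨(h, v) * (1, plus (-(k * n))), G.mul_mem hv (hk.one_plus_mem_iff.2
      ⟨-n, by push_cast; ring⟩), (b, v⁻¹ p.2 + k * n), ⟨hb, hn⟩, ?_⟩
    refine Prod.ext ?_ ?_
    · simpa [act] using e
    · simp only [act, Prod.mk_mul_mk, IsometryEquiv.mul_apply, plus_apply]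
      rw [show -(k * (n : ℝ)) + (v⁻¹ p.2 + k * n) = v⁻¹ p.2 by ring]
      exact v.apply_symm_apply p.2

/-! ### Construction of isotopies -/

section isotopy

/-- The conjugates of plane isometries by a homeomorphism that conjugates them to isometries. -/
def conjHom {H : Subgroup (Plane ≃ᵢ Plane)} (F : Plane ≃ₜ Plane)
    (hF : ∀ h : H, Isometry fun x => F ((h : Plane ≃ᵢ Plane) (F.symm x))) :
    H →* Plane ≃ᵢ Plane where
  toFun h := ⟨(F.symm.toEquiv.trans (h : Plane ≃ᵢ Plane).toEquiv).trans F.toEquiv, hF h⟩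
  map_one' := by ext1 x; exact F.apply_symm_apply x
  map_mul' g h := by
    ext1 x
    change F (g.1 (h.1 (F.symm x))) = F (g.1 (F.symm (F (h.1 (F.symm x)))))
    rw [F.symm_apply_apply]

variable {H : Subgroup (Plane ≃ᵢ Plane)} {F : Plane ≃ₜ Plane}
    {hF : ∀ h : H, Isometry fun x => F ((h : Plane ≃ᵢ Plane) (F.symm x))}

@[simp] theorem conjHom_apply (h : H) (x : Plane) :
    conjHom F hF h x = F ((h : Plane ≃ᵢ Plane) (F.symm x)) := rfl

theorem conjHom_injective : Function.Injective (conjHom F hF) := fun g h e => by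
  ext1
  ext1 x
  have := congrArg (fun f : Plane ≃ᵢ Plane => F.symm (f (F x))) e
  simpa using this

theorem IsCrystallographic.range_conjHom (hH : IsCrystallographic H) :
    IsCrystallographic (conjHom F hF).range := by
  constructor
  · intro B hB
    refine (((hH.finite (F ⁻¹' B) ((Homeomorph.isCompact_preimage F).2 hB)).preimage
      (Subtype.val_injective (p := (· ∈ H))).injOn).image (conjHom F hF)).subset ?_
    rintro _ ⟨⟨h, rfl⟩, _, ⟨b, hb, rfl⟩, hb'⟩
    refine ⟨h, ⟨h.2, h.1 (F.symm b), ⟨F.symm b, by simpa using hb, rfl⟩, ?_⟩, rfl⟩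
    exact hb'
  · obtain ⟨B, hB, h⟩ := hH.cocompact
    refine ⟨F '' B, hB.image F.continuous, fun p => ?_⟩
    obtain ⟨g, hg, b, hb, e⟩ := h (F.symm p)
    refine ⟨_, ⟨⟨g, hg⟩, rfl⟩, F b, ⟨b, hb, rfl⟩, ?_⟩
    simp [e]

end isotopy

end

section

/-! ### Twisted homomorphisms and the isotopies they define -/

section isotopy

variable {G₀ G₁ : Subgroup FibIsom} {k₀ k₁ : ℝ} {θ : horizontal G₀ →* Plane ≃ᵢ Plane} {D : G₀ → ℝ}
  {F : Plane ≃ₜ Plane}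
  {hF : ∀ h : horizontal G₀, Isometry fun x => F ((h : Plane ≃ᵢ Plane) (F.symm x))}

/-- The group obtained from `G₀` by conjugating the plane group by `F`, twisting by the multiple
`t` of `D` and rescaling by `r`. -/
def twistHom (F : Plane ≃ₜ Plane)
    (hF : ∀ h : horizontal G₀, Isometry fun x => F ((h : Plane ≃ᵢ Plane) (F.symm x)))
    (hD : IsTwist G₀ G₁ k₀ k₁ θ D) (t r : ℝ) : G₀ →* FibIsom where
  toFun g := (conjHom F hF (toHorizontal G₀ g), twistVertical r (t * D g) (g : FibIsom).2)
  map_one' := by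
    refine Prod.ext ?_ ?_
    · simp only [map_one]; rfl
    · have h : D 1 = 0 := hD.vertical 1 rfl slope_one
      simp only [h, mul_zero]
      refine vertical_ext ?_ ?_
      · rw [twistVertical_zero]; simp
      · rw [slope_twistVertical]; rfl
  map_mul' g g' := by
    refine Prod.ext ?_ ?_
    · simp only [map_mul]; rfl
    · simp only [hD.map_mul, Subgroup.coe_mul, Prod.snd_mul]
      rw [← twistVertical_mul]
      congr 1; ring

theorem twistHom_apply (hD : IsTwist G₀ G₁ k₀ k₁ θ D) (t r : ℝ) (g : G₀) :
    twistHom F hF hD t r g =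
      (conjHom F hF (toHorizontal G₀ g), twistVertical r (t * D g) (g : FibIsom).2) := rfl

theorem twistVertical_injective {r : ℝ} (hr : r ≠ 0) (d : ℝ) :
    Function.Injective (twistVertical r d) := fun v w h => by
  have h0 := congrArg (fun u : ℝ ≃ᵢ ℝ => u 0) h
  have h1 := congrArg slope h
  simp only [twistVertical_zero] at h0
  rw [slope_twistVertical, slope_twistVertical] at h1
  exact vertical_ext (add_left_cancel (mul_left_cancel₀ hr h0)) h1

theorem twistHom_fst_eq_one_iff (hD : IsTwist G₀ G₁ k₀ k₁ θ D) (t r : ℝ) (g : G₀) :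
    (twistHom F hF hD t r g).1 = 1 ↔ (g : FibIsom).1 = 1 := by
  rw [twistHom_apply]
  change conjHom F hF (toHorizontal G₀ g) = 1 ↔ _
  rw [map_eq_one_iff _ conjHom_injective]
  exact Subtype.ext_iff

theorem twistHom_injective (hD : IsTwist G₀ G₁ k₀ k₁ θ D) (t : ℝ) {r : ℝ} (hr : r ≠ 0) :
    Function.Injective (twistHom F hF hD t r) := by
  rw [injective_iff_map_eq_one]
  intro g hg
  have h1 : (g : FibIsom).1 = 1 := (twistHom_fst_eq_one_iff hD t r g).1 (by rw [hg]; rfl)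
  have h2 : twistVertical r (t * D g) (g : FibIsom).2 = 1 := congrArg Prod.snd hg
  have h3 : slope (g : FibIsom).2 = 1 := by
    rw [← slope_twistVertical r (t * D g), h2, slope_one]
  rw [hD.vertical g h1 h3, mul_zero] at h2
  have h4 : twistVertical r 0 1 = 1 :=
    vertical_ext (by rw [twistVertical_zero]; simp) (slope_twistVertical _ _ _)
  ext1
  exact Prod.ext h1 (twistVertical_injective hr 0 (h2.trans h4.symm))

theorem horizontal_range_twistHom (hD : IsTwist G₀ G₁ k₀ k₁ θ D) (t r : ℝ) :
    horizontal (twistHom F hF hD t r).range = (conjHom F hF).range := by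
  ext h
  rw [mem_horizontal]
  constructor
  · rintro ⟨v, g, hg⟩
    exact ⟨toHorizontal G₀ g, congrArg Prod.fst hg⟩
  · rintro ⟨x, rfl⟩
    obtain ⟨v, hv⟩ := mem_horizontal.1 x.2
    exact ⟨_, ⟨(x, v), hv⟩, rfl⟩

theorem isFiberLength_range_twistHom (hk : IsFiberLength G₀ k₀) (hD : IsTwist G₀ G₁ k₀ k₁ θ D)
    (t : ℝ) {r : ℝ} (hr : 0 < r) : IsFiberLength (twistHom F hF hD t r).range (r * k₀) := by
  constructor
  · refine ⟨mul_pos hr hk.1.1, ⟨(1, plus k₀), hk.1.2⟩, ?_⟩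
    rw [twistHom_apply, hD.vertical _ rfl (slope_plus _)]
    refine Prod.ext ?_ ?_
    · exact (twistHom_fst_eq_one_iff (F := F) (hF := hF) hD t r ⟨(1, plus k₀), hk.1.2⟩).2 rfl
    · simp [twistVertical_plus]
  · rintro c ⟨hc, g, hg⟩
    have h1 : (g : FibIsom).1 = 1 := (twistHom_fst_eq_one_iff hD t r g).1 (by rw [hg])
    have h2 : twistVertical r (t * D g) (g : FibIsom).2 = plus c := congrArg Prod.snd hg
    have h3 : slope (g : FibIsom).2 = 1 := by
      rw [← slope_twistVertical r (t * D g), h2, slope_plus]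
    rw [hD.vertical g h1 h3, mul_zero] at h2
    obtain ⟨d, hd⟩ := (slope_eq_one_iff _).1 h3
    rw [hd, twistVertical_plus, zero_add, plus_inj] at h2
    subst h2
    refine mul_le_mul_of_nonneg_left (hk.2 ⟨pos_of_mul_pos_right hc hr.le, ?_⟩) hr.le
    rw [← h1, ← hd]
    exact g.2

/-- At time `t` the plane group is conjugated by `F t`, heights are shifted by `t D`, and the fiber
is rescaled. The horizontal part stays crystallographic and the fiber length positive, so every
image is a fibered space group. -/
theorem exists_isotopy (hG₀ : IsFiberedSpaceGroup G₀) (hk₀ : IsFiberLength G₀ k₀)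
    (hk₁ : IsFiberLength G₁ k₁) (hint : IsInterval G₁ → IsInterval G₀)
    (hD : IsTwist G₀ G₁ k₀ k₁ θ D)
    (hθ : ∀ h ∈ horizontal G₁, ∃ x, θ x = h)
    (F : Set.Icc (0 : ℝ) 1 → Plane ≃ₜ Plane)
    (hF : ∀ t, ∀ h : horizontal G₀, Isometry fun x => F t ((h : Plane ≃ᵢ Plane) ((F t).symm x)))
    (hF0 : ∀ (h : horizontal G₀) x, F 0 ((h : Plane ≃ᵢ Plane) ((F 0).symm x)) = (h : Plane ≃ᵢ Plane) x)
    (hF1 : ∀ (h : horizontal G₀) x, F 1 ((h : Plane ≃ᵢ Plane) ((F 1).symm x)) = θ h x)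
    (hcont : ∀ (h : horizontal G₀) x,
      Continuous fun t => F t ((h : Plane ≃ᵢ Plane) ((F t).symm x))) :
    ∃ Φ : Isotopy G₀ G₁, ∀ t g x, (Φ.φ t g).1 x = F t ((g : FibIsom).1 ((F t).symm x)) := by
  have p0 := hk₀.1.1
  have p1 := hk₁.1.1
  -- A convex combination of `1` and `k₁ / k₀`, hence positive throughout.
  let r : Set.Icc (0 : ℝ) 1 → ℝ := fun t => (1 - t) + t * (k₁ / k₀)
  have hr : ∀ t, 0 < r t := fun t => by
    have h0 := t.2.1
    have h1 := t.2.2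
    have h2 : 0 < k₁ / k₀ := div_pos p1 p0
    rcases h0.eq_or_lt with h | h
    · simp only [r, ← h]; norm_num
    · have := mul_pos h h2
      simp only [r]; linarith
  have hr1 : r 1 = k₁ / k₀ := by simp [r]
  have e1 : ∀ g : G₀, twistHom (F 1) (hF 1) hD ((1 : Set.Icc (0 : ℝ) 1) : ℝ) (r 1) g =
      (θ (toHorizontal G₀ g), twistVertical (k₁ / k₀) (D g) (g : FibIsom).2) := fun g => by
    rw [twistHom_apply, hr1]
    refine Prod.ext ?_ ?_
    · ext1 x; exact hF1 _ x
    · simp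
  refine ⟨⟨fun t => twistHom (F t) (hF t) hD t (r t), fun t => twistHom_injective hD t (hr t).ne',
    fun t => ?_, fun t g => twistHom_fst_eq_one_iff hD _ _ g, fun g p => ?_, fun g => ?_, ?_⟩,
    fun t g x => rfl⟩
  · refine IsCrystallographic.isFiberedSpaceGroup ?_ (isFiberLength_range_twistHom hk₀ hD t (hr t))
    rw [horizontal_range_twistHom]
    exact hG₀.isCrystallographic.range_conjHom
  · refine Continuous.prodMk (hcont (toHorizontal G₀ g) p.1) ?_
    have : ∀ t : Set.Icc (0 : ℝ) 1, (twistHom (F t) (hF t) hD t (r t) g).2 p.2 =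
        r t * (t * D g + (g : FibIsom).2 0) + slope (g : FibIsom).2 * p.2 := fun t => by
      rw [twistHom_apply, vertical_apply, twistVertical_zero, slope_twistVertical]
    simp only [this, r]
    fun_prop
  · rw [twistHom_apply]
    refine Prod.ext ?_ ?_
    · ext1 x; exact hF0 _ x
    · refine vertical_ext ?_ ?_
      · simp [twistVertical_zero, r]
      · rw [slope_twistVertical]
  · apply le_antisymm
    · rintro _ ⟨g, rfl⟩
      rw [e1]
      exact hD.mem g
    -- The final image already lies in `G₁` and reaches every horizontal part, so it remains to
    -- reach the elements of `G₁` over the identity.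
    · rintro ⟨h, w⟩ hw
      obtain ⟨x, rfl⟩ := hθ h (mem_horizontal.2 ⟨w, hw⟩)
      obtain ⟨v, hv⟩ := mem_horizontal.1 x.2
      have hm : ∀ g : G₀, (θ (toHorizontal G₀ g),
          twistVertical (k₁ / k₀) (D g) (g : FibIsom).2) ∈
          (twistHom (F 1) (hF 1) hD ((1 : Set.Icc (0 : ℝ) 1) : ℝ) (r 1)).range :=
        fun g => ⟨g, e1 g⟩
      have hvert : ∀ c : ℝ, ((1, plus c) : FibIsom) ∈ G₁ → ((1, plus c) : FibIsom) ∈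
          (twistHom (F 1) (hF 1) hD ((1 : Set.Icc (0 : ℝ) 1) : ℝ) (r 1)).range := fun c hc => by
        obtain ⟨n, rfl⟩ := hk₁.one_plus_mem_iff.1 hc
        have hn : ((1, plus (k₀ * n)) : FibIsom) ∈ G₀ := hk₀.one_plus_mem_iff.2 ⟨n, rfl⟩
        have := hm ⟨_, hn⟩
        rw [hD.vertical _ rfl (slope_plus _), twistVertical_plus, zero_add,
          show toHorizontal G₀ ⟨_, hn⟩ = 1 from rfl, map_one] at this
        rwa [show k₁ / k₀ * (k₀ * n) = k₁ * n by field_simp] at this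
      have hvert' : ∀ u, ((1, u) : FibIsom) ∈ G₁ → ((1, u) : FibIsom) ∈
          (twistHom (F 1) (hF 1) hD ((1 : Set.Icc (0 : ℝ) 1) : ℝ) (r 1)).range := fun u hu => by
        rcases exists_eq_plus_or_minus u with ⟨c, rfl⟩ | ⟨c, rfl⟩
        · exact hvert c hu
        -- A reflection over the identity in `G₀` goes to one in `G₁`; any other differs from it by
        -- a fiber translation, which has been reached.
        · obtain ⟨d, hd⟩ := hint ⟨c, hu⟩
          have h1 := hm ⟨_, hd⟩
          have h2 := hD.mem ⟨_, hd⟩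
          rw [twistVertical_minus, show toHorizontal G₀ ⟨_, hd⟩ = 1 from rfl, map_one] at h1 h2
          have h3 := G₁.mul_mem (G₁.inv_mem h2) hu
          rw [Prod.inv_mk, Prod.mk_mul_mk, minus_inv, minus_mul_minus, inv_one, one_mul] at h3
          have h4 := Subgroup.mul_mem _ h1 (hvert _ h3)
          rw [Prod.mk_mul_mk, minus_mul_plus, one_mul] at h4
          simpa using h4
      have h1 := hm ⟨(x, v), hv⟩
      have h2 := hD.mem ⟨(x, v), hv⟩
      have h3 := G₁.mul_mem (G₁.inv_mem h2) hw
      rw [Prod.inv_mk, Prod.mk_mul_mk,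
        show toHorizontal G₀ ⟨((x : Plane ≃ᵢ Plane), v), hv⟩ = x from rfl, inv_mul_cancel] at h3
      have h4 := Subgroup.mul_mem _ h1 (hvert' _ h3)
      rwa [Prod.mk_mul_mk, mul_one, mul_inv_cancel_left] at h4

end isotopy

end

section

open scoped ComplexConjugate

/-! ### Isometries of the plane -/

/-- The identification of the complex numbers with the plane. -/
def planeEquiv : ℂ ≃ₗᵢ[ℝ] Plane := Complex.orthonormalBasisOneI.repr

/-- The translation of the plane by `u`. -/
def trans (u : Plane) : Plane ≃ᵢ Plane := IsometryEquiv.addLeft u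

theorem trans_apply (u x : Plane) : trans u x = u + x := rfl

/-- The linear part of a plane isometry. -/
def linearPart : (Plane ≃ᵢ Plane) →* (Plane ≃ₗᵢ[ℝ] Plane) where
  toFun h := h.toRealLinearIsometryEquiv
  map_one' := by ext1 x; simp
  map_mul' g h := by
    ext1 x
    change g (h x) - g (h 0) =
      g.toRealLinearIsometryEquiv (h.toRealLinearIsometryEquiv x)
    rw [IsometryEquiv.toRealLinearIsometryEquiv_apply h, map_sub,
      IsometryEquiv.toRealLinearIsometryEquiv_apply, IsometryEquiv.toRealLinearIsometryEquiv_apply]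
    abel

theorem linearPart_apply (h : Plane ≃ᵢ Plane) (x : Plane) : linearPart h x = h x - h 0 :=
  IsometryEquiv.toRealLinearIsometryEquiv_apply h x

theorem apply_eq_linearPart_add (h : Plane ≃ᵢ Plane) (x : Plane) :
    h x = linearPart h x + h 0 := by rw [linearPart_apply, sub_add_cancel]

theorem linearPart_trans (u : Plane) : linearPart (trans u) = 1 := by
  ext1 x
  rw [linearPart_apply, trans_apply, trans_apply]
  simp

theorem eq_trans_of_linearPart_eq_one {h : Plane ≃ᵢ Plane} (hh : linearPart h = 1) :
    h = trans (h 0) := by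
  ext1 x
  rw [trans_apply, apply_eq_linearPart_add, hh, add_comm]
  rfl

theorem trans_zero : trans 0 = 1 := by ext1 x; simp [trans_apply]

theorem trans_add (u v : Plane) : trans (u + v) = trans u * trans v := by
  ext1 x; simp [trans_apply, add_assoc]

theorem trans_neg (u : Plane) : trans (-u) = (trans u)⁻¹ :=
  eq_inv_of_mul_eq_one_left (by rw [← trans_add, neg_add_cancel, trans_zero])

theorem conj_trans (h : Plane ≃ᵢ Plane) (u : Plane) :
    h * trans u * h⁻¹ = trans (linearPart h u) := by
  rw [mul_inv_eq_iff_eq_mul]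
  ext1 x
  rw [IsometryEquiv.mul_apply, IsometryEquiv.mul_apply, trans_apply, trans_apply,
    apply_eq_linearPart_add h (u + x), map_add, apply_eq_linearPart_add h x, add_assoc]

/-- An orientation preserving linear isometry. -/
def IsDirect (f : Plane ≃ₗᵢ[ℝ] Plane) : Prop := ∃ a : ℂ, ∀ z, f (planeEquiv z) = planeEquiv (a * z)

theorem isDirect_or (f : Plane ≃ₗᵢ[ℝ] Plane) : ∃ a : ℂ, a ≠ 0 ∧
    ((∀ z, f (planeEquiv z) = planeEquiv (a * z)) ∨
      ∀ z, f (planeEquiv z) = planeEquiv (a * conj z)) := by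
  obtain ⟨a, h⟩ := linear_isometry_complex ((planeEquiv.trans f).trans planeEquiv.symm)
  have key : ∀ z, f (planeEquiv z) =
      planeEquiv (((planeEquiv.trans f).trans planeEquiv.symm) z) := fun z => by simp
  refine ⟨a, by simp, h.imp (fun h z => ?_) fun h z => ?_⟩
  · rw [key, h, rotation_apply]
  · rw [key, h]; rfl

theorem IsDirect.exists_ne_zero {f : Plane ≃ₗᵢ[ℝ] Plane} (hf : IsDirect f) :
    ∃ a : ℂ, a ≠ 0 ∧ ∀ z, f (planeEquiv z) = planeEquiv (a * z) := by
  obtain ⟨a, ha⟩ := hf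
  refine ⟨a, ?_, ha⟩
  rintro rfl
  have h1 := ha 1
  rw [zero_mul, map_zero, LinearIsometryEquiv.map_eq_zero_iff,
    LinearIsometryEquiv.map_eq_zero_iff] at h1
  exact one_ne_zero h1

theorem exists_of_not_isDirect {f : Plane ≃ₗᵢ[ℝ] Plane} (hf : ¬ IsDirect f) :
    ∃ a : ℂ, a ≠ 0 ∧ ∀ z, f (planeEquiv z) = planeEquiv (a * conj z) := by
  obtain ⟨a, ha, h⟩ := isDirect_or f
  exact ⟨a, ha, h.resolve_left fun h => hf ⟨a, h⟩⟩

theorem plane_linear_ext {f g : Plane ≃ₗᵢ[ℝ] Plane}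
    (h : ∀ z, f (planeEquiv z) = g (planeEquiv z)) : f = g := by
  ext1 x
  simpa using h (planeEquiv.symm x)

theorem IsDirect.commute {f g : Plane ≃ₗᵢ[ℝ] Plane} (hf : IsDirect f) (hg : IsDirect g) :
    f * g = g * f := by
  obtain ⟨a, ha⟩ := hf
  obtain ⟨b, hb⟩ := hg
  refine plane_linear_ext fun z => ?_
  change f (g _) = g (f _)
  rw [ha, hb, ha, hb, mul_left_comm]

theorem isDirect_mul_of_not {f g : Plane ≃ₗᵢ[ℝ] Plane} (hf : ¬ IsDirect f) (hg : ¬ IsDirect g) :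
    IsDirect (f * g) := by
  obtain ⟨a, -, ha⟩ := exists_of_not_isDirect hf
  obtain ⟨b, -, hb⟩ := exists_of_not_isDirect hg
  refine ⟨a * conj b, fun z => ?_⟩
  change f (g _) = _
  rw [hb, ha, map_mul (starRingEnd ℂ), Complex.conj_conj, mul_assoc]

theorem IsDirect.inv {f : Plane ≃ₗᵢ[ℝ] Plane} (hf : IsDirect f) : IsDirect f⁻¹ := by
  obtain ⟨a, h0, ha⟩ := hf.exists_ne_zero
  refine ⟨a⁻¹, fun z => ?_⟩
  have := ha (a⁻¹ * z)
  rw [mul_inv_cancel_left₀ h0] at this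
  rw [← this]
  exact f.symm_apply_apply _

/-- The image of one nonzero vector determines a direct linear isometry, and likewise an opposite
one, so at most two of them take `u` to a given point. -/
theorem finite_setOf_apply_mem {u : Plane} (hu : u ≠ 0) {S : Set Plane} (hS : S.Finite) :
    {f : Plane ≃ₗᵢ[ℝ] Plane | f u ∈ S}.Finite := by
  obtain ⟨w, rfl⟩ := planeEquiv.surjective u
  have hw : w ≠ 0 := fun h => hu (by rw [h, map_zero])
  have hw' : conj w ≠ 0 := by simpa using hw
  have h1 : {f : Plane ≃ₗᵢ[ℝ] Plane | f (planeEquiv w) ∈ S ∧ IsDirect f}.Finite := by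
    refine Set.Finite.of_injOn (f := fun f => f (planeEquiv w)) (fun f hf => hf.1) ?_ hS
    rintro f ⟨-, a, ha⟩ g ⟨-, b, hb⟩ h
    simp only [ha, hb, EmbeddingLike.apply_eq_iff_eq] at h
    rw [mul_right_cancel₀ hw h] at ha
    exact plane_linear_ext fun z => (ha z).trans (hb z).symm
  have h2 : {f : Plane ≃ₗᵢ[ℝ] Plane | f (planeEquiv w) ∈ S ∧ ¬ IsDirect f}.Finite := by
    refine Set.Finite.of_injOn (f := fun f => f (planeEquiv w)) (fun f hf => hf.1) ?_ hS
    rintro f ⟨-, hf⟩ g ⟨-, hg⟩ h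
    obtain ⟨a, -, ha⟩ := exists_of_not_isDirect hf
    obtain ⟨b, -, hb⟩ := exists_of_not_isDirect hg
    simp only [ha, hb, EmbeddingLike.apply_eq_iff_eq] at h
    rw [mul_right_cancel₀ hw' h] at ha
    exact plane_linear_ext fun z => (ha z).trans (hb z).symm
  refine (h1.union h2).subset fun f hf => ?_
  by_cases h : IsDirect f
  · exact Or.inl ⟨hf, h⟩
  · exact Or.inr ⟨hf, h⟩

theorem exists_norm_gt (R : ℝ) : ∃ x : Plane, R < ‖x‖ := by
  refine ⟨planeEquiv ((|R| + 1 : ℝ) : ℂ), ?_⟩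
  rw [LinearIsometryEquiv.norm_map, Complex.norm_real, Real.norm_eq_abs]
  have := le_abs_self (|R| + 1)
  have := le_abs_self R
  linarith

/-! ### The translation lattice -/

/-- The vectors of the translations in `H`. -/
def lattice (H : Subgroup (Plane ≃ᵢ Plane)) : Submodule ℤ Plane :=
  AddSubgroup.toIntSubmodule
    { carrier := {u | trans u ∈ H}
      zero_mem' := by
        change trans 0 ∈ H
        rw [trans_zero]
        exact H.one_mem
      add_mem' := fun {u v} hu hv => by
        change trans (u + v) ∈ H
        rw [trans_add]
        exact H.mul_mem hu hv
      neg_mem' := fun {u} hu => by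
        change trans (-u) ∈ H
        rw [trans_neg]
        exact H.inv_mem hu }

variable {H : Subgroup (Plane ≃ᵢ Plane)}

theorem mem_lattice {u : Plane} : u ∈ lattice H ↔ trans u ∈ H := Iff.rfl

theorem linearPart_mem_lattice {h : Plane ≃ᵢ Plane} (hh : h ∈ H) {u : Plane}
    (hu : u ∈ lattice H) : linearPart h u ∈ lattice H := by
  rw [mem_lattice, ← conj_trans]
  exact H.mul_mem (H.mul_mem hh hu) (H.inv_mem hh)

namespace IsCrystallographic

variable (hH : IsCrystallographic H)

include hH

theorem finite_lattice (R : ℝ) : {u | u ∈ lattice H ∧ ‖u‖ ≤ R}.Finite := by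
  refine ((hH.finite (Metric.closedBall 0 R) (isCompact_closedBall 0 R)).image
    (fun h => h 0)).subset ?_
  rintro u ⟨hu, hR⟩
  have hR0 : (0 : Plane) ∈ Metric.closedBall 0 R := by
    simpa using (norm_nonneg u).trans hR
  refine ⟨trans u, ⟨hu, trans u 0, ⟨0, hR0, rfl⟩, ?_⟩, ?_⟩
  · simpa [trans_apply] using hR
  · simp [trans_apply]

/-- Without translations, linear parts determine the elements of `H`, so the orientation preserving
elements commute. A nontrivial one has a single fixed point `p`, which the others must then fix. All
orientation reversing elements send `p` to one point `q`. The orbit of `p` is thus bounded,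
contradicting cocompactness. -/
theorem exists_mem_lattice_ne_zero : ∃ u ∈ lattice H, u ≠ 0 := by
  by_contra! hcon
  have h1 : ∀ h ∈ H, linearPart h = 1 → h = 1 := fun h hh hl => by
    have e := eq_trans_of_linearPart_eq_one hl
    have hm : h 0 ∈ lattice H := by rw [mem_lattice, ← e]; exact hh
    rw [e, hcon _ hm, trans_zero]
  have hcomm : ∀ g ∈ H, ∀ h ∈ H, IsDirect (linearPart g) → IsDirect (linearPart h) →
      g * h = h * g := fun g hg h hh dg dh => by
    have := h1 (g * h * (h * g)⁻¹) (H.mul_mem (H.mul_mem hg hh) (H.inv_mem (H.mul_mem hh hg))) (by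
      rw [map_mul, map_inv, map_mul, map_mul, dg.commute dh, mul_inv_cancel])
    exact mul_inv_eq_one.1 this
  obtain ⟨p, hp⟩ : ∃ p, ∀ h ∈ H, IsDirect (linearPart h) → h p = p := by
    by_cases hex : ∃ h ∈ H, IsDirect (linearPart h) ∧ h ≠ 1
    · obtain ⟨h, hh, dh, hne⟩ := hex
      obtain ⟨a, ha⟩ := dh
      have ha1 : a ≠ 1 := by
        rintro rfl
        refine hne (h1 h hh (plane_linear_ext fun z => ?_))
        rw [ha, one_mul]; rfl
      have hfix : ∀ x, h x = x ↔ planeEquiv.symm x = planeEquiv.symm (h 0) / (1 - a) := fun x => by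
        obtain ⟨z, rfl⟩ := planeEquiv.surjective x
        rw [apply_eq_linearPart_add, ha, ← planeEquiv.symm.injective.eq_iff, map_add,
          LinearIsometryEquiv.symm_apply_apply, LinearIsometryEquiv.symm_apply_apply,
          eq_div_iff (sub_ne_zero.2 ha1.symm)]
        constructor <;> intro e <;> linear_combination -e
      refine ⟨planeEquiv (planeEquiv.symm (h 0) / (1 - a)), fun g hg dg => ?_⟩
      set p := planeEquiv (planeEquiv.symm (h 0) / (1 - a)) with hp
      have hpf : h p = p := (hfix p).2 (by simp [hp])
      have hgp : h (g p) = g p := by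
        have := congrArg (fun f : Plane ≃ᵢ Plane => f p) (hcomm h hh g hg ⟨a, ha⟩ dg)
        simpa [hpf] using this
      have := (hfix _).1 hgp
      rw [← (hfix p).1 hpf] at this
      exact planeEquiv.symm.injective this
    · push Not at hex
      exact ⟨0, fun h hh dh => by rw [hex h hh dh]; rfl⟩
  obtain ⟨q, hq⟩ : ∃ q, ∀ h ∈ H, h p = p ∨ h p = q := by
    by_cases hex : ∃ h ∈ H, ¬ IsDirect (linearPart h)
    · obtain ⟨r, hr, dr⟩ := hex
      refine ⟨r p, fun h hh => ?_⟩
      by_cases dh : IsDirect (linearPart h)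
      · exact Or.inl (hp h hh dh)
      · right
        have dr' : ¬ IsDirect (linearPart r⁻¹) := fun d => dr (by
          have := d.inv
          rwa [map_inv, inv_inv] at this)
        have := hp (r⁻¹ * h) (H.mul_mem (H.inv_mem hr) hh) (by
          rw [map_mul]; exact isDirect_mul_of_not dr' dh)
        rw [IsometryEquiv.mul_apply] at this
        exact (r.apply_symm_apply (h p)).symm.trans (congrArg r this)
    · push Not at hex
      exact ⟨p, fun h hh => Or.inl (hp h hh (hex h hh))⟩
  obtain ⟨B, hB, hcov⟩ := hH.cocompact
  obtain ⟨R, hR⟩ := hB.isBounded.exists_norm_le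
  -- Every translate of a point of `B` is within `R + ‖p‖` of `p` or `q`, so such an `x` is not
  -- covered.
  obtain ⟨x, hx⟩ := exists_norm_gt (R + ‖p‖ + ‖p‖ + ‖q‖)
  obtain ⟨h, hh, b, hb, rfl⟩ := hcov x
  have h2 : dist (h b) (h p) ≤ R + ‖p‖ := by
    rw [h.isometry.dist_eq, dist_eq_norm]
    exact (norm_sub_le _ _).trans (by linarith [hR b hb])
  have h3 : ‖h b‖ ≤ dist (h b) (h p) + ‖h p‖ := by
    rw [dist_eq_norm]
    simpa using norm_add_le (h b - h p) (h p)
  have := norm_nonneg p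
  have := norm_nonneg q
  rcases hq h hh with e | e <;> rw [e] at h3 h2 <;> linarith

/-- Linear parts permute the lattice vectors of a given length, of which there are finitely many,
and the image of one nonzero vector leaves at most two linear isometries. -/
theorem finite_range_linearPart : (Set.range fun h : H => linearPart h).Finite := by
  obtain ⟨u, hu, h0⟩ := hH.exists_mem_lattice_ne_zero
  refine (finite_setOf_apply_mem h0 (hH.finite_lattice ‖u‖)).subset ?_
  rintro _ ⟨h, rfl⟩
  exact ⟨linearPart_mem_lattice h.2 hu, (LinearIsometryEquiv.norm_map _ _).le⟩

/-- Every element is the product of a translation and one of finitely many elements. -/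
theorem exists_finite_reps : ∃ S : Set (Plane ≃ᵢ Plane), S.Finite ∧
    ∀ h ∈ H, ∃ r ∈ S, ∃ u ∈ lattice H, h = trans u * r := by
  have hf : Finite (Set.range fun h : H => linearPart h) := hH.finite_range_linearPart
  choose r hr using fun f : Set.range fun h : H => linearPart h => f.2
  refine ⟨Set.range fun f => (r f : Plane ≃ᵢ Plane), Set.finite_range _, fun h hh => ?_⟩
  let f : Set.range fun h : H => linearPart h := ⟨linearPart h, ⟨h, hh⟩, rfl⟩
  have hl : linearPart (h * (r f : Plane ≃ᵢ Plane)⁻¹) = 1 := by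
    rw [map_mul, map_inv, show linearPart (r f) = linearPart h from hr f, mul_inv_cancel]
  have e := eq_trans_of_linearPart_eq_one hl
  refine ⟨_, ⟨f, rfl⟩, _, ?_, mul_inv_eq_iff_eq_mul.1 e⟩
  rw [mem_lattice, ← e]
  exact H.mul_mem hh (H.inv_mem (r f).2)

/-- For `w` orthogonal to the lattice, the inner product with `w` ignores translations. It is then
bounded on the whole plane, since finitely many images of a compact set cover the plane up to
lattice translations; this forces `w = 0`. -/
theorem span_lattice : Submodule.span ℝ (lattice H : Set Plane) = ⊤ := by
  by_contra hne
  rw [← Submodule.orthogonal_eq_bot_iff] at hne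
  obtain ⟨w, hw, hw0⟩ := Submodule.exists_mem_ne_zero_of_ne_bot hne
  have hort : ∀ u ∈ lattice H, inner ℝ w u = 0 := fun u hu =>
    Submodule.inner_left_of_mem_orthogonal (Submodule.subset_span hu) hw
  obtain ⟨S, hS, hrep⟩ := hH.exists_finite_reps
  obtain ⟨B, hB, hcov⟩ := hH.cocompact
  have hc : IsCompact (⋃ r ∈ S, (r : Plane → Plane) '' B) :=
    hS.isCompact_biUnion fun r _ => hB.image r.continuous
  obtain ⟨R, hR⟩ := hc.isBounded.exists_norm_le
  have hbound : ∀ x, inner ℝ w x ≤ ‖w‖ * R := fun x => by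
    obtain ⟨h, hh, b, hb, rfl⟩ := hcov x
    obtain ⟨r, hr, u, hu, rfl⟩ := hrep h hh
    rw [IsometryEquiv.mul_apply, trans_apply, inner_add_right, hort u hu, zero_add]
    refine (real_inner_le_norm _ _).trans (mul_le_mul_of_nonneg_left (hR _ ?_) (norm_nonneg _))
    exact Set.mem_biUnion hr ⟨b, hb, rfl⟩
  have h1 := hbound (((‖w‖ * R + 1) / ‖w‖ ^ 2) • w)
  have h2 : ‖w‖ ≠ 0 := norm_ne_zero_iff.2 hw0
  rw [inner_smul_right, real_inner_self_eq_norm_sq, div_mul_cancel₀ _ (pow_ne_zero 2 h2)] at h1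
  linarith

theorem discreteTopology_lattice : DiscreteTopology (lattice H) := by
  have hf := (hH.finite_lattice 1).subset (Set.sdiff_subset (t := {0}))
  refine discreteTopology_of_isOpen_singleton_zero ?_
  have : ({0} : Set (lattice H)) = Subtype.val ⁻¹'
      (Metric.ball 0 1 ∩ ({u | u ∈ lattice H ∧ ‖u‖ ≤ 1} \ {0})ᶜ) := by
    ext u
    simp only [Set.mem_singleton_iff, Set.mem_preimage, Set.mem_inter_iff, Metric.mem_ball,
      dist_zero_right, Set.mem_compl_iff, Set.mem_sdiff, Set.mem_ofPred_eq, not_and, not_not]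
    constructor
    · rintro rfl; simp
    · rintro ⟨h1, h2⟩
      exact Subtype.ext (h2 ⟨u.2, h1.le⟩)
  rw [this]
  exact (Metric.isOpen_ball.inter hf.isClosed.isOpen_compl).preimage continuous_subtype_val

/-- This characterizes translations by group structure alone, so isomorphisms preserve them.
Translations commute with the translation subgroup, which has finite index. Conversely, if the
centralizer has finite index, a positive multiple of each lattice vector is fixed by the linear
part, hence so is the vector, and the lattice spans. -/
theorem linearPart_eq_one_iff (h : H) :
    linearPart h = 1 ↔ (Subgroup.centralizer ({h} : Set H)).FiniteIndex := by
  constructor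
  · intro hl
    have : Finite (linearPart.comp H.subtype).range := hH.finite_range_linearPart
    have hk : (linearPart.comp H.subtype).ker.FiniteIndex := Subgroup.finiteIndex_ker _
    refine Subgroup.finiteIndex_of_le (H := (linearPart.comp H.subtype).ker) fun g hg => ?_
    rw [Subgroup.mem_centralizer_singleton_iff]
    have hg : linearPart g = 1 := hg
    ext1
    rw [Subgroup.coe_mul, Subgroup.coe_mul, eq_trans_of_linearPart_eq_one hg,
      eq_trans_of_linearPart_eq_one hl, ← trans_add, ← trans_add, add_comm]
  · intro hfi
    have key : ∀ u ∈ lattice H, linearPart h u = u := fun u hu => by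
      obtain ⟨n, hn, -, hm⟩ := Subgroup.exists_pow_mem_of_index_ne_zero hfi.index_ne_zero
        (⟨trans u, hu⟩ : H)
      rw [Subgroup.mem_centralizer_singleton_iff] at hm
      have hpow : ∀ n : ℕ, trans u ^ n = trans ((n : ℝ) • u) := fun n => by
        induction n with
        | zero => simp [trans_zero]
        | succ n ih => rw [pow_succ, ih, ← trans_add, Nat.cast_succ, add_smul, one_smul]
      have hm' := congrArg Subtype.val hm
      simp only [Subgroup.coe_mul, Subgroup.coe_pow, hpow] at hm'
      have h2 := conj_trans (h : Plane ≃ᵢ Plane) ((n : ℝ) • u)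
      have h3 := congrArg (fun f : Plane ≃ᵢ Plane => f 0) (h2.symm.trans
        (mul_inv_eq_iff_eq_mul.2 (hm'.symm)))
      simp only [trans_apply, add_zero, map_smul] at h3
      exact smul_right_injective _ (Nat.cast_ne_zero.2 hn.ne') h3
    ext1 x
    have hx : x ∈ Submodule.span ℝ (lattice H : Set Plane) := hH.span_lattice ▸ Submodule.mem_top
    have : Set.EqOn (linearPart (h : Plane ≃ᵢ Plane)).toLinearEquiv.toLinearMap
      (LinearMap.id : Plane →ₗ[ℝ] Plane) (Submodule.span ℝ (lattice H : Set Plane)) :=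
      LinearMap.eqOn_span fun u hu => key u hu
    exact this hx

end IsCrystallographic

end

section

/-! ### Isomorphisms of plane groups are affine -/

section affine

variable {H H' : Subgroup (Plane ≃ᵢ Plane)}

theorem linearPart_map_eq_one_iff (hH : IsCrystallographic H) (hH' : IsCrystallographic H')
    (θ : H ≃* H') (h : H) :
    linearPart (θ h : Plane ≃ᵢ Plane) = 1 ↔ linearPart (h : Plane ≃ᵢ Plane) = 1 := by
  rw [hH.linearPart_eq_one_iff, hH'.linearPart_eq_one_iff]
  have : (Subgroup.centralizer ({θ h} : Set H')).comap θ.toMonoidHom =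
      Subgroup.centralizer ({h} : Set H) := by
    ext g
    rw [Subgroup.mem_comap, Subgroup.mem_centralizer_singleton_iff,
      Subgroup.mem_centralizer_singleton_iff]
    change θ g * θ h = θ h * θ g ↔ _
    rw [← map_mul, ← map_mul, EmbeddingLike.apply_eq_iff_eq]
  rw [Subgroup.finiteIndex_iff, Subgroup.finiteIndex_iff, ← this,
    Subgroup.index_comap_of_surjective _ (f := θ.toMonoidHom) θ.surjective]

/-- The linear extension of the action of an isomorphism on the translations. -/
theorem exists_linear_extension (hH : IsCrystallographic H) (hH' : IsCrystallographic H')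
    (θ : H ≃* H') : ∃ A : Plane →ₗ[ℝ] Plane, ∀ u (hu : u ∈ lattice H),
      (θ ⟨trans u, hu⟩ : Plane ≃ᵢ Plane) = trans (A u) := by
  have hval : ∀ u (hu : u ∈ lattice H), (θ ⟨trans u, hu⟩ : Plane ≃ᵢ Plane) =
      trans ((θ ⟨trans u, hu⟩ : Plane ≃ᵢ Plane) 0) := fun u hu =>
    eq_trans_of_linearPart_eq_one ((linearPart_map_eq_one_iff hH hH' θ _).2 (linearPart_trans u))
  let α : lattice H →+ Plane :=
    { toFun := fun u => (θ ⟨trans u, u.2⟩ : Plane ≃ᵢ Plane) 0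
      map_zero' := by
        have : (⟨trans ((0 : lattice H) : Plane), (0 : lattice H).2⟩ : H) = 1 :=
          Subtype.ext trans_zero
        rw [this, map_one]; rfl
      map_add' := fun u v => by
        have : (⟨trans ((u + v : lattice H) : Plane), (u + v).2⟩ : H) =
            ⟨trans u, u.2⟩ * ⟨trans v, v.2⟩ := Subtype.ext (trans_add _ _)
        rw [this, map_mul, Subgroup.coe_mul, IsometryEquiv.mul_apply, hval u u.2, trans_apply,
          trans_apply, add_zero] }
  have := hH.discreteTopology_lattice
  have hz : IsZLattice ℝ (lattice H) := ⟨hH.span_lattice⟩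
  have := ZLattice.module_finite ℝ (lattice H)
  have := ZLattice.module_free ℝ (lattice H)
  let b := Module.Free.chooseBasis ℤ (lattice H)
  let A : Plane →ₗ[ℝ] Plane := (b.ofZLatticeBasis ℝ (lattice H)).constr ℝ fun i => α (b i)
  refine ⟨A, fun u hu => ?_⟩
  -- Both sides are additive on the lattice and agree on a basis of it.
  have e : α.toIntLinearMap = (A.restrictScalars ℤ).comp (lattice H).subtype := by
    refine b.ext fun i => ?_
    have h1 : A (b i) = α (b i) := by
      have := (b.ofZLatticeBasis ℝ (lattice H)).constr_basis ℝ (fun i => α (b i)) i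
      rwa [b.ofZLatticeBasis_apply ℝ (lattice H)] at this
    exact h1.symm
  rw [hval u hu]
  exact congrArg trans (LinearMap.congr_fun e ⟨u, hu⟩)

theorem eq_of_eqOn_lattice (hH : IsCrystallographic H) {A B : Plane →ₗ[ℝ] Plane}
    (h : ∀ u ∈ lattice H, A u = B u) : A = B :=
  LinearMap.ext_on (s := (lattice H : Set Plane)) hH.span_lattice h

theorem trans_injective : Function.Injective trans := fun u v h => by
  simpa [trans_apply] using congrArg (fun f : Plane ≃ᵢ Plane => f 0) h

/-- An isomorphism of plane crystallographic groups is the conjugation by an affine map. -/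
theorem exists_affine_conj (hH : IsCrystallographic H) (hH' : IsCrystallographic H')
    (θ : H ≃* H') : ∃ (A : Plane ≃ₗ[ℝ] Plane) (b : Plane), ∀ (h : H) x,
      A ((h : Plane ≃ᵢ Plane) x) + b = (θ h : Plane ≃ᵢ Plane) (A x + b) := by
  obtain ⟨A, hA⟩ := exists_linear_extension hH hH' θ
  obtain ⟨A', hA'⟩ := exists_linear_extension hH' hH θ.symm
  have hAmem : ∀ u ∈ lattice H, A u ∈ lattice H' := fun u hu => by
    rw [mem_lattice, ← hA u hu]
    exact (θ _).2
  have hinv : A'.comp A = LinearMap.id := eq_of_eqOn_lattice hH fun u hu => by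
    have h1 := hA' (A u) (hAmem u hu)
    have h2 : (⟨trans (A u), hAmem u hu⟩ : H') = θ ⟨trans u, hu⟩ := Subtype.ext (hA u hu).symm
    rw [h2, MulEquiv.symm_apply_apply] at h1
    exact (trans_injective h1).symm
  have hinj : Function.Injective A := fun x y h => by
    have := congrArg A' h
    rwa [← LinearMap.comp_apply, ← LinearMap.comp_apply, hinv] at this
  -- Conjugation by `h` acts on translations through its linear part, so applying `θ` gives the
  -- identity on lattice vectors, and these span.
  have hlin : ∀ (h : H) x, A (linearPart (h : Plane ≃ᵢ Plane) x) =
      linearPart (θ h : Plane ≃ᵢ Plane) (A x) := fun h x => by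
    have : A.comp (linearPart (h : Plane ≃ᵢ Plane)).toLinearEquiv.toLinearMap =
        (linearPart (θ h : Plane ≃ᵢ Plane)).toLinearEquiv.toLinearMap.comp A :=
      eq_of_eqOn_lattice hH fun u hu => by
        change A (linearPart (h : Plane ≃ᵢ Plane) u) = linearPart (θ h : Plane ≃ᵢ Plane) (A u)
        have hm := linearPart_mem_lattice h.2 hu
        apply trans_injective
        have e : (⟨trans (linearPart (h : Plane ≃ᵢ Plane) u), hm⟩ : H) =
            h * ⟨trans u, hu⟩ * h⁻¹ := Subtype.ext (conj_trans _ _).symm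
        have h1 := hA _ hm
        rw [e, map_mul, map_mul, map_inv, Subgroup.coe_mul, Subgroup.coe_mul, Subgroup.coe_inv,
          hA u hu, conj_trans] at h1
        exact h1.symm
    exact LinearMap.congr_fun this x
  -- With linear parts matched, `c` measures the mismatch of the translation parts. It is a cocycle
  -- that vanishes on translations, so it lives on the finite quotient `H ⧸ T`.
  let c : H → Plane := fun h => (θ h : Plane ≃ᵢ Plane) 0 - A ((h : Plane ≃ᵢ Plane) 0)
  have hc : ∀ g h, c (g * h) = linearPart (θ g : Plane ≃ᵢ Plane) (c h) + c g := fun g h => by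
    simp only [c, map_mul, Subgroup.coe_mul, IsometryEquiv.mul_apply]
    rw [apply_eq_linearPart_add (θ g : Plane ≃ᵢ Plane), apply_eq_linearPart_add (g : Plane ≃ᵢ Plane),
      map_add, hlin, map_sub]
    abel
  let T : Subgroup H := (linearPart.comp H.subtype).ker
  have hT : ∀ t ∈ T, c t = 0 := fun t ht => by
    have ht1 : linearPart (t : Plane ≃ᵢ Plane) = 1 := ht
    have e := eq_trans_of_linearPart_eq_one ht1
    have hm : (t : Plane ≃ᵢ Plane) 0 ∈ lattice H := by rw [mem_lattice, ← e]; exact t.2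
    have h1 := hA _ hm
    rw [show (⟨trans ((t : Plane ≃ᵢ Plane) 0), hm⟩ : H) = t from Subtype.ext e.symm] at h1
    simp only [c]
    rw [h1, trans_apply, add_zero, sub_self]
  have : Finite (linearPart.comp H.subtype).range := hH.finite_range_linearPart
  have hfin : T.FiniteIndex := Subgroup.finiteIndex_ker _
  have := T.fintypeQuotientOfFiniteIndex
  let cq : H ⧸ T → Plane := fun q => Quotient.liftOn' q c fun g h hgh => by
    rw [QuotientGroup.leftRel_apply] at hgh
    have := hc g (g⁻¹ * h)
    rw [hT _ hgh, mul_inv_cancel_left, map_zero, zero_add] at this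
    exact this.symm
  have hcq : ∀ (g : H) (q : H ⧸ T),
      cq (g • q) = linearPart (θ g : Plane ≃ᵢ Plane) (cq q) + c g := fun g q => by
    induction q using QuotientGroup.induction_on with
    | H h => exact hc g h
  let n : ℝ := Fintype.card (H ⧸ T)
  have hn : n ≠ 0 := Nat.cast_ne_zero.2 Fintype.card_ne_zero
  -- Averaging over the finite quotient writes the cocycle as a coboundary; the mean `b` is the
  -- translation part of the affine map.
  let b : Plane := n⁻¹ • ∑ q, cq q
  have hb : ∀ g : H, b = linearPart (θ g : Plane ≃ᵢ Plane) b + c g := fun g => by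
    have h1 : ∑ q, cq (g • q) = ∑ q, cq q := Equiv.sum_comp (MulAction.toPerm g) cq
    simp only [hcq, Finset.sum_add_distrib, Finset.sum_const, Finset.card_univ] at h1
    rw [← map_sum, ← Nat.cast_smul_eq_nsmul ℝ] at h1
    change _ + n • c g = _ at h1
    change n⁻¹ • _ = linearPart (θ g : Plane ≃ᵢ Plane) (n⁻¹ • _) + c g
    rw [map_smul]
    nth_rewrite 1 [← h1]
    rw [smul_add, smul_smul, inv_mul_cancel₀ hn, one_smul]
  refine ⟨LinearEquiv.ofInjectiveEndo A hinj, b, fun h x => ?_⟩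
  rw [LinearEquiv.coe_ofInjectiveEndo, apply_eq_linearPart_add (θ h : Plane ≃ᵢ Plane),
    apply_eq_linearPart_add (h : Plane ≃ᵢ Plane), map_add, map_add, hlin]
  have := hb h
  simp only [c] at this
  nth_rewrite 1 [this]
  abel

end affine

end

section

open scoped ComplexConjugate

/-! ### Paths of affine maps -/

/-- The affine map of the plane with complex coordinates `a`, `β`, `c`. -/
def affineFun (a β c : ℂ) (x : Plane) : Plane :=
  planeEquiv (a * planeEquiv.symm x + β * conj (planeEquiv.symm x) + c)

/-- The inverse of `affineFun (a * 1) (a * s) c`. -/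
def affineInv (a s c : ℂ) (x : Plane) : Plane :=
  planeEquiv (((planeEquiv.symm x - c) / a - s * conj ((planeEquiv.symm x - c) / a)) /
    (1 - s * conj s))

theorem one_sub_mul_conj_ne_zero {s : ℂ} (hs : ‖s‖ < 1) : 1 - s * conj s ≠ 0 := by
  rw [Complex.mul_conj, ← Complex.ofReal_one, ← Complex.ofReal_sub, Complex.ofReal_ne_zero,
    Complex.normSq_eq_norm_sq]
  nlinarith [norm_nonneg s]

theorem affineFun_affineInv {a s : ℂ} (ha : a ≠ 0) (hs : ‖s‖ < 1) (c : ℂ) (x : Plane) :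
    affineFun a (a * s) c (affineInv a s c x) = x := by
  have h := one_sub_mul_conj_ne_zero hs
  have h' : 1 - conj s * s ≠ 0 := by rwa [mul_comm]
  unfold affineFun affineInv
  rw [LinearIsometryEquiv.symm_apply_apply]
  obtain ⟨w, rfl⟩ := planeEquiv.surjective x
  rw [LinearIsometryEquiv.symm_apply_apply]
  congr 1
  obtain ⟨y, rfl⟩ : ∃ y, w = a * y + c := ⟨(w - c) / a, by field_simp; ring⟩
  rw [add_sub_cancel_right, mul_div_cancel_left₀ _ ha]
  simp only [map_div₀, map_sub, map_mul, map_one, Complex.conj_conj]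
  field_simp
  ring

theorem affineInv_affineFun {a s : ℂ} (ha : a ≠ 0) (hs : ‖s‖ < 1) (c : ℂ) (x : Plane) :
    affineInv a s c (affineFun a (a * s) c x) = x := by
  have h := one_sub_mul_conj_ne_zero hs
  unfold affineFun affineInv
  rw [LinearIsometryEquiv.symm_apply_apply]
  obtain ⟨w, rfl⟩ := planeEquiv.surjective x
  rw [LinearIsometryEquiv.symm_apply_apply]
  congr 1
  rw [add_sub_cancel_right]
  have : (a * w + a * s * conj w) / a = w + s * conj w := by field_simp
  rw [this, div_eq_iff h]
  simp only [map_add, map_mul, Complex.conj_conj]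
  ring

/-- `affineFun` as a homeomorphism. -/
def affineHomeo {a s : ℂ} (ha : a ≠ 0) (hs : ‖s‖ < 1) (c : ℂ) : Plane ≃ₜ Plane where
  toFun := affineFun a (a * s) c
  invFun := affineInv a s c
  left_inv := affineInv_affineFun ha hs c
  right_inv := affineFun_affineInv ha hs c
  continuous_toFun := by unfold affineFun; fun_prop
  continuous_invFun := by unfold affineInv; fun_prop

/-- The squared norm of `z + t μ conj z` is `‖z‖² (1 + t² ‖μ‖²) + 2 t Re (μ (conj z)²)`. Equality at
`t = 0` matches the first terms and equality at `t = 1` then matches the real parts, so equality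
holds for all `t`. -/
theorem norm_add_mul_conj_eq {z w μ : ℂ} (h1 : ‖w‖ = ‖z‖)
    (h2 : ‖w + μ * conj w‖ = ‖z + μ * conj z‖) (t : ℝ) :
    ‖w + t * μ * conj w‖ = ‖z + t * μ * conj z‖ := by
  have key : ∀ (t : ℝ) (z : ℂ), Complex.normSq (z + t * μ * conj z) =
      Complex.normSq z * (1 + t ^ 2 * Complex.normSq μ) +
        2 * t * (μ * conj z * conj z).re := fun t z => by
    simp only [Complex.normSq_apply, Complex.add_re, Complex.add_im, Complex.mul_re,
      Complex.mul_im, Complex.ofReal_re, Complex.ofReal_im, Complex.conj_re, Complex.conj_im]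
    ring
  have e1 : Complex.normSq w = Complex.normSq z := by
    rw [Complex.normSq_eq_norm_sq, h1, Complex.normSq_eq_norm_sq]
  have e2 : Complex.normSq (w + (1 : ℝ) * μ * conj w) =
      Complex.normSq (z + (1 : ℝ) * μ * conj z) := by
    rw [Complex.ofReal_one, one_mul, Complex.normSq_eq_norm_sq, h2, Complex.normSq_eq_norm_sq]
  rw [key, key, e1] at e2
  have e3 : Complex.normSq (w + t * μ * conj w) = Complex.normSq (z + t * μ * conj z) := by
    rw [key, key, e1]
    linear_combination t * e2
  rw [Complex.normSq_eq_norm_sq, Complex.normSq_eq_norm_sq] at e3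
  exact (sq_eq_sq₀ (norm_nonneg _) (norm_nonneg _)).1 e3

theorem dist_affineFun (a β c : ℂ) (x y : Plane) :
    dist (affineFun a β c x) (affineFun a β c y) =
      ‖a * planeEquiv.symm (x - y) + β * conj (planeEquiv.symm (x - y))‖ := by
  unfold affineFun
  rw [LinearIsometryEquiv.dist_map, dist_eq_norm, map_sub, map_sub]
  congr 1
  ring

theorem dist_affineFun_mul (a s c : ℂ) (x y : Plane) :
    dist (affineFun a (a * s) c x) (affineFun a (a * s) c y) =
      ‖a‖ * ‖planeEquiv.symm (x - y) + s * conj (planeEquiv.symm (x - y))‖ := by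
  rw [dist_affineFun, ← norm_mul]
  congr 1
  ring

/-- An orientation preserving affine map conjugating a plane group to isometries can be joined to the
identity by such maps. -/
theorem exists_affine_path {H : Subgroup (Plane ≃ᵢ Plane)} {θ : H →* Plane ≃ᵢ Plane} {a β c : ℂ}
    (hβ : ‖β‖ < ‖a‖)
    (hθ : ∀ (h : H) x, affineFun a β c ((h : Plane ≃ᵢ Plane) x) = θ h (affineFun a β c x)) :
    ∃ F : Set.Icc (0 : ℝ) 1 → Plane ≃ₜ Plane,
      (∀ t, ∀ h : H, Isometry fun x => F t ((h : Plane ≃ᵢ Plane) ((F t).symm x))) ∧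
      (∀ (h : H) x, F 0 ((h : Plane ≃ᵢ Plane) ((F 0).symm x)) = (h : Plane ≃ᵢ Plane) x) ∧
      (∀ (h : H) x, F 1 ((h : Plane ≃ᵢ Plane) ((F 1).symm x)) = θ h x) ∧
      ∀ (h : H) x, Continuous fun t => F t ((h : Plane ≃ᵢ Plane) ((F t).symm x)) := by
  have ha : a ≠ 0 := by
    rintro rfl
    rw [norm_zero] at hβ
    exact absurd hβ (not_lt.2 (norm_nonneg _))
  let μ := β / a
  have hμ : ‖μ‖ < 1 := by
    rw [norm_div]; exact (div_lt_one (norm_pos_iff.2 ha)).2 hβ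
  have haμ : a * μ = β := mul_div_cancel₀ _ ha
  have hs : ∀ t : Set.Icc (0 : ℝ) 1, ‖(t : ℝ) * μ‖ < 1 := fun t => by
    rw [norm_mul, Complex.norm_real, Real.norm_of_nonneg t.2.1]
    nlinarith [t.2.1, t.2.2, norm_nonneg μ]
  -- The map at time `t` is `z ↦ A t (z + t μ conj z) + t c`, where `A` is a path from `1` to `a`
  -- avoiding `0`; it stays invertible because `‖t μ‖ < 1`.
  let A : Set.Icc (0 : ℝ) 1 → ℂ := fun t => Complex.exp ((t : ℝ) * Complex.log a)
  have hA : ∀ t, A t ≠ 0 := fun t => Complex.exp_ne_zero _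
  let F : Set.Icc (0 : ℝ) 1 → Plane ≃ₜ Plane := fun t =>
    affineHomeo (hA t) (hs t) ((t : ℝ) * c)
  have hF : ∀ t x, F t x = affineFun (A t) (A t * ((t : ℝ) * μ)) ((t : ℝ) * c) x := fun _ _ => rfl
  have hFs : ∀ t x, (F t).symm x = affineInv (A t) ((t : ℝ) * μ) ((t : ℝ) * c) x := fun _ _ => rfl
  have hF1 : ∀ x, F 1 x = affineFun a β c x := fun x => by
    have e : A 1 = a := by simp [A, Complex.exp_log ha]
    rw [hF, e]
    simp [haμ]
  have hF0 : ∀ x, F 0 x = x := fun x => by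
    have e : A 0 = 1 := by simp [A]
    rw [hF, e]
    simp [affineFun]
  have hdist : ∀ t (h : H) x y, dist (F t ((h : Plane ≃ᵢ Plane) x)) (F t ((h : Plane ≃ᵢ Plane) y)) =
      dist (F t x) (F t y) := fun t h x y => by
    rw [hF, hF, hF, hF, dist_affineFun_mul, dist_affineFun_mul]
    congr 1
    -- The operation `h` preserves distances in the plane and, because `θ h` is an isometry, also
    -- distances measured after the final affine map. It therefore preserves distances measured
    -- after every intermediate one.
    refine norm_add_mul_conj_eq ?_ ?_ t
    · rw [LinearIsometryEquiv.norm_map, LinearIsometryEquiv.norm_map, ← dist_eq_norm,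
        ← dist_eq_norm]
      exact (h : Plane ≃ᵢ Plane).isometry.dist_eq x y
    · have h1 : dist (affineFun a β c ((h : Plane ≃ᵢ Plane) x))
          (affineFun a β c ((h : Plane ≃ᵢ Plane) y)) =
          dist (affineFun a β c x) (affineFun a β c y) := by
        rw [hθ, hθ]
        exact (θ h).isometry.dist_eq _ _
      rw [← haμ, dist_affineFun_mul, dist_affineFun_mul] at h1
      exact mul_left_cancel₀ (norm_ne_zero_iff.2 ha) h1
  refine ⟨F, fun t h => Isometry.of_dist_eq fun x y => ?_, fun h x => ?_, fun h x => ?_,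
    fun h x => ?_⟩
  · rw [hdist, Homeomorph.apply_symm_apply, Homeomorph.apply_symm_apply]
  · have : (F 0).symm x = x := by rw [← hF0 ((F 0).symm x), Homeomorph.apply_symm_apply]
    rw [this, hF0]
  · rw [hF1, hθ, ← hF1, Homeomorph.apply_symm_apply]
  · simp only [hF, hFs]
    have h1 : Continuous fun t : Set.Icc (0 : ℝ) 1 =>
        affineInv (A t) ((t : ℝ) * μ) ((t : ℝ) * c) x := by
      unfold affineInv
      have hd : ∀ t : Set.Icc (0 : ℝ) 1, 1 - (t : ℝ) * μ * conj ((t : ℝ) * μ) ≠ 0 :=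
        fun t => one_sub_mul_conj_ne_zero (hs t)
      have hq : Continuous fun t : Set.Icc (0 : ℝ) 1 =>
          (planeEquiv.symm x - (t : ℝ) * c) / A t :=
        Continuous.div (by fun_prop) (by fun_prop) hA
      refine planeEquiv.continuous.comp (Continuous.div ?_ ?_ hd)
      · exact hq.sub (Continuous.mul (by fun_prop) (Complex.continuous_conj.comp hq))
      · exact continuous_const.sub (Continuous.mul (by fun_prop)
          (Complex.continuous_conj.comp (by fun_prop)))
    have h2 := (h : Plane ≃ᵢ Plane).continuous.comp h1
    unfold affineFun
    refine planeEquiv.continuous.comp ?_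
    have h3 := planeEquiv.symm.continuous.comp h2
    have hAc : Continuous A := by fun_prop
    exact ((hAc.mul h3).add ((hAc.mul (by fun_prop)).mul (Complex.continuous_conj.comp h3))).add
      (by fun_prop)

/-- Complex coordinates of an affine automorphism. -/
theorem exists_affineFun (A : Plane ≃ₗ[ℝ] Plane) (b : Plane) :
    ∃ a β c : ℂ, ‖a‖ ≠ ‖β‖ ∧ ∀ x, A x + b = affineFun a β c x := by
  let f : ℂ →ₗ[ℝ] ℂ := (planeEquiv.symm.toLinearEquiv.toLinearMap.comp A.toLinearMap).comp
    planeEquiv.toLinearEquiv.toLinearMap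
  have hf : ∀ z, A (planeEquiv z) = planeEquiv (f z) := fun z => by simp [f]
  let a := (f 1 - Complex.I * f Complex.I) / 2
  let β := (f 1 + Complex.I * f Complex.I) / 2
  have hfz : ∀ z, f z = a * z + β * conj z := fun z => by
    have h1 : z = (z.re : ℝ) • (1 : ℂ) + (z.im : ℝ) • Complex.I := by
      simp [Complex.re_add_im]
    have h2 : f z = z.re * f 1 + z.im * f Complex.I := by
      conv_lhs => rw [h1]
      rw [map_add, map_smul, map_smul, Complex.real_smul, Complex.real_smul]
    rw [h2]
    simp only [a, β]
    have h3 : conj z = z.re - z.im * Complex.I := by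
      apply Complex.ext <;> simp
    have h4 : z = z.re + z.im * Complex.I := (Complex.re_add_im z).symm
    rw [h3]
    conv_rhs => rw [h4]
    simp only [Complex.add_re, Complex.ofReal_re, Complex.mul_re, Complex.I_re, Complex.I_im,
      Complex.ofReal_im, Complex.add_im, Complex.mul_im]
    ring_nf
    simp only [Complex.I_sq]
    ring
  refine ⟨a, β, planeEquiv.symm b, fun hab => ?_, fun x => ?_⟩
  -- If `‖a‖ = ‖β‖ ≠ 0`, a square root `z` of `-β / a` has modulus `1`, and `a z + β conj z = conj z
  -- (a z² + β) = 0` contradicts injectivity.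
  · have hz : ∃ z : ℂ, z ≠ 0 ∧ f z = 0 := by
      by_cases ha : a = 0
      · have hβ : β = 0 := by rwa [ha, norm_zero, eq_comm, norm_eq_zero] at hab
        exact ⟨1, one_ne_zero, by rw [hfz, ha, hβ]; simp⟩
      · obtain ⟨z, hz⟩ := IsAlgClosed.exists_pow_nat_eq (-β / a) two_pos
        have hn : ‖z‖ ^ 2 = 1 := by
          rw [← norm_pow, hz, norm_div, norm_neg, hab, div_self]
          rw [← hab]
          exact norm_ne_zero_iff.2 ha
        have hzz : z * conj z = 1 := by
          rw [Complex.mul_conj, Complex.normSq_eq_norm_sq, hn, Complex.ofReal_one]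
        have hz0 : z ≠ 0 := by
          rintro rfl
          simp at hzz
        refine ⟨z, hz0, ?_⟩
        have h5 : a * z ^ 2 = -β := by rw [hz]; field_simp
        rw [hfz]
        have : a * z + β * conj z = (a * z ^ 2 + β) * conj z + a * z * (1 - z * conj z) := by ring
        rw [this, h5, hzz]
        ring
    obtain ⟨z, hz0, hz⟩ := hz
    have := hf z
    rw [hz, map_zero, LinearEquiv.map_eq_zero_iff, LinearIsometryEquiv.map_eq_zero_iff] at this
    exact hz0 this
  · obtain ⟨z, rfl⟩ := planeEquiv.surjective x
    rw [hf, hfz, affineFun, LinearIsometryEquiv.symm_apply_apply, map_add planeEquiv _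
      (planeEquiv.symm b), LinearIsometryEquiv.apply_symm_apply]

theorem planeFlip_apply (z : ℂ) : planeFlip (planeEquiv z) = planeEquiv (-conj z) := by
  ext i
  fin_cases i <;> simp [planeFlip, planeEquiv, Complex.orthonormalBasisOneI]

theorem planeFlip_mul_self : planeFlip * planeFlip = 1 := by
  ext1 x
  obtain ⟨z, rfl⟩ := planeEquiv.surjective x
  rw [IsometryEquiv.mul_apply, planeFlip_apply, planeFlip_apply]
  simp

theorem planeFlip_inv : planeFlip⁻¹ = planeFlip := inv_eq_of_mul_eq_one_right planeFlip_mul_self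

/-- The reflection exchanges the holomorphic and antiholomorphic coefficients up to sign, which
reduces orientation reversing affine maps to orientation preserving ones. -/
theorem affineFun_planeFlip (a β c : ℂ) (x : Plane) :
    affineFun a β c (planeFlip x) = affineFun (-β) (-a) c x := by
  obtain ⟨z, rfl⟩ := planeEquiv.surjective x
  rw [planeFlip_apply]
  unfold affineFun
  rw [LinearIsometryEquiv.symm_apply_apply, LinearIsometryEquiv.symm_apply_apply]
  congr 1
  simp only [map_neg, Complex.conj_conj]
  ring

end

section

/-! ### Mirror images, and isotopies along affine maps -/

variable {G G₀ G₁ : Subgroup FibIsom} {k k₀ k₁ : ℝ} {θ : horizontal G₀ →* Plane ≃ᵢ Plane}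
  {D : G₀ → ℝ}

theorem exists_isotopy_of_affineFun (hG₀ : IsFiberedSpaceGroup G₀) (hk₀ : IsFiberLength G₀ k₀)
    (hk₁ : IsFiberLength G₁ k₁) (hint : IsInterval G₁ → IsInterval G₀)
    (hD : IsTwist G₀ G₁ k₀ k₁ θ D) (hsurj : ∀ h ∈ horizontal G₁, ∃ x, θ x = h)
    {a β c : ℂ} (hβ : ‖β‖ < ‖a‖) (hθ : ∀ (h : horizontal G₀) x,
      affineFun a β c ((h : Plane ≃ᵢ Plane) x) = θ h (affineFun a β c x)) :
    ∃ Φ : Isotopy G₀ G₁, ∀ g, (Φ.φ 1 g).1 = θ (toHorizontal G₀ g) := by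
  obtain ⟨F, hF, hF0, hF1, hcont⟩ := exists_affine_path hβ hθ
  obtain ⟨Φ, hΦ⟩ := exists_isotopy hG₀ hk₀ hk₁ hint hD hsurj F hF hF0 hF1 hcont
  refine ⟨Φ, fun g => ?_⟩
  ext1 x
  rw [hΦ, ← hF1, coe_toHorizontal]

theorem mem_mirrorImage {g : FibIsom} :
    g ∈ mirrorImage G ↔ (planeFlip⁻¹ * g.1 * planeFlip, g.2) ∈ G := by
  have key : (MulAut.conj ((planeFlip, 1) : FibIsom)).symm g
      = (planeFlip⁻¹ * g.1 * planeFlip, g.2) := by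
    rw [MulAut.conj_symm_apply]
    ext1 <;> simp
  rw [← key]
  exact Subgroup.mem_map_equiv

theorem one_mem_mirrorImage_iff {v : ℝ ≃ᵢ ℝ} :
    ((1, v) : FibIsom) ∈ mirrorImage G ↔ ((1, v) : FibIsom) ∈ G := by
  rw [mem_mirrorImage]
  simp

theorem mem_horizontal_mirrorImage {h : Plane ≃ᵢ Plane} :
    h ∈ horizontal (mirrorImage G) ↔ planeFlip⁻¹ * h * planeFlip ∈ horizontal G := by
  simp only [mem_horizontal, mem_mirrorImage]

theorem IsFiberLength.mirrorImage (hk : IsFiberLength G k) : IsFiberLength (mirrorImage G) k := by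
  unfold IsFiberLength
  simp only [one_mem_mirrorImage_iff]
  exact hk

theorem isInterval_mirrorImage_iff : IsInterval (mirrorImage G) ↔ IsInterval G := by
  unfold IsInterval
  simp only [one_mem_mirrorImage_iff]

theorem IsFiberedSpaceGroup.mirrorImage (hG : IsFiberedSpaceGroup G) :
    IsFiberedSpaceGroup (mirrorImage G) := by
  obtain ⟨k, hk⟩ := hG.exists_isFiberLength
  have hF : ∀ h : horizontal G, Isometry fun x => planeFlip.toHomeomorph
      ((h : Plane ≃ᵢ Plane) (planeFlip.toHomeomorph.symm x)) := fun h =>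
    planeFlip.isometry.comp (h.1.isometry.comp planeFlip.symm.isometry)
  have e : (conjHom _ hF).range = horizontal (Fibrifold.mirrorImage G) := by
    ext h
    rw [mem_horizontal_mirrorImage]
    constructor
    · rintro ⟨x, rfl⟩
      convert x.2 using 1
      ext1 p
      change planeFlip.symm (planeFlip (x.1 (planeFlip.symm (planeFlip p)))) = x.1 p
      simp
    · intro hh
      refine ⟨⟨_, hh⟩, ?_⟩
      ext1 p
      change planeFlip (planeFlip.symm (h (planeFlip (planeFlip.symm p)))) = h p
      simp
  exact IsCrystallographic.isFiberedSpaceGroup (e ▸ hG.isCrystallographic.range_conjHom)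
    hk.mirrorImage

/-- Conjugation by the reflection, as a homomorphism of plane groups. -/
def unmirror (G : Subgroup FibIsom) : horizontal (mirrorImage G) →* horizontal G where
  toFun h := ⟨planeFlip⁻¹ * h * planeFlip, mem_horizontal_mirrorImage.1 h.2⟩
  map_one' := by ext1; simp
  map_mul' g h := by ext1; simp [mul_assoc]

@[simp] theorem coe_unmirror (h : horizontal (mirrorImage G)) :
    (unmirror G h : Plane ≃ᵢ Plane) = planeFlip⁻¹ * h * planeFlip := rfl

theorem unmirror_surjective : Function.Surjective (unmirror G) := fun h =>
  ⟨⟨planeFlip * h * planeFlip⁻¹, mem_horizontal_mirrorImage.2 (by simp [mul_assoc])⟩,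
    by ext1; simp [mul_assoc]⟩

theorem IsTwist.mirrorImage (hD : IsTwist G₀ G₁ k₀ k₁ θ D) :
    IsTwist (mirrorImage G₀) G₁ k₀ k₁ (θ.comp (unmirror G₀))
      fun g => D ⟨_, mem_mirrorImage.1 g.2⟩ where
  map_mul g g' := by
    rw [← hD.map_mul]
    congr 1
    ext1
    ext1 <;> simp [mul_assoc]
  vertical g h1 h2 := hD.vertical _ (by simp [h1]) h2
  mem g := hD.mem ⟨_, mem_mirrorImage.1 g.2⟩

theorem affineFun_unmirror {a β c : ℂ} (hθ : ∀ (h : horizontal G₀) x,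
      affineFun a β c ((h : Plane ≃ᵢ Plane) x) = θ h (affineFun a β c x))
    (h : horizontal (mirrorImage G₀)) (x : Plane) :
    affineFun (-β) (-a) c ((h : Plane ≃ᵢ Plane) x)
      = θ.comp (unmirror G₀) h (affineFun (-β) (-a) c x) := by
  rw [← affineFun_planeFlip, ← affineFun_planeFlip, MonoidHom.comp_apply, ← hθ]
  congr 1
  have : planeFlip (planeFlip x) = x := by
    rw [← IsometryEquiv.mul_apply, planeFlip_mul_self, IsometryEquiv.coe_one, id]
  rw [coe_unmirror, planeFlip_inv, IsometryEquiv.mul_apply, IsometryEquiv.mul_apply, this]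

/-! ### From equal names to isotopies -/

variable {σ : OrbifoldSymbol} {s s₀ s₁ : Gen σ → (Plane ≃ᵢ Plane)} {N : Name σ}

/-- The name determines the coupling maps over a given plane group up to isotopy. -/
theorem HasName.exists_isotopy_horizontal (hσ : σ.NoRingOrTorus) (hG₀ : IsFiberedSpaceGroup G₀)
    (hs₀ : IsStandard (horizontal G₀) s) (hs₁ : IsStandard (horizontal G₁) s)
    (hN₀ : HasName G₀ s N) (hN₁ : HasName G₁ s N) :
    ∃ Φ : Isotopy G₀ G₁, ∀ t g, (Φ.φ t g).1 = (g : FibIsom).1 := by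
  obtain ⟨k₀, k₁, D, hk₀, hk₁, hD⟩ := hN₀.exists_isTwist hσ hs₀ hs₁ hN₁
    (θ := (horizontal G₀).subtype) fun _ => rfl
  obtain ⟨θ, hθ⟩ := hs₀.exists_mulEquiv hs₁
  -- The isomorphism fixes the common generators, so it is the inclusion and the two plane groups
  -- coincide; the plane then need not move during the isotopy.
  have htop := hs₀.eq_top (K := MonoidHom.eqLocus
    ((horizontal G₁).subtype.comp θ.toMonoidHom) (horizontal G₀).subtype) hθ
  obtain ⟨Φ, hΦ⟩ := exists_isotopy hG₀ hk₀ hk₁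
    (fun h => hN₀.isInterval_iff.1 (hN₁.isInterval_iff.2 h)) hD
    (fun h hh => by
      obtain ⟨x, hx⟩ := θ.surjective ⟨h, hh⟩
      have hx' : (θ x : Plane ≃ᵢ Plane) = x := (htop ▸ Subgroup.mem_top x : x ∈ MonoidHom.eqLocus
        ((horizontal G₁).subtype.comp θ.toMonoidHom) (horizontal G₀).subtype)
      exact ⟨x, by rw [Subgroup.subtype_apply, ← hx', hx]⟩)
    (fun _ => Homeomorph.refl Plane) (fun _ h => h.1.isometry) (fun _ _ => rfl) (fun _ _ => rfl)
    (fun _ _ => continuous_const)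
  exact ⟨Φ, fun t g => IsometryEquiv.ext fun x => hΦ t g x⟩

/-- The name determines the fibered space group up to isotopy and mirror images. -/
theorem HasName.exists_isotopy_or_mirrorImage (hσ : σ.NoRingOrTorus)
    (hG₀ : IsFiberedSpaceGroup G₀) (hG₁ : IsFiberedSpaceGroup G₁)
    (hs₀ : IsStandard (horizontal G₀) s₀) (hs₁ : IsStandard (horizontal G₁) s₁)
    (hN₀ : HasName G₀ s₀ N) (hN₁ : HasName G₁ s₁ N) :
    (∃ Φ : Isotopy G₀ G₁, ∀ (g : G₀) x, (g : FibIsom).1 = s₀ x → (Φ.φ 1 g).1 = s₁ x) ∨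
      ∃ Φ : Isotopy (mirrorImage G₀) G₁, ∀ (g : mirrorImage G₀) x,
        (g : FibIsom).1 = planeFlip * s₀ x * planeFlip⁻¹ → (Φ.φ 1 g).1 = s₁ x := by
  obtain ⟨θ, hθ⟩ := hs₀.exists_mulEquiv hs₁
  obtain ⟨k₀, k₁, D, hk₀, hk₁, hD⟩ := hN₀.exists_isTwist hσ hs₀ hs₁ hN₁
    (θ := (horizontal G₁).subtype.comp θ.toMonoidHom) hθ
  have hint : IsInterval G₁ → IsInterval G₀ := fun h =>
    hN₀.isInterval_iff.1 (hN₁.isInterval_iff.2 h)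
  have hsurj : ∀ h ∈ horizontal G₁, ∃ x, (horizontal G₁).subtype.comp θ.toMonoidHom x = h :=
    fun h hh => (θ.surjective ⟨h, hh⟩).imp fun x hx => congrArg Subtype.val hx
  obtain ⟨A, b, hA⟩ := exists_affine_conj hG₀.isCrystallographic hG₁.isCrystallographic θ
  obtain ⟨a, β, c, hab, hf⟩ := exists_affineFun A b
  have hAf : ∀ (h : horizontal G₀) x, affineFun a β c ((h : Plane ≃ᵢ Plane) x)
      = (horizontal G₁).subtype.comp θ.toMonoidHom h (affineFun a β c x) := fun h x => by
    rw [← hf, ← hf]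
    exact hA h x
  -- When `‖a‖ < ‖β‖` the affine map reverses orientation and cannot be joined to the identity;
  -- after the reflection it can.
  rcases hab.lt_or_gt with h | h
  · right
    obtain ⟨Φ, hΦ⟩ := exists_isotopy_of_affineFun hG₀.mirrorImage hk₀.mirrorImage hk₁
      (fun h => isInterval_mirrorImage_iff.2 (hint h)) hD.mirrorImage
      (fun h hh => by
        obtain ⟨x, hx⟩ := hsurj h hh
        obtain ⟨y, rfl⟩ := unmirror_surjective x
        exact ⟨y, hx⟩)
      (by rwa [norm_neg, norm_neg]) (affineFun_unmirror hAf)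
    refine ⟨Φ, fun g x hg => ?_⟩
    have e : unmirror G₀ (toHorizontal _ g) = ⟨s₀ x, hs₀.mem x⟩ := by
      ext1
      rw [coe_unmirror, coe_toHorizontal, hg]
      simp [mul_assoc]
    rw [hΦ, MonoidHom.comp_apply, e]
    exact hθ x
  · left
    obtain ⟨Φ, hΦ⟩ := exists_isotopy_of_affineFun hG₀ hk₀ hk₁ hint hD hsurj h hAf
    refine ⟨Φ, fun g x hg => ?_⟩
    have e : toHorizontal G₀ g = ⟨s₀ x, hs₀.mem x⟩ := Subtype.ext hg
    rw [hΦ, e]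
    exact hθ x

end

end Fibrifold

end

theorem mainTheorem7 (σ : OrbifoldSymbol) (hσ : σ ∈ euclideanSymbols) :
    -- every fibered space group over a plane group with symbol `σ` has a name, and exactly one
    -- for each admissible system of standard generators
    (∀ (G : Subgroup FibIsom) (s : Gen σ → (Plane ≃ᵢ Plane)),
      IsFiberedSpaceGroup G → IsStandard (horizontal G) s →
        (IsAdmissible G s → ∃! N : Name σ, HasName G s N) ∧
        ∃ s' : Gen σ → (Plane ≃ᵢ Plane), IsStandard (horizontal G) s' ∧ IsAdmissible G s') ∧
    ∀ (G₀ G₁ : Subgroup FibIsom) (s₀ s₁ : Gen σ → (Plane ≃ᵢ Plane)) (N : Name σ),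
      IsFiberedSpaceGroup G₀ → IsFiberedSpaceGroup G₁ →
      IsStandard (horizontal G₀) s₀ → IsStandard (horizontal G₁) s₁ →
      HasName G₀ s₀ N → HasName G₁ s₁ N →
        -- over a given plane group, the name determines the coupling maps up to isotopy
        (s₀ = s₁ → ∃ Φ : Isotopy G₀ G₁, ∀ t g, (Φ.φ t g).1 = (g : FibIsom).1) ∧
        -- the name determines the fibered space group up to isotopy (and mirror images)
        ((∃ Φ : Isotopy G₀ G₁, ∀ (g : G₀) x, (g : FibIsom).1 = s₀ x → (Φ.φ 1 g).1 = s₁ x) ∨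
          ∃ Φ : Isotopy (mirrorImage G₀) G₁,
            ∀ (g : mirrorImage G₀) x,
              (g : FibIsom).1 = planeFlip * s₀ x * planeFlip⁻¹ → (Φ.φ 1 g).1 = s₁ x) := by
  have hσ' := noRingOrTorus_of_mem hσ
  refine ⟨fun G s hG hs => ⟨fun ha => ?_, exists_isAdmissible hσ' hG hs⟩,
    fun G₀ G₁ s₀ s₁ N hG₀ hG₁ hs₀ hs₁ hN₀ hN₁ => ⟨?_,
      hN₀.exists_isotopy_or_mirrorImage hσ' hG₀ hG₁ hs₀ hs₁ hN₁⟩⟩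
  · obtain ⟨N, hN⟩ := exists_hasName (posDigits_of_mem hσ) hG hs ha
    exact ⟨N, hN, fun N' hN' => hN'.unique hN⟩
  · rintro rfl
    exact hN₀.exists_isotopy_horizontal hσ' hG₀ hs₀ hs₁ hN₁
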